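/- Let $S=\{\infty\}\cup S_f$, where $S_f$ is a finite (possibly empty) set of primes, let $d\ge 1$, and write $\mathbb Q_\infty=\mathbb R$. For a prime $p$ let $\mathrm{UL}_d(\mathbb Q_p)=\{g\in\mathrm{GL}_d(\mathbb Q_p): |\det g|_p=1\}$, and let $\mathrm{UL}_d(\mathbb R)=\mathrm{SL}_d(\mathbb R)$. Put $\mathrm{UL}_d(\mathbb Q_S)=\prod_{p\in S}\mathrm{UL}_d(\mathbb Q_p)$ and $\mathrm{SL}_d(\mathbb Q_S)=\prod_{p\in S}\mathrm{SL}_d(\mathbb Q_p)$. Let $\mathbb Z_S=\{z\in\mathbb Q: |z|_p\le 1\text{ for all primes }p\notin S_f\}$, and let $\mathrm{SL}_d(\mathbb Z_S)\subset\mathrm{SL}_d(\mathbb Q_S)$ and $\mathrm{UL}_d(\mathbb Z_S)\subset\mathrm{UL}_d(\mathbb Q_S)$ be the subgroups of the diagonally embedded matrices of $\mathrm{SL}_d(\mathbb Z_S)$, respectively of the diagonally embedded matrices of $\mathrm{GL}_d(\mathbb Z_S)$ that lie in $\mathrm{UL}_d(\mathbb Q_S)$. Equip $\mathbb R^k$ with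 Lebesgue measure, and $\mathbb Q_p^k$ with the Haar measure giving $\mathbb Z_p^k$ mass $1$. Define measures $\nu_p^{(d)}$ on $\mathrm{SL}_d(\mathbb Q_p)$ ($p\in S$) and $\mu_p^{(d)}$ on $\mathrm{UL}_d(\mathbb Q_p)$ ($p\in S_f$) inductively. The measure $\nu_p^{(1)}$ has mass $1$ on the trivial group $\mathrm{SL}_1(\mathbb Q_p)$, and $\mu_p^{(1)}$ is the restriction of the Haar measure of $\mathbb Q_p$ to $\mathrm{UL}_1(\mathbb Q_p)=\mathbb Z_p\setminus p\mathbb Z_p$, of total mass $1-1/p$. For $d\ge2$, $\nu_p^{(d)}$ and $\mu_p^{(d)}$ are the push-forwards of $d\mathbf v'\,d\nu_p^{(d-1)}(g')\,d\mathbf y$ and $d\mathbf v'\,d\mu_p^{(d-1)}(g')\,d\mathbf y$ under $$\Phi_p(\mathbf v',g',\mathbf y)=\begin{pmatrix}1&0\\ {}^{\mathrm t}\mathbf v'&g'\end{pmatrix}\begin{pmatrix}y_1&(y_2,\dots,y_d)\\ 0&\mathrm{diag}(1/y_1,1,\dots,1)\end{pmatrix},$$ where $\mathbf v'\in\mathbb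 Q_p^{d-1}$, $\mathbf y\in\mathbb Q_p^d$, $y_1\ne0$, and $g'$ lies in $\mathrm{SL}_{d-1}(\mathbb Q_p)$, respectively $\mathrm{UL}_{d-1}(\mathbb Q_p)$. Put $\mu_\infty^{(d)}=\nu_\infty^{(d)}$, $\mu_S^{(d)}=\prod_{p\in S}\mu_p^{(d)}$ and $\nu_S^{(d)}=\prod_{p\in S}\nu_p^{(d)}$. For $k\ge2$ let $$\zeta_S(k)=\sum_{t\in\mathbb N_S}t^{-k},\qquad \mathbb N_S=\{t\ge1:\gcd(t,p)=1\text{ for all }p\in S_f\}.$$ Then $\mu_S^{(d)}$ and $\nu_S^{(d)}$ are Haar measures on $\mathrm{UL}_d(\mathbb Q_S)$ and $\mathrm{SL}_d(\mathbb Q_S)$, and $$\mu_S^{(d)}\big(\mathrm{UL}_d(\mathbb Z_S)\backslash\mathrm{UL}_d(\mathbb Q_S)\big)=\prod_{p\in S_f}\Big(1-\frac1p\Big)\cdot\zeta_S(d)\zeta_S(d-1)\cdots\zeta_S(2),$$ $$\nu_S^{(d)}\big(\mathrm{SL}_d(\mathbb Z_S)\backslash\mathrm{SL}_d(\mathbb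 Q_S)\big)=\zeta_S(d)\zeta_S(d-1)\cdots\zeta_S(2),$$ where for $d=1$ the product of zeta values is empty. Here $\mu(\Gamma\backslash G)=c$ means that the left translation action of $\Gamma$ on $G$ has a measurable fundamental domain (its $\Gamma$-translates are pairwise disjoint and cover $G$ up to $\mu$-null sets), and that every such fundamental domain has $\mu$-measure $c$. -/

import Mathlib

open MeasureTheory Matrix
open scoped MatrixGroups

noncomputable section

/-! ### The local fields and their Haar measures -/

instance factPrimeOfPrimes (p : Nat.Primes) : Fact (p : ℕ).Prime := ⟨p.2⟩

/-- The compact neighbourhood `ℤ_p = {x : |x|_p ≤ 1}` of `0` in `ℚ_p`. -/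
def padicUnitBall (p : ℕ) [Fact p.Prime] : TopologicalSpace.PositiveCompacts ℚ_[p] where
  carrier := Metric.closedBall 0 1
  isCompact' := isCompact_closedBall 0 1
  interior_nonempty' :=
    ⟨0, interior_mono Metric.ball_subset_closedBall
      (by rw [Metric.isOpen_ball.interior_eq]; exact Metric.mem_ball_self one_pos)⟩

instance padicMeasurableSpace (p : ℕ) [Fact p.Prime] : MeasurableSpace ℚ_[p] := borel _

instance padicBorelSpace (p : ℕ) [Fact p.Prime] : BorelSpace ℚ_[p] := ⟨rfl⟩

/-- `volume` on `ℚ_p` is the additive Haar measure with `volume ℤ_p = 1`. Consequently `volume` on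
`Fin d → ℚ_p` is the product measure, giving mass `1` to `ℤ_p ^ d`. (On `ℝ` and `Fin d → ℝ`,
`volume` is Lebesgue measure.) -/
instance padicMeasureSpace (p : ℕ) [Fact p.Prime] : MeasureSpace ℚ_[p] where
  volume := Measure.addHaarMeasure (padicUnitBall p)

/-! ### The groups `SL_d(K)` and `UL_d(K)` -/

instance slMeasurableSpace (K : Type) [NormedField K] (d : ℕ) :
    MeasurableSpace (SpecialLinearGroup (Fin d) K) := borel _

instance slBorelSpace (K : Type) [NormedField K] (d : ℕ) :
    BorelSpace (SpecialLinearGroup (Fin d) K) := ⟨rfl⟩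

/-- `UL_d(K) = {g ∈ GL_d(K) : |det g| = 1}`. -/
def UL (d : ℕ) (K : Type) [NormedField K] : Subgroup (GL (Fin d) K) where
  carrier := {g | ‖(g : Matrix (Fin d) (Fin d) K).det‖ = 1}
  one_mem' := by simp
  mul_mem' := by
    intro a b ha hb
    simp only [Set.mem_ofPred_eq] at ha hb ⊢
    rw [GeneralLinearGroup.coe_mul, det_mul, norm_mul, ha, hb, one_mul]
  inv_mem' := by
    intro a ha
    simp only [Set.mem_ofPred_eq] at ha ⊢
    have h : ‖((a * a⁻¹ : GL (Fin d) K) : Matrix (Fin d) (Fin d) K).det‖ = 1 := by simp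
    rwa [GeneralLinearGroup.coe_mul, det_mul, norm_mul, ha, one_mul] at h

instance ulMeasurableSpace (K : Type) [NormedField K] (d : ℕ) :
    MeasurableSpace (UL d K) := borel _

instance ulBorelSpace (K : Type) [NormedField K] (d : ℕ) :
    BorelSpace (UL d K) := ⟨rfl⟩

/-! ### The coordinates `Φ` -/

/-- The block matrix with first row `(1, 0, …, 0)` and remaining rows `(v i, M i)`. -/
def lowerBlock {K : Type} [Field K] {n : ℕ} (v : Fin (n + 1) → K)
    (M : Matrix (Fin (n + 1)) (Fin (n + 1)) K) : Matrix (Fin (n + 2)) (Fin (n + 2)) K :=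
  Matrix.of (Fin.cons (Fin.cons 1 0) (fun i => Fin.cons (v i) (M i)))

/-- The matrix with first row `y`, with diagonal `(y 0, 1 / y 0, 1, …, 1)`, and with zeros
everywhere else. -/
def upperRow {K : Type} [Field K] {n : ℕ} (y : Fin (n + 2) → K) :
    Matrix (Fin (n + 2)) (Fin (n + 2)) K :=
  Matrix.of fun i j => if i = 0 then y j else if i = j then (if i = 1 then 1 / y 0 else 1) else 0

theorem det_lowerBlock {K : Type} [Field K] {n : ℕ} (v : Fin (n + 1) → K)
    (M : Matrix (Fin (n + 1)) (Fin (n + 1)) K) : (lowerBlock v M).det = M.det := by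
  rw [det_succ_row_zero, Fin.sum_univ_succ]
  simp only [lowerBlock, of_apply, Fin.cons_zero, Fin.cons_succ, Pi.zero_apply, mul_zero, zero_mul,
    Finset.sum_const_zero, add_zero, Fin.val_zero, pow_zero, one_mul]
  congr 1

theorem det_upperRow {K : Type} [Field K] {n : ℕ} (y : Fin (n + 2) → K) (hy : y 0 ≠ 0) :
    (upperRow y).det = 1 := by
  have h : (upperRow y).BlockTriangular id := by
    intro i j hij
    have hij' : j < i := hij
    have h0 : i ≠ 0 := by rintro rfl; exact absurd hij' (by simp)
    simp [upperRow, h0, hij'.ne']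
  rw [det_of_isUpperTriangular h, Fin.prod_univ_succ, Fin.prod_univ_succ]
  have h1 : ∀ i : Fin n, (i.succ.succ : Fin (n + 2)) ≠ 1 := by
    intro i hi
    have := congrArg Fin.val hi
    simp at this
  simp [upperRow, h1, hy]

/-- `Φ : (v', g', y) ↦ (1 0; v' g') · (y; 0 diag(1 / y 0, 1, …, 1))`, into `SL`. -/
def slPhi {K : Type} [Field K] {n : ℕ}
    (x : ((Fin (n + 1) → K) × SpecialLinearGroup (Fin (n + 1)) K) ×
      {y : Fin (n + 2) → K // y 0 ≠ 0}) : SpecialLinearGroup (Fin (n + 2)) K :=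
  ⟨lowerBlock x.1.1 x.1.2.1 * upperRow x.2.1, by
    rw [det_mul, det_lowerBlock, det_upperRow _ x.2.2, x.1.2.2, one_mul]⟩

/-- `Φ : (v', g', y) ↦ (1 0; v' g') · (y; 0 diag(1 / y 0, 1, …, 1))`, into `UL`. -/
def ulPhi {K : Type} [NormedField K] {n : ℕ}
    (x : ((Fin (n + 1) → K) × UL (n + 1) K) ×
      {y : Fin (n + 2) → K // y 0 ≠ 0}) : UL (n + 2) K :=
  have hdet : ‖(lowerBlock x.1.1 (x.1.2.1 : Matrix (Fin (n + 1)) (Fin (n + 1)) K) *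
      upperRow x.2.1).det‖ = 1 := by
    rw [det_mul, det_lowerBlock, det_upperRow _ x.2.2, mul_one]
    exact x.1.2.2
  ⟨GeneralLinearGroup.mkOfDetNeZero
      (lowerBlock x.1.1 (x.1.2.1 : Matrix (Fin (n + 1)) (Fin (n + 1)) K) * upperRow x.2.1)
      (fun h => by rw [h, norm_zero] at hdet; exact zero_ne_one hdet), hdet⟩

/-- The `1 × 1` matrix with entry `u`, as an element of `UL_1(K)`, for `|u| = 1`. -/
def ulOne {K : Type} [NormedField K] (u : {u : K // ‖u‖ = 1}) : UL 1 K :=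
  have hdet : ‖(Matrix.of fun _ _ => u.1 : Matrix (Fin 1) (Fin 1) K).det‖ = 1 := by
    rw [det_fin_one, of_apply]
    exact u.2
  ⟨GeneralLinearGroup.mkOfDetNeZero (Matrix.of fun _ _ => u.1)
      (fun h => by rw [h, norm_zero] at hdet; exact zero_ne_one hdet), hdet⟩

/-! ### The inductively normalized measures -/

/-- The measure `ν^{(d)}` on `SL_d(K)`, `d ≥ 1`: total mass `1` on the trivial group `SL_1(K)`, and
then the push-forward of `dv' dν^{(d-1)}(g') dy` under `Φ`. (The value at `d = 0` is unused.) -/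
def slMeasure (K : Type) [NormedField K] [MeasureSpace K] :
    (d : ℕ) → Measure (SpecialLinearGroup (Fin d) K)
  | 0 => 0
  | 1 => Measure.dirac 1
  | n + 2 => Measure.map slPhi
      (((volume : Measure (Fin (n + 1) → K)).prod (slMeasure K (n + 1))).prod
        (Measure.comap Subtype.val (volume : Measure (Fin (n + 2) → K))))

/-- The measure `μ^{(d)}` on `UL_d(K)`, `d ≥ 1`: the restriction of the Haar measure of `K` to the
elements of norm one (for `K = ℚ_p`: to `ℤ_p \ pℤ_p`, of mass `1 - 1/p`) on `UL_1(K)`, and then the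
push-forward of `dv' dμ^{(d-1)}(g') dy` under `Φ`. (The value at `d = 0` is unused.) -/
def ulMeasure (K : Type) [NormedField K] [MeasureSpace K] : (d : ℕ) → Measure (UL d K)
  | 0 => 0
  | 1 => Measure.map ulOne (Measure.comap Subtype.val (volume : Measure K))
  | n + 2 => Measure.map ulPhi
      (((volume : Measure (Fin (n + 1) → K)).prod (ulMeasure K (n + 1))).prod
        (Measure.comap Subtype.val (volume : Measure (Fin (n + 2) → K))))

/-! ### The `S`-arithmetic groups; `S` is the set of finite places, `∞` is always included -/

/-- The ring of `S`-integers, as a subring of `ℚ`. -/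
def SInt (S : Finset Nat.Primes) : Subring ℚ where
  carrier := {z | ∀ p : Nat.Primes, p ∉ S → padicNorm p z ≤ 1}
  zero_mem' := by intro p _; simp
  one_mem' := by intro p _; simp
  add_mem' := by
    intro a b ha hb p hp
    exact padicNorm.nonarchimedean.trans (max_le (ha p hp) (hb p hp))
  mul_mem' := by
    intro a b ha hb p hp
    rw [padicNorm.mul]
    exact mul_le_one₀ (ha p hp) (padicNorm.nonneg _) (hb p hp)
  neg_mem' := by
    intro a ha p hp
    rw [padicNorm.neg]
    exact ha p hp

/-- The embedding of the `S`-integers in a field of characteristic zero (here `ℝ` or `ℚ_p`). -/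
def sIntHom (S : Finset Nat.Primes) (K : Type) [Field K] [CharZero K] : SInt S →+* K :=
  (Rat.castHom K).comp (SInt S).subtype

/-- `SL_d(ℚ_S) = SL_d(ℝ) × ∏_{p ∈ S_f} SL_d(ℚ_p)`. -/
abbrev SLQS (S : Finset Nat.Primes) (d : ℕ) : Type :=
  SpecialLinearGroup (Fin d) ℝ × (∀ p : S, SpecialLinearGroup (Fin d) ℚ_[(p : Nat.Primes)])

/-- `UL_d(ℚ_S) = UL_d(ℝ) × ∏_{p ∈ S_f} UL_d(ℚ_p)`, where by convention `UL_d(ℝ) = SL_d(ℝ)`. -/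
abbrev ULQS (S : Finset Nat.Primes) (d : ℕ) : Type :=
  SpecialLinearGroup (Fin d) ℝ × (∀ p : S, UL d ℚ_[(p : Nat.Primes)])

/-- `SL_d(ℤ_S)`, diagonally embedded in `SL_d(ℚ_S)`. -/
def SLZS (S : Finset Nat.Primes) (d : ℕ) : Subgroup (SLQS S d) :=
  ((SpecialLinearGroup.map (sIntHom S ℝ)).prod
    (MonoidHom.pi fun p : S => SpecialLinearGroup.map (sIntHom S ℚ_[(p : Nat.Primes)]))).range

/-- `UL_d(ℤ_S)`: the elements of `UL_d(ℚ_S)` that come from a matrix in `GL_d(ℤ_S)`, diagonally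
embedded. -/
def ULZS (S : Finset Nat.Primes) (d : ℕ) : Subgroup (ULQS S d) where
  carrier := {g | ∃ γ : GL (Fin d) (SInt S),
    (g.1 : GL (Fin d) ℝ) = GeneralLinearGroup.map (sIntHom S ℝ) γ ∧
    ∀ p : S, (g.2 p : GL (Fin d) ℚ_[(p : Nat.Primes)]) =
      GeneralLinearGroup.map (sIntHom S ℚ_[(p : Nat.Primes)]) γ}
  one_mem' := ⟨1, by simp, by simp⟩
  mul_mem' := by
    rintro a b ⟨γ, h, h'⟩ ⟨δ, k, k'⟩
    exact ⟨γ * δ, by simp [h, k], fun p => by simp [h', k']⟩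
  inv_mem' := by
    rintro a ⟨γ, h, h'⟩
    refine ⟨γ⁻¹, ?_, fun p => ?_⟩
    · rw [map_inv, ← h, Prod.fst_inv, map_inv]
    · rw [map_inv, ← h' p, Prod.snd_inv, Pi.inv_apply, Subgroup.coe_inv]

/-- `ν_S^{(d)} = ∏_{p ∈ S} ν_p^{(d)}`. -/
def nuS (S : Finset Nat.Primes) (d : ℕ) : Measure (SLQS S d) :=
  (slMeasure ℝ d).prod (Measure.pi fun p : S => slMeasure ℚ_[(p : Nat.Primes)] d)

/-- `μ_S^{(d)} = ∏_{p ∈ S} μ_p^{(d)}`, where `μ_∞^{(d)} = ν_∞^{(d)}` since `UL_d(ℝ) = SL_d(ℝ)`. -/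
def muS (S : Finset Nat.Primes) (d : ℕ) : Measure (ULQS S d) :=
  (slMeasure ℝ d).prod (Measure.pi fun p : S => ulMeasure ℚ_[(p : Nat.Primes)] d)

/-- The measure of `Γ \ G` for the measure induced by `μ` is `c`: the left translation action of
`Γ` on `G` has a fundamental domain, and every fundamental domain has `μ`-measure `c`. -/
def HasCovolume {G : Type} [Group G] [MeasurableSpace G] (Γ : Subgroup G) (μ : Measure G)
    (c : ENNReal) : Prop :=
  (∃ F : Set G, IsFundamentalDomain Γ F μ) ∧ ∀ F : Set G, IsFundamentalDomain Γ F μ → μ F = c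

/-- `ζ_S(k) = ∑ t^{-k}`, over the positive integers `t` coprime to all primes in `S`. -/
def zetaS (S : Finset Nat.Primes) (k : ℕ) : ℝ :=
  ∑' t : {t : ℕ // 0 < t ∧ Nat.Coprime t (∏ p ∈ S, (p : ℕ))}, 1 / (t : ℝ) ^ k

end

/-! The coordinates `Φ` fibre SL_d over its first row: the product has first row y, and the left
factor runs over the stabilizer of the first basis row vector e₁, a semidirect product of K^(d-1)
and SL_(d-1)(K). Everything is an induction on d along this fibration.

Haar property. Right multiplication by g replaces y by yg, which preserves volume, and multiplies
the stabilizer factor on the right; so right invariance passes from d-1 to d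
(`slMeasure_isMulRightInvariant`). In characteristic zero SL_d has no nontrivial homomorphism to an
abelian group, hence is unimodular, and right invariance gives left invariance.

The real place (Siegel). The primitive vectors are the orbit e₁ SL_d(ℤ), with stabilizer ℤ^(d-1) ⋊
SL_(d-1)(ℤ). Unfolding shows that the integral over a fundamental domain of the sum of f(wg) over
primitive w is the covolume in dimension d-1 times ∫ f (`lintegral_tsum_primitive`). Every nonzero
integral vector is a unique positive multiple of a primitive one, so the sum over all of them brings
in ζ(d). For f the normalized indicator of a large cube this sum tends to 1, because ℤ^d g has
covolume 1; passing to the limit under the integral gives the recursion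
`slMeasure_strictDomain_succ`.

The finite places. The rows of elements of SL_d(ℤ_p) are the vectors of norm one, and all fibres
over them have equal mass, so SL_d(ℤ_p) has measure ∏ (1 - p^(-k)) over 2 ≤ k ≤ d
(`slMeasure_slIntegral`). On UL_d(ℚ_p) the measure is the product of the one on SL_d and the one on
the units, embedded as diag(1, …, 1, u) (`ulMeasure_eq_map`), which accounts for the factors 1 -
1/p.

Gluing. By strong approximation SL_d(ℤ_S) is dense in the product of the SL_d(ℚ_p), and its elements
integral at all p in S form SL_d(ℤ). Hence a fundamental domain for SL_d(ℤ) times ∏ SL_d(ℤ_p) is one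
for SL_d(ℤ_S) (`isStrictDomain_slDomain`). The local volumes remove the Euler factors at S from ζ
(`ofReal_zetaS`). The real component forces determinant 1, so UL_d(ℤ_S) is just SL_d(ℤ_S)
(`ulDiagHom_range`). -/

noncomputable section

set_option linter.unusedSectionVars false

/-! ### The underlying matrix of an element of `SL` -/

section ToMat

variable {ι : Type*} [Fintype ι] [DecidableEq ι] {R : Type*} [CommRing R]

/-- The underlying matrix of an element of `SL`. -/
def toMat (g : SpecialLinearGroup ι R) : Matrix ι ι R := g.1

theorem toMat_injective : Function.Injective (toMat : SpecialLinearGroup ι R → Matrix ι ι R) :=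
  Subtype.val_injective

@[simp] theorem toMat_mul (A B : SpecialLinearGroup ι R) : toMat (A * B) = toMat A * toMat B := rfl

@[simp] theorem toMat_one : toMat (1 : SpecialLinearGroup ι R) = 1 := rfl

@[simp] theorem toMat_mk (A : Matrix ι ι R) (h : A.det = 1) :
    toMat (⟨A, h⟩ : SpecialLinearGroup ι R) = A := rfl

@[simp] theorem det_toMat (A : SpecialLinearGroup ι R) : (toMat A).det = 1 := A.2

@[simp] theorem toMat_map {S : Type*} [CommRing S] (f : R →+* S) (A : SpecialLinearGroup ι R) :
    toMat (SpecialLinearGroup.map f A) = (toMat A).map f := rfl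

theorem toMat_transvection {F : Type*} [Field F] {i j : ι} (hij : i ≠ j) (c : F) :
    toMat (SpecialLinearGroup.transvection hij c) = 1 + Matrix.single i j c := rfl

theorem toMat_diag2n {F : Type*} [Field F] {i j : ι} (hij : i ≠ j) (a : F) (ha : a ≠ 0) :
    toMat (SpecialLinearGroup.diag2n hij a ha) =
      diagonal (fun k => if k = i then a else if k = j then a⁻¹ else 1) := rfl

theorem continuous_toMat [TopologicalSpace R] :
    Continuous (toMat : SpecialLinearGroup ι R → Matrix ι ι R) := continuous_subtype_val

end ToMat

/-! ### Generation of `SL_d(K)` by transvections -/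

section Generation

variable {ι : Type*} [Fintype ι] [DecidableEq ι] {F : Type*} [Field F]

/-- The first three factors form the Weyl element w(c), the last three form w(-1), and h(c) = w(c)
w(-1). -/
theorem diag2n_eq_transvections {i j : ι} (hij : i ≠ j) {c : F} (hc : c ≠ 0) :
    SpecialLinearGroup.diag2n hij c hc =
      SpecialLinearGroup.transvection hij c * SpecialLinearGroup.transvection hij.symm (-c⁻¹) *
      SpecialLinearGroup.transvection hij c * SpecialLinearGroup.transvection hij (-1) *
      SpecialLinearGroup.transvection hij.symm 1 * SpecialLinearGroup.transvection hij (-1) := by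
  apply toMat_injective
  simp only [toMat_mul, toMat_transvection]
  have e : toMat (SpecialLinearGroup.diag2n hij c hc) =
      1 + Matrix.single i i (c - 1) + Matrix.single j j (c⁻¹ - 1) := by
    ext a b
    rw [toMat_diag2n]
    simp only [diagonal_apply, Matrix.add_apply, Matrix.one_apply, Matrix.single_apply]
    grind
  rw [e]
  simp only [mul_add, add_mul, Matrix.single_mul_single_same, one_mul, mul_one,
    Matrix.single_mul_single_of_ne _ _ _ _ hij, Matrix.single_mul_single_of_ne _ _ _ _ hij.symm]
  ext a b
  simp only [Matrix.add_apply, Matrix.one_apply, Matrix.single_apply, Matrix.zero_apply]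
  by_cases h1 : i = a <;> by_cases h2 : i = b <;> by_cases h3 : j = a <;> by_cases h4 : j = b <;>
   simp [h1, h2, h3, h4] <;> (try grind)

theorem closure_transvections_eq_top [Nontrivial ι] (P : Subgroup (SpecialLinearGroup ι F))
    (hP : ∀ (i j : ι) (hij : i ≠ j) (c : F), SpecialLinearGroup.transvection hij c ∈ P) :
    P = ⊤ := by
  rw [eq_top_iff]
  intro M _
  refine SpecialLinearGroup.diagonal_transvection_induction' (· ∈ P) M ?_ hP
    (fun _ _ => P.mul_mem)
  intro i j hij c hc
  rw [diag2n_eq_transvections]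
  exact P.mul_mem (P.mul_mem (P.mul_mem (P.mul_mem (P.mul_mem (hP _ _ _ _) (hP _ _ _ _))
    (hP _ _ _ _)) (hP _ _ _ _)) (hP _ _ _ _)) (hP _ _ _ _)

/-- Conjugation by diag(a, 1/a) scales the parameter of a transvection by a²; with a = 2 this makes
every transvection a commutator. -/
theorem diag2n_mul_transvection {i j : ι} (hij : i ≠ j) {a : F} (ha : a ≠ 0) (c : F) :
    SpecialLinearGroup.diag2n hij a ha * SpecialLinearGroup.transvection hij c =
      SpecialLinearGroup.transvection hij (a * a * c) * SpecialLinearGroup.diag2n hij a ha := by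
  apply toMat_injective
  simp only [toMat_mul, toMat_transvection, toMat_diag2n]
  ext k l
  simp only [mul_add, add_mul, Matrix.add_apply, diagonal_mul, mul_diagonal,
    Matrix.single_apply, Matrix.one_apply]
  congr 1 <;> split_ifs <;> grind

/-- Over a field of characteristic zero, `SL` has no nontrivial abelian quotient. -/
theorem sl_hom_eq_one [CharZero F] {A : Type*} [CommGroup A] [Nontrivial ι]
    (f : SpecialLinearGroup ι F →* A) (g : SpecialLinearGroup ι F) : f g = 1 := by
  have h : f.ker = ⊤ := by
    apply closure_transvections_eq_top
    intro i j hij c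
    rw [MonoidHom.mem_ker]
    -- In an abelian target, conjugation by diag(2, 1/2) is invisible, so the parameters c/3 and
    -- 4c/3 have the same image. Since 4c/3 = c + c/3, the image of c is trivial.
    have h2 : (2 : F) ≠ 0 := two_ne_zero
    have h3 : (3 : F) ≠ 0 := three_ne_zero
    have key := congrArg f (diag2n_mul_transvection hij h2 (c / 3))
    rw [map_mul, map_mul, mul_comm] at key
    have key' := mul_right_cancel key
    have e : SpecialLinearGroup.transvection hij (2 * 2 * (c / 3)) =
        SpecialLinearGroup.transvection hij c * SpecialLinearGroup.transvection hij (c / 3) := by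
      rw [← SpecialLinearGroup.transvection_add]
      congr 1
      field_simp
      ring
    rw [e, map_mul] at key'
    exact mul_eq_right.1 key'.symm
  have : g ∈ f.ker := h ▸ Subgroup.mem_top g
  exact this

end Generation

/-! ### The coordinates `Φ` in terms of group elements -/

section Coordinates

variable {n : ℕ}

section Lower

variable {R : Type*} [CommRing R]

/-- `lowerBlock` over a commutative ring. -/
def lowerMat (v : Fin (n + 1) → R) (M : Matrix (Fin (n + 1)) (Fin (n + 1)) R) :
    Matrix (Fin (n + 2)) (Fin (n + 2)) R :=
  Matrix.of (Fin.cons (Fin.cons 1 0) (fun i => Fin.cons (v i) (M i)))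

variable (v w : Fin (n + 1) → R) (M N : Matrix (Fin (n + 1)) (Fin (n + 1)) R)

@[simp] theorem lowerMat_zero : lowerMat v M 0 = Pi.single 0 1 := by
  ext j
  refine Fin.cases ?_ (fun j => ?_) j <;> simp [lowerMat]

@[simp] theorem lowerMat_succ_zero (i : Fin (n + 1)) : lowerMat v M i.succ 0 = v i := by
  simp [lowerMat]

@[simp] theorem lowerMat_succ_succ (i j : Fin (n + 1)) :
    lowerMat v M i.succ j.succ = M i j := by
  simp [lowerMat]

theorem lowerMat_mul :
    lowerMat v M * lowerMat w N = lowerMat (v + M *ᵥ w) (M * N) := by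
  ext i j
  rw [Matrix.mul_apply, Fin.sum_univ_succ]
  refine Fin.cases ?_ (fun i => ?_) i
  · simp
  · refine Fin.cases ?_ (fun j => ?_) j
    · simp [Matrix.mulVec, dotProduct]
    · simp [Matrix.mul_apply]

theorem det_lowerMat : (lowerMat v M).det = M.det := by
  rw [det_succ_row_zero, Fin.sum_univ_succ]
  simp only [lowerMat_zero, Pi.single_eq_same, Fin.val_zero, pow_zero, one_mul]
  rw [Finset.sum_eq_zero (by intro i _; simp)]
  rw [add_zero]
  congr 1

theorem eq_lowerMat {A : Matrix (Fin (n + 2)) (Fin (n + 2)) R} (h : A 0 = Pi.single 0 1) :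
    A = lowerMat (fun i => A i.succ 0) (A.submatrix Fin.succ Fin.succ) := by
  ext i j
  refine Fin.cases ?_ (fun i => ?_) i
  · rw [h, lowerMat_zero]
  · refine Fin.cases ?_ (fun j => ?_) j <;> simp

theorem lowerMat_map {S : Type*} [CommRing S] (f : R →+* S) :
    (lowerMat v M).map f = lowerMat (f ∘ v) (M.map f) := by
  ext i j
  refine Fin.cases ?_ (fun i => ?_) i
  · refine Fin.cases ?_ (fun j => ?_) j <;> simp
  · refine Fin.cases ?_ (fun j => ?_) j <;> simp

/-- The element `(1 0; v g')` of `SL`. -/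
def slLower (x : (Fin (n + 1) → R) × SpecialLinearGroup (Fin (n + 1)) R) :
    SpecialLinearGroup (Fin (n + 2)) R :=
  ⟨lowerMat x.1 (toMat x.2), by rw [det_lowerMat, det_toMat]⟩

@[simp] theorem toMat_slLower (x : (Fin (n + 1) → R) × SpecialLinearGroup (Fin (n + 1)) R) :
    toMat (slLower x) = lowerMat x.1 (toMat x.2) := rfl

theorem slLower_mul (x y : (Fin (n + 1) → R) × SpecialLinearGroup (Fin (n + 1)) R) :
    slLower x * slLower y = slLower (x.1 + toMat x.2 *ᵥ y.1, x.2 * y.2) :=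
  toMat_injective (lowerMat_mul _ _ _ _)

theorem slLower_map {S : Type*} [CommRing S] (f : R →+* S)
    (x : (Fin (n + 1) → R) × SpecialLinearGroup (Fin (n + 1)) R) :
    SpecialLinearGroup.map f (slLower x) = slLower (f ∘ x.1, SpecialLinearGroup.map f x.2) :=
  toMat_injective (lowerMat_map _ _ _)

/-- The coordinates of an element of `SL` with first row `(1, 0, …, 0)`. -/
def lowerPart (g : {g : SpecialLinearGroup (Fin (n + 2)) R // toMat g 0 = Pi.single 0 1}) :
    (Fin (n + 1) → R) × SpecialLinearGroup (Fin (n + 1)) R :=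
  (fun i => toMat g.1 i.succ 0, ⟨(toMat g.1).submatrix Fin.succ Fin.succ, by
    rw [← det_lowerMat (fun i => toMat g.1 i.succ 0), ← eq_lowerMat g.2, det_toMat]⟩)

theorem slLower_lowerPart
    (g : {g : SpecialLinearGroup (Fin (n + 2)) R // toMat g 0 = Pi.single 0 1}) :
    slLower (lowerPart g) = g.1 :=
  toMat_injective (eq_lowerMat g.2).symm

theorem slLower_injective : Function.Injective
    (slLower : (Fin (n + 1) → R) × SpecialLinearGroup (Fin (n + 1)) R → _) := by
  intro x y h
  have h' := congrArg toMat h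
  rw [toMat_slLower, toMat_slLower] at h'
  refine Prod.ext (funext fun i => ?_) (toMat_injective (Matrix.ext fun i j => ?_))
  · simpa using congrFun (congrFun h' i.succ) 0
  · simpa using congrFun (congrFun h' i.succ) j.succ

theorem row_slLower_mul (x : (Fin (n + 1) → R) × SpecialLinearGroup (Fin (n + 1)) R)
    (g : SpecialLinearGroup (Fin (n + 2)) R) : toMat (slLower x * g) 0 = toMat g 0 := by
  rw [toMat_mul, Matrix.mul_apply_eq_vecMul, toMat_slLower, lowerMat_zero,
    Matrix.single_one_vecMul]
  rfl

/-- The first row of g is e₁g, so e₁g = e₁h means that gh⁻¹ fixes e₁. This is how stabilizer factors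
are produced throughout. -/
theorem row_mul_inv_of_row_eq {g h : SpecialLinearGroup (Fin (n + 2)) R}
    (e : toMat g 0 = toMat h 0) : toMat (g * h⁻¹) 0 = Pi.single 0 1 := by
  have : toMat (h * h⁻¹) 0 = Pi.single 0 1 := by
    rw [mul_inv_cancel]
    ext j
    simp [Matrix.one_apply, Pi.single_apply, eq_comm]
  rw [← this, toMat_mul, toMat_mul, Matrix.mul_apply_eq_vecMul, e, Matrix.mul_apply_eq_vecMul]

end Lower

variable {K : Type} [NormedField K]

/-- The element `(y; 0 diag(1 / y 0, 1, …, 1))` of `SL`. -/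
def slUpper (y : {y : Fin (n + 2) → K // y 0 ≠ 0}) : SpecialLinearGroup (Fin (n + 2)) K :=
  ⟨upperRow y.1, det_upperRow _ y.2⟩

theorem slPhi_eq (x : ((Fin (n + 1) → K) × SpecialLinearGroup (Fin (n + 1)) K) ×
      {y : Fin (n + 2) → K // y 0 ≠ 0}) : slPhi x = slLower x.1 * slUpper x.2 :=
  Subtype.ext rfl

@[simp] theorem row_slUpper (y : {y : Fin (n + 2) → K // y 0 ≠ 0}) : toMat (slUpper y) 0 = y := by
  ext j
  simp [slUpper, upperRow]

theorem row_slPhi (x : ((Fin (n + 1) → K) × SpecialLinearGroup (Fin (n + 1)) K) ×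
      {y : Fin (n + 2) → K // y 0 ≠ 0}) : toMat (slPhi x) 0 = x.2 := by
  rw [slPhi_eq, row_slLower_mul, row_slUpper]

theorem continuous_slUpper :
    Continuous (slUpper : {y : Fin (n + 2) → K // y 0 ≠ 0} → _) := by
  refine Continuous.subtype_mk (continuous_matrix fun i j => ?_) _
  simp only [upperRow, of_apply]
  split_ifs
  · exact (continuous_apply j).comp continuous_subtype_val
  · exact continuous_const.div ((continuous_apply 0).comp continuous_subtype_val) fun y => y.2
  · fun_prop
  · fun_prop

theorem continuous_slLower {R : Type*} [CommRing R] [TopologicalSpace R] : Continuous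
    (slLower : (Fin (n + 1) → R) × SpecialLinearGroup (Fin (n + 1)) R → _) := by
  refine Continuous.subtype_mk (continuous_matrix fun i j => ?_) _
  refine Fin.cases ?_ (fun i => ?_) i
  · simp only [lowerMat_zero]; fun_prop
  · refine Fin.cases ?_ (fun j => ?_) j
    · simp only [lowerMat_succ_zero]; fun_prop
    · simp only [lowerMat_succ_succ]
      exact (continuous_toMat.comp continuous_snd).matrix_elem i j

theorem continuous_slPhi : Continuous (slPhi (K := K) (n := n)) := by
  have : slPhi (K := K) (n := n) = fun x => slLower x.1 * slUpper x.2 := funext slPhi_eq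
  rw [this]
  exact (continuous_slLower.comp continuous_fst).mul (continuous_slUpper.comp continuous_snd)

theorem continuous_lowerPart : Continuous (lowerPart (n := n) (R := K)) := by
  have h : Continuous fun g : {g : SpecialLinearGroup (Fin (n + 2)) K //
      toMat g 0 = Pi.single 0 1} => toMat g.1 := continuous_toMat.comp continuous_subtype_val
  refine Continuous.prodMk (continuous_pi fun i => h.matrix_elem _ _) ?_
  exact Continuous.subtype_mk (h.matrix_submatrix _ _) _

/-- The set of elements of `SL` whose upper left entry does not vanish. -/
abbrev BigCell (n : ℕ) (K : Type) [NormedField K] :=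
  {g : SpecialLinearGroup (Fin (n + 2)) K // toMat g 0 0 ≠ 0}

/-- The unique first factor of an element of `SL` in the coordinates `Φ`. -/
def slPhiInvAux (g : BigCell n K) :
    {g : SpecialLinearGroup (Fin (n + 2)) K // toMat g 0 = Pi.single 0 1} :=
  ⟨g.1 * (slUpper ⟨toMat g.1 0, g.2⟩)⁻¹, row_mul_inv_of_row_eq (by rw [row_slUpper])⟩

/-- The inverse of `Φ`. -/
def slPhiInv (g : BigCell n K) : ((Fin (n + 1) → K) × SpecialLinearGroup (Fin (n + 1)) K) ×
    {y : Fin (n + 2) → K // y 0 ≠ 0} :=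
  (lowerPart (slPhiInvAux g), ⟨toMat g.1 0, g.2⟩)

theorem slPhi_slPhiInv (g : BigCell n K) : slPhi (slPhiInv g) = g.1 := by
  rw [slPhi_eq, slPhiInv, slLower_lowerPart, slPhiInvAux, inv_mul_cancel_right]

theorem slPhi_injective : Function.Injective (slPhi (K := K) (n := n)) := by
  intro x x' h
  have h2 : x.2 = x'.2 := Subtype.ext (by rw [← row_slPhi, ← row_slPhi, h])
  rw [slPhi_eq, slPhi_eq, h2] at h
  exact Prod.ext (slLower_injective (mul_right_cancel h)) h2

theorem continuous_slPhiInv : Continuous (slPhiInv (K := K) (n := n)) := by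
  have h : Continuous fun g : BigCell n K => (⟨toMat g.1 0, g.2⟩ :
      {y : Fin (n + 2) → K // y 0 ≠ 0}) :=
    Continuous.subtype_mk (continuous_pi fun j =>
      (continuous_toMat.comp continuous_subtype_val).matrix_elem 0 j) _
  exact (continuous_lowerPart.comp (Continuous.subtype_mk
    (continuous_subtype_val.mul (continuous_slUpper.comp h).inv) _)).prodMk h

theorem slPhi_mem_bigCell (x : ((Fin (n + 1) → K) × SpecialLinearGroup (Fin (n + 1)) K) ×
    {y : Fin (n + 2) → K // y 0 ≠ 0}) : toMat (slPhi x) 0 0 ≠ 0 := by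
  rw [row_slPhi]
  exact x.2.2

/-- `Φ` as a homeomorphism onto its image. -/
def slPhiHomeo : (((Fin (n + 1) → K) × SpecialLinearGroup (Fin (n + 1)) K) ×
      {y : Fin (n + 2) → K // y 0 ≠ 0}) ≃ₜ BigCell n K where
  toFun x := ⟨slPhi x, slPhi_mem_bigCell x⟩
  invFun := slPhiInv
  left_inv _ := slPhi_injective (slPhi_slPhiInv _)
  right_inv g := Subtype.ext (slPhi_slPhiInv g)
  continuous_toFun := continuous_slPhi.subtype_mk _
  continuous_invFun := continuous_slPhiInv

theorem isOpen_bigCell :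
    IsOpen {g : SpecialLinearGroup (Fin (n + 2)) K | toMat g 0 0 ≠ 0} :=
  isOpen_ne_fun (continuous_toMat.matrix_elem 0 0) continuous_const

theorem isOpenEmbedding_slPhi : Topology.IsOpenEmbedding (slPhi (K := K) (n := n)) :=
  isOpen_bigCell.isOpenEmbedding_subtypeVal.comp slPhiHomeo.isOpenEmbedding

theorem mem_range_slPhi {g : SpecialLinearGroup (Fin (n + 2)) K} (h : toMat g 0 0 ≠ 0) :
    ∃ x, slPhi x = g :=
  ⟨slPhiHomeo.symm ⟨g, h⟩, congrArg Subtype.val (slPhiHomeo.apply_symm_apply ⟨g, h⟩)⟩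

end Coordinates

/-! ### `slMeasure` is a Haar measure -/


section SLHaar

/-! ### Topology of `SL` and measures on subtypes -/

section Topology

variable {ι : Type*} [Fintype ι] [DecidableEq ι] {R : Type*} [CommRing R] [TopologicalSpace R]
  [IsTopologicalRing R]

instance instSecondCountableSL [SecondCountableTopology R] :
    SecondCountableTopology (SpecialLinearGroup ι R) :=
  have : SecondCountableTopology (Matrix ι ι R) :=
    inferInstanceAs (SecondCountableTopology (ι → ι → R))
  (Topology.IsInducing.mk rfl :
    Topology.IsInducing (toMat : SpecialLinearGroup ι R → _)).secondCountableTopology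

instance instLocallyCompactSL [LocallyCompactSpace R] [T1Space R] :
    LocallyCompactSpace (SpecialLinearGroup ι R) :=
  have : LocallyCompactSpace (Matrix ι ι R) :=
    inferInstanceAs (LocallyCompactSpace (ι → ι → R))
  SpecialLinearGroup.isClosedEmbedding_val.locallyCompactSpace

end Topology

theorem comap_subtype_apply {α : Type*} [MeasurableSpace α] (μ : Measure α)
    {p : α → Prop} (hp : MeasurableSet {x | p x}) (s : Set {x // p x}) :
    Measure.comap (Subtype.val : {x // p x} → α) μ s = μ (Subtype.val '' s) :=
  (MeasurableEmbedding.subtype_coe hp).comap_apply _ _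

theorem sigmaFinite_comap_subtype {α : Type*} [MeasurableSpace α] (μ : Measure α) [SigmaFinite μ]
    {p : α → Prop} (hp : MeasurableSet {x | p x}) :
    SigmaFinite (Measure.comap (Subtype.val : {x // p x} → α) μ) := by
  refine ⟨⟨⟨fun n => Subtype.val ⁻¹' (spanningSets μ n), fun _ => trivial, fun n => ?_, ?_⟩⟩⟩
  · rw [comap_subtype_apply μ hp]
    exact (measure_mono (Set.image_preimage_subset _ _)).trans_lt (measure_spanningSets_lt_top μ n)
  · rw [← Set.preimage_iUnion, iUnion_spanningSets, Set.preimage_univ]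

theorem lintegral_comap_subtype {α : Type*} [MeasurableSpace α] (μ : Measure α)
    {p : α → Prop} (hp : MeasurableSet {x | p x}) (f : α → ENNReal) :
    ∫⁻ x : {x // p x}, f x ∂Measure.comap Subtype.val μ = ∫⁻ x in {x | p x}, f x ∂μ :=
  lintegral_subtype_comap hp f

theorem measurableSet_apply_ne_zero {K : Type*} [NormedField K] [MeasurableSpace K] [BorelSpace K]
    {n : ℕ} (i : Fin n) : MeasurableSet {y : Fin n → K | y i ≠ 0} :=
  (measurable_pi_apply i) (measurableSet_singleton 0).compl

/-! ### Unimodularity of groups without characters -/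

section RightInvariance

variable {G : Type*} [Group G] [TopologicalSpace G] [IsTopologicalGroup G] [LocallyCompactSpace G]
  [SecondCountableTopology G] [MeasurableSpace G] [BorelSpace G]

/-- A locally compact group without nontrivial homomorphisms to `ℝ>0` is unimodular. -/
theorem isMulRightInvariant_of_hom_trivial (h : ∀ (f : G →* NNRealˣ) (g : G), f g = 1)
    (μ : Measure G) [μ.IsHaarMeasure] : μ.IsMulRightInvariant := by
  refine ⟨fun g => ?_⟩
  have h1 : Measure.modularCharacterFun g = 1 := by
    have := congrArg Units.val (h (Measure.modularCharacter (G := G)).toHomUnits g)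
    rwa [MonoidHom.coe_toHomUnits] at this
  rw [Measure.modularCharacterFun_eq_haarScalarFactor μ] at h1
  have h2 := Measure.isMulLeftInvariant_eq_smul (Measure.map (fun x => x * g) μ) μ
  rw [h1, one_smul] at h2
  exact h2

/-- The inverted measure is left invariant, hence Haar, hence right invariant by unimodularity;
inverting back makes `μ` left invariant. The set `C` shows that `μ` is nonzero and locally finite.
-/
theorem isHaarMeasure_of_isMulRightInvariant (h : ∀ (f : G →* NNRealˣ) (g : G), f g = 1)
    (μ : Measure G) [μ.IsMulRightInvariant] (C : Set G) (hC : IsCompact C)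
    (hi : (interior C).Nonempty) (h0 : μ C ≠ 0) (ht : μ C ≠ ⊤) : μ.IsHaarMeasure := by
  have hinv : μ.inv (C⁻¹) = μ C := by rw [Measure.inv_apply, inv_inv]
  have h1 : μ.inv.IsHaarMeasure := by
    refine Measure.isHaarMeasure_of_isCompact_nonempty_interior μ.inv C⁻¹ hC.inv ?_
      (by rwa [hinv]) (by rwa [hinv])
    exact hi.inv.mono
      (interior_maximal (Set.inv_subset_inv.2 interior_subset) isOpen_interior.inv)
  have h2 : μ.inv.IsMulRightInvariant := isMulRightInvariant_of_hom_trivial h _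
  have h3 : μ.IsMulLeftInvariant := by
    rw [← μ.inv_inv]
    infer_instance
  exact Measure.isHaarMeasure_of_isCompact_nonempty_interior μ C hC hi h0 ht

end RightInvariance

variable {K : Type} [NormedField K]

theorem sl_hom_units_eq_one [CharZero K] {n : ℕ} {A : Type*} [CommGroup A]
    (f : SpecialLinearGroup (Fin (n + 1)) K →* A)
    (g : SpecialLinearGroup (Fin (n + 1)) K) : f g = 1 := by
  cases n with
  | zero =>
    rw [Subsingleton.elim (α := SpecialLinearGroup (Fin 1) K) g 1]
    exact map_one f
  | succ n => exact sl_hom_eq_one f g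

variable [CharZero K] [MeasureSpace K] [BorelSpace K] [LocallyCompactSpace K]
  [SecondCountableTopology K] [(volume : Measure K).IsAddHaarMeasure]

/-- `SL` acts on column vectors preserving the volume. -/
theorem measurePreserving_mulVec {n : ℕ} (g : SpecialLinearGroup (Fin (n + 1)) K) :
    MeasurePreserving (fun y : Fin (n + 1) → K => toMat g *ᵥ y) volume volume := by
  have hcont : ∀ g : SpecialLinearGroup (Fin (n + 1)) K,
      Continuous (fun y : Fin (n + 1) → K => toMat g *ᵥ y) := fun g => by
    exact Continuous.matrix_mulVec continuous_const continuous_id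
  have : ContinuousConstSMul (SpecialLinearGroup (Fin (n + 1)) K) (Fin (n + 1) → K) :=
    ⟨fun g => hcont g⟩
  refine ⟨(hcont g).measurable, ?_⟩
  ext s hs
  rw [Measure.map_apply (hcont g).measurable hs]
  -- The factor by which a linear action scales Haar measure is a character of the group, hence
  -- trivial on `SL`.
  have h1 : distribHaarChar (Fin (n + 1) → K) g⁻¹ = 1 := by
    have := congrArg Units.val (sl_hom_units_eq_one
      (distribHaarChar (G := SpecialLinearGroup (Fin (n + 1)) K) (Fin (n + 1) → K)).toHomUnits g⁻¹)
    simpa using this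
  have h2 := distribHaarChar_mul (volume : Measure (Fin (n + 1) → K)) g⁻¹ s
  rw [h1, ENNReal.coe_one, one_mul] at h2
  rw [h2, ← Set.preimage_smul]
  rfl

/-- `SL` acts on row vectors preserving the volume. -/
theorem measurePreserving_vecMul {n : ℕ} (g : SpecialLinearGroup (Fin (n + 1)) K) :
    MeasurePreserving (fun y : Fin (n + 1) → K => y ᵥ* toMat g) volume volume := by
  have := measurePreserving_mulVec (SpecialLinearGroup.transpose g)
  convert this using 2 with y
  exact (Matrix.mulVec_transpose _ _).symm

theorem measurableEmbedding_vecMul {n : ℕ} (g : SpecialLinearGroup (Fin (n + 1)) K) :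
    MeasurableEmbedding (fun y : Fin (n + 1) → K => y ᵥ* toMat g) := by
  have hcont : ∀ g : SpecialLinearGroup (Fin (n + 1)) K,
      Continuous (fun y : Fin (n + 1) → K => y ᵥ* toMat g) := fun g => by
    exact Continuous.matrix_vecMul continuous_id continuous_const
  let e : (Fin (n + 1) → K) ≃ₜ (Fin (n + 1) → K) :=
    { toFun := fun y => y ᵥ* toMat g
      invFun := fun y => y ᵥ* toMat g⁻¹
      left_inv := fun y => by
        simp only [Matrix.vecMul_vecMul, ← toMat_mul, mul_inv_cancel, toMat_one, vecMul_one]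
      right_inv := fun y => by
        simp only [Matrix.vecMul_vecMul, ← toMat_mul, inv_mul_cancel, toMat_one, vecMul_one]
      continuous_toFun := hcont g
      continuous_invFun := hcont g⁻¹ }
  exact e.measurableEmbedding

open Classical in
/-- `slUpper`, extended by `1`. -/
def slUpperExt {n : ℕ} (y : Fin (n + 2) → K) : SpecialLinearGroup (Fin (n + 2)) K :=
  if h : y 0 ≠ 0 then slUpper ⟨y, h⟩ else 1

theorem ae_apply_ne_zero [NullSingletonClass (volume : Measure K)] {n : ℕ} (i : Fin (n + 1)) :
    ∀ᵐ y : Fin (n + 1) → K, y i ≠ 0 := by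
  rw [ae_iff, volume_pi]
  simpa only [not_not] using Measure.pi_hyperplane (fun _ : Fin (n + 1) => (volume : Measure K)) i 0

/-- The measure `dv' dν(g')` in the coordinates of the stabilizer of the first basis row vector. -/
abbrev lowerMeasure (K : Type) [NormedField K] [MeasureSpace K] (n : ℕ) :
    Measure ((Fin (n + 1) → K) × SpecialLinearGroup (Fin (n + 1)) K) :=
  (volume : Measure (Fin (n + 1) → K)).prod (slMeasure K (n + 1))

/-- The hyperplane `y 0 = 0` is null, so the rows may range over the whole space, where `SL` acts
linearly; the action does not preserve the condition `y 0 ≠ 0`. -/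
theorem lintegral_slMeasure [NullSingletonClass (volume : Measure K)] {n : ℕ}
    [SFinite (slMeasure K (n + 1))] {f : SpecialLinearGroup (Fin (n + 2)) K → ENNReal}
    (hf : Measurable f) :
    ∫⁻ g, f g ∂(slMeasure K (n + 2)) =
      ∫⁻ y : Fin (n + 2) → K, ∫⁻ x, f (slLower x * slUpperExt y) ∂(lowerMeasure K n) := by
  have := sigmaFinite_comap_subtype (volume : Measure (Fin (n + 2) → K))
    (measurableSet_apply_ne_zero 0)
  rw [slMeasure, lintegral_map hf continuous_slPhi.measurable,
    lintegral_prod_symm (fun x => f (slPhi x)) (hf.comp continuous_slPhi.measurable).aemeasurable]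
  have e : ∀ y : {y : Fin (n + 2) → K // y 0 ≠ 0},
      ∫⁻ x, f (slPhi (x, y)) ∂(lowerMeasure K n) =
      (fun y => ∫⁻ x, f (slLower x * slUpperExt y) ∂(lowerMeasure K n)) y.1 := by
    intro y
    refine lintegral_congr fun x => ?_
    rw [slPhi_eq, slUpperExt, dif_pos y.2]
  simp only [e]
  rw [lintegral_comap_subtype _ (measurableSet_apply_ne_zero 0)
    (fun y => ∫⁻ x, f (slLower x * slUpperExt y) ∂(lowerMeasure K n)),
    Measure.restrict_eq_self_of_ae_mem]
  exact ae_apply_ne_zero 0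

/-- Right translation by `x₀` shifts `v` by a vector depending on `g` and multiplies `g` on the
right. Integrating over `v` first absorbs the shift, and right invariance in the smaller size
absorbs the rest. -/
theorem lintegral_lowerMeasure_mul_right {n : ℕ} [SFinite (slMeasure K (n + 1))]
    [(slMeasure K (n + 1)).IsMulRightInvariant]
    {f : SpecialLinearGroup (Fin (n + 2)) K → ENNReal} (hf : Measurable f)
    (x₀ : (Fin (n + 1) → K) × SpecialLinearGroup (Fin (n + 1)) K) :
    ∫⁻ x, f (slLower x * slLower x₀) ∂(lowerMeasure K n) =
      ∫⁻ x, f (slLower x) ∂(lowerMeasure K n) := by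
  have hm : Measurable fun x => f (slLower x * slLower x₀) :=
    hf.comp ((continuous_slLower.mul continuous_const).measurable)
  have hm' : Measurable fun x => f (slLower (R := K) (n := n) x) :=
    hf.comp continuous_slLower.measurable
  rw [lintegral_prod_symm _ hm.aemeasurable, lintegral_prod_symm _ hm'.aemeasurable]
  simp only [slLower_mul]
  have e : ∀ g : SpecialLinearGroup (Fin (n + 1)) K,
      ∫⁻ v : Fin (n + 1) → K, f (slLower (v + toMat g *ᵥ x₀.1, g * x₀.2)) =
      ∫⁻ v : Fin (n + 1) → K, f (slLower (v, g * x₀.2)) := fun g =>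
    lintegral_add_right_eq_self (fun v => f (slLower (v, g * x₀.2))) _
  simp only [e]
  exact lintegral_mul_right_eq_self
    (fun g => ∫⁻ v : Fin (n + 1) → K, f (slLower (v, g))) x₀.2

theorem slUpperExt_mul {n : ℕ} {y : Fin (n + 2) → K} (g : SpecialLinearGroup (Fin (n + 2)) K)
    (hy : y 0 ≠ 0) (hyg : (y ᵥ* toMat g) 0 ≠ 0) :
    ∃ x, slUpperExt y * g = slLower x * slUpperExt (y ᵥ* toMat g) := by
  rw [slUpperExt, dif_pos hy, slUpperExt, dif_pos hyg]
  have h : toMat (slUpper ⟨y, hy⟩ * g) 0 = toMat (slUpper ⟨y ᵥ* toMat g, hyg⟩) 0 := by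
    rw [toMat_mul, Matrix.mul_apply_eq_vecMul, row_slUpper, row_slUpper]
  exact ⟨lowerPart ⟨_, row_mul_inv_of_row_eq h⟩, by
    rw [slLower_lowerPart, inv_mul_cancel_right]⟩

/-- For almost every `y` both `y` and `y ᵥ* g` have nonzero first entry. There, translation by `g`
moves the row linearly and multiplies the lower factor on the right by a stabilizer element; both
operations preserve the measure. -/
theorem slMeasure_isMulRightInvariant [NullSingletonClass (volume : Measure K)] {n : ℕ}
    [SFinite (slMeasure K (n + 1))] [(slMeasure K (n + 1)).IsMulRightInvariant] :
    (slMeasure K (n + 2)).IsMulRightInvariant := by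
  refine ⟨fun g => Measure.ext_of_lintegral _ fun f hf => ?_⟩
  rw [lintegral_map hf (measurable_mul_const g), lintegral_slMeasure hf,
    lintegral_slMeasure (f := fun x => f (x * g)) (hf.comp (measurable_mul_const g))]
  refine Eq.trans ?_ ((measurePreserving_vecMul g).lintegral_comp_emb
    (measurableEmbedding_vecMul g)
    (fun y => ∫⁻ x, f (slLower x * slUpperExt y) ∂(lowerMeasure K n)))
  refine lintegral_congr_ae ?_
  filter_upwards [ae_apply_ne_zero 0,
    (measurePreserving_vecMul g).quasiMeasurePreserving.ae (ae_apply_ne_zero 0)] with y hy hyg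
  obtain ⟨x₀, hx₀⟩ := slUpperExt_mul g hy hyg
  simp only [mul_assoc, hx₀]
  have := lintegral_lowerMeasure_mul_right (n := n)
    (hf.comp (measurable_mul_const (slUpperExt (y ᵥ* toMat g)))) x₀
  simpa only [mul_assoc, Function.comp_apply] using this

theorem slMeasure_one_isHaarMeasure : (slMeasure K 1).IsHaarMeasure := by
  have : (slMeasure K 1).IsMulLeftInvariant := by
    refine ⟨fun g => ?_⟩
    rw [Subsingleton.elim (α := SpecialLinearGroup (Fin 1) K) g 1]
    simp
  refine Measure.isHaarMeasure_of_isCompact_nonempty_interior _ Set.univ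
    Set.subsingleton_univ.isCompact ?_ ?_ ?_
  · simp
  · simp [slMeasure]
  · simp [slMeasure]

theorem slMeasure_succ_isHaarMeasure [NullSingletonClass (volume : Measure K)] {n : ℕ}
    [(slMeasure K (n + 1)).IsHaarMeasure] : (slMeasure K (n + 2)).IsHaarMeasure := by
  have : (slMeasure K (n + 1)).IsMulRightInvariant :=
    isMulRightInvariant_of_hom_trivial sl_hom_units_eq_one _
  have := slMeasure_isMulRightInvariant (K := K) (n := n)
  have hopen : IsOpen {y : Fin (n + 2) → K | y 0 ≠ 0} :=
    isOpen_ne_fun (continuous_apply 0) continuous_const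
  have : LocallyCompactSpace {y : Fin (n + 2) → K // y 0 ≠ 0} := hopen.locallyCompactSpace
  -- The image under `Φ` of a product of compact neighbourhoods is a compact neighbourhood whose
  -- measure is a product of three finite positive numbers.
  obtain ⟨C₁, hC₁, h₁⟩ := exists_compact_mem_nhds (0 : Fin (n + 1) → K)
  obtain ⟨C₂, hC₂, h₂⟩ := exists_compact_mem_nhds (1 : SpecialLinearGroup (Fin (n + 1)) K)
  obtain ⟨C₃, hC₃, h₃⟩ := exists_compact_mem_nhds
    (⟨1, one_ne_zero⟩ : {y : Fin (n + 2) → K // y 0 ≠ 0})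
  have hmeas : slMeasure K (n + 2) (slPhi '' ((C₁ ×ˢ C₂) ×ˢ C₃)) =
      (volume C₁ * slMeasure K (n + 1) C₂) * volume (Subtype.val '' C₃) := by
    have := sigmaFinite_comap_subtype (volume : Measure (Fin (n + 2) → K))
      (measurableSet_apply_ne_zero 0)
    rw [slMeasure, isOpenEmbedding_slPhi.measurableEmbedding.map_apply,
      Set.preimage_image_eq _ slPhi_injective, Measure.prod_prod, Measure.prod_prod,
      comap_subtype_apply _ (measurableSet_apply_ne_zero 0)]
  have hv : Subtype.val '' C₃ ∈ nhds (1 : Fin (n + 2) → K) :=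
    hopen.isOpenMap_subtype_val.image_mem_nhds h₃
  refine isHaarMeasure_of_isMulRightInvariant sl_hom_units_eq_one _ (slPhi '' ((C₁ ×ˢ C₂) ×ˢ C₃))
    (((hC₁.prod hC₂).prod hC₃).image continuous_slPhi) ?_ ?_ ?_
  · refine ⟨slPhi ((0, 1), ⟨1, one_ne_zero⟩), mem_interior_iff_mem_nhds.2 ?_⟩
    exact isOpenEmbedding_slPhi.isOpenMap.image_mem_nhds
      (prod_mem_nhds (prod_mem_nhds h₁ h₂) h₃)
  · rw [hmeas]
    exact mul_ne_zero (mul_ne_zero (Measure.measure_pos_of_mem_nhds _ h₁).ne'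
      (Measure.measure_pos_of_mem_nhds _ h₂).ne') (Measure.measure_pos_of_mem_nhds _ hv).ne'
  · rw [hmeas]
    exact ENNReal.mul_ne_top (ENNReal.mul_ne_top hC₁.measure_lt_top.ne hC₂.measure_lt_top.ne)
      (hC₃.image continuous_subtype_val).measure_lt_top.ne

theorem slMeasure_isHaarMeasure [NullSingletonClass (volume : Measure K)] (n : ℕ) :
    (slMeasure K (n + 1)).IsHaarMeasure := by
  induction n with
  | zero => exact slMeasure_one_isHaarMeasure
  | succ n ih => exact slMeasure_succ_isHaarMeasure

end SLHaar

/-! ### Strict fundamental domains -/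

section StrictDomain

variable {G Δ : Type*} [Group G] [Group Δ] [MeasurableSpace G]

/-- A measurable set containing exactly one point of each orbit of `Δ`, which acts through `i` by
left translations, and such that moreover this point corresponds to a unique element of `Δ`. -/
def IsStrictDomain (i : Δ →* G) (F : Set G) : Prop :=
  MeasurableSet F ∧ ∀ x, ∃! γ, i γ * x ∈ F

/-- The translates `V n = U * c n` along a dense sequence cover the group, and each meets every
orbit at most once, for a unique element of `Δ`. An orbit is represented in the first `V n` that it
meets: the saturations `W m` of the earlier ones are removed. -/
theorem exists_isStrictDomain [TopologicalSpace G] [IsTopologicalGroup G]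
    [SecondCountableTopology G] [BorelSpace G] [Countable Δ] (i : Δ →* G) {U : Set G}
    (hU : IsOpen U) (h1 : (1 : G) ∈ U) (h : ∀ γ, ∀ u ∈ U, i γ * u ∈ U → γ = 1) :
    ∃ F, IsStrictDomain i F := by
  let c : ℕ → G := TopologicalSpace.denseSeq G
  have hc : DenseRange c := TopologicalSpace.denseRange_denseSeq G
  let V : ℕ → Set G := fun n => {x | x * (c n)⁻¹ ∈ U}
  have hV : ∀ n, IsOpen (V n) := fun n => hU.preimage (continuous_mul_const _)
  let W : ℕ → Set G := fun n => ⋃ γ, {x | i γ * x ∈ V n}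
  have hW : ∀ n, IsOpen (W n) := fun n =>
    isOpen_iUnion fun γ => (hV n).preimage (continuous_const_mul _)
  have hWinv : ∀ n γ x, i γ * x ∈ W n ↔ x ∈ W n := by
    intro n γ x
    simp only [W, Set.mem_iUnion, Set.mem_ofPred_eq]
    constructor
    · rintro ⟨δ, hδ⟩
      exact ⟨δ * γ, by rwa [map_mul, mul_assoc]⟩
    · rintro ⟨δ, hδ⟩
      exact ⟨δ * γ⁻¹, by rwa [← mul_assoc, ← map_mul, inv_mul_cancel_right]⟩
  have hcov : ∀ x, ∃ n, x ∈ W n := by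
    intro x
    have hopen : IsOpen {y : G | x * y⁻¹ ∈ U} :=
      hU.preimage (continuous_const.mul continuous_inv)
    obtain ⟨n, hn⟩ := hc.exists_mem_open hopen ⟨x, by simpa using h1⟩
    exact ⟨n, Set.mem_iUnion.2 ⟨1, by simpa [V] using hn⟩⟩
  refine ⟨⋃ n, V n \ ⋃ m : Fin n, W m, ?_, fun x => ?_⟩
  · exact MeasurableSet.iUnion fun n => (hV n).measurableSet.diff
      (MeasurableSet.iUnion fun m => (hW m).measurableSet)
  · classical
    have key : ∀ γ, i γ * x ∈ (⋃ n, V n \ ⋃ m : Fin n, W m) ↔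
        i γ * x ∈ V (Nat.find (hcov x)) := by
      intro γ
      simp only [Set.mem_iUnion, Set.mem_sdiff, hWinv]
      constructor
      · rintro ⟨n, hn, hm⟩
        have : Nat.find (hcov x) = n := by
          refine (Nat.find_eq_iff _).2 ⟨?_, fun m hmn hxm => hm ⟨⟨m, hmn⟩, hxm⟩⟩
          exact Set.mem_iUnion.2 ⟨γ, hn⟩
        rwa [this]
      · intro hγ
        exact ⟨_, hγ, fun ⟨m, hm⟩ => Nat.find_min (hcov x) m.2 hm⟩
    simp only [key]
    obtain ⟨γ, hγ⟩ := Set.mem_iUnion.1 (Nat.find_spec (hcov x))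
    refine ⟨γ, hγ, fun δ hδ => ?_⟩
    have := h (δ * γ⁻¹) _ hγ (by
      simp only [V, Set.mem_ofPred_eq] at hδ
      rw [← mul_assoc, ← mul_assoc, ← map_mul, inv_mul_cancel_right]
      exact hδ)
    exact mul_inv_eq_one.1 this

/-- The indicator of `F` sums to 1 over each orbit. Insert this sum, translate each term by left
invariance and reindex by inverses. -/
theorem IsStrictDomain.lintegral_eq_tsum [MeasurableMul G] [Countable Δ] {i : Δ →* G} {F : Set G}
    (hF : IsStrictDomain i F) (μ : Measure G) [μ.IsMulLeftInvariant] {f : G → ENNReal}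
    (hf : Measurable f) :
    ∫⁻ x, f x ∂μ = ∫⁻ x in F, ∑' γ, f (i γ * x) ∂μ := by
  have hm : ∀ γ, Measurable fun x => i γ * x := fun γ => measurable_const_mul _
  have hind : Measurable (F.indicator (1 : G → ENNReal)) := measurable_one.indicator hF.1
  have h1 : ∀ x, ∑' γ, F.indicator (1 : G → ENNReal) (i γ * x) * f x = f x := by
    intro x
    obtain ⟨γ, hγ, huniq⟩ := hF.2 x
    rw [tsum_eq_single γ, Set.indicator_of_mem hγ, Pi.one_apply, one_mul]
    intro δ hδ
    rw [Set.indicator_of_notMem (fun h => hδ (huniq δ h)), zero_mul]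
  calc ∫⁻ x, f x ∂μ
      = ∫⁻ x, ∑' γ, F.indicator (1 : G → ENNReal) (i γ * x) * f x ∂μ := by simp only [h1]
    _ = ∑' γ, ∫⁻ x, F.indicator (1 : G → ENNReal) (i γ * x) * f x ∂μ :=
        lintegral_tsum fun γ => ((hind.comp (hm γ)).mul hf).aemeasurable
    _ = ∑' γ, ∫⁻ x, F.indicator (1 : G → ENNReal) x * f (i γ⁻¹ * x) ∂μ := by
        refine tsum_congr fun γ => ?_
        rw [← lintegral_mul_left_eq_self
          (fun x => F.indicator (1 : G → ENNReal) x * f (i γ⁻¹ * x)) (i γ)]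
        simp only [← mul_assoc, ← map_mul, inv_mul_cancel, map_one, one_mul]
    _ = ∑' γ, ∫⁻ x, F.indicator (1 : G → ENNReal) x * f (i γ * x) ∂μ :=
        (Equiv.inv Δ).tsum_eq fun γ => ∫⁻ x, F.indicator (1 : G → ENNReal) x * f (i γ * x) ∂μ
    _ = ∑' γ, ∫⁻ x in F, f (i γ * x) ∂μ := by
        refine tsum_congr fun γ => ?_
        rw [← lintegral_indicator hF.1]
        refine lintegral_congr fun x => ?_
        by_cases hx : x ∈ F <;> simp [hx]
    _ = ∫⁻ x in F, ∑' γ, f (i γ * x) ∂μ :=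
        (lintegral_tsum fun γ => (hf.comp (hm γ)).aemeasurable).symm

end StrictDomain

/-! ### Primitive integral vectors -/

section Primitive

/-- The first rows of the elements of `SL(ℤ)`. -/
def primitiveVectors (n : ℕ) : Set (Fin (n + 2) → ℤ) :=
  Set.range fun γ : SpecialLinearGroup (Fin (n + 2)) ℤ => toMat γ 0

/-- Divide by the gcd and complete the coprime pair to a unimodular matrix; the zero pair takes `t =
0`. -/
theorem exists_sl_two_of_pair (a b : ℤ) :
    ∃ (t : ℕ) (A : SpecialLinearGroup (Fin 2) ℤ), a = t * toMat A 0 0 ∧ b = t * toMat A 0 1 := by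
  by_cases h : Int.gcd a b = 0
  · rw [Int.gcd_eq_zero_iff] at h
    exact ⟨0, 1, by simp [h.1], by simp [h.2]⟩
  · obtain ⟨a', ha⟩ := Int.gcd_dvd_left a b
    obtain ⟨b', hb⟩ := Int.gcd_dvd_right a b
    have hco : IsCoprime a' b' := by
      rw [Int.isCoprime_iff_gcd_eq_one]
      have := Int.gcd_mul_left (Int.gcd a b) a' b'
      rw [← ha, ← hb, Int.natAbs_natCast] at this
      exact (Nat.eq_of_mul_eq_mul_left (Nat.pos_of_ne_zero h) (by rw [mul_one]; exact this)).symm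
    obtain ⟨A, h0, h1⟩ := hco.exists_SL2_row 0
    exact ⟨Int.gcd a b, A, by rw [show toMat A 0 0 = a' from h0]; exact ha,
      by rw [show toMat A 0 1 = b' from h1]; exact hb⟩

/-- The witness is the identity with `A` as its upper left block, written 1 + V(A - 1)Vᵀ so that
det(1 + XY) = det(1 + YX) computes its determinant. -/
theorem exists_sl_of_sl_two {n : ℕ} (A : SpecialLinearGroup (Fin 2) ℤ) :
    ∃ B : SpecialLinearGroup (Fin (n + 2)) ℤ,
      toMat B 0 = Pi.single 0 (toMat A 0 0) + Pi.single 1 (toMat A 0 1) := by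
  let V : Matrix (Fin (n + 2)) (Fin 2) ℤ :=
    (1 : Matrix (Fin (n + 2)) (Fin (n + 2)) ℤ).submatrix id ![0, 1]
  have hV : Vᵀ * V = 1 := by
    have he : Function.Injective (![0, 1] : Fin 2 → Fin (n + 2)) := by
      intro i j
      fin_cases i <;> fin_cases j <;> simp
    rw [Matrix.transpose_submatrix, Matrix.transpose_one,
      ← Matrix.submatrix_mul _ _ _ _ _ Function.bijective_id, Matrix.one_mul,
      Matrix.submatrix_one _ he]
  refine ⟨⟨1 + V * ((toMat A - 1) * Vᵀ), ?_⟩, ?_⟩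
  · rw [Matrix.det_one_add_mul_comm, Matrix.mul_assoc, hV, Matrix.mul_one, add_sub_cancel,
      det_toMat]
  · rw [toMat_mk]
    ext j
    simp only [Matrix.add_apply, Matrix.mul_apply, Fin.sum_univ_two, V, Matrix.submatrix_apply,
      Matrix.one_apply, Matrix.transpose_apply, Matrix.sub_apply, Pi.add_apply, Pi.single_apply]
    simp
    grind

/-- Induction on the length: the tail is `t'` times a first row of `γ'`, the pair `(v 0, t')` is
treated in SL_2, and right multiplication by the block matrix of 1 and `γ'` spreads the second entry
over the tail. -/
theorem exists_smul_row (n : ℕ) (v : Fin (n + 2) → ℤ) :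
    ∃ (t : ℕ) (γ : SpecialLinearGroup (Fin (n + 2)) ℤ), v = (t : ℤ) • toMat γ 0 := by
  induction n with
  | zero =>
    obtain ⟨t, A, h0, h1⟩ := exists_sl_two_of_pair (v 0) (v 1)
    refine ⟨t, A, ?_⟩
    ext j
    fin_cases j
    · exact h0
    · exact h1
  | succ n ih =>
    obtain ⟨t', γ', h'⟩ := ih (fun i => v i.succ)
    obtain ⟨t, A, h0, h1⟩ := exists_sl_two_of_pair (v 0) t'
    obtain ⟨B, hB⟩ := exists_sl_of_sl_two (n := n + 1) A
    refine ⟨t, B * slLower (0, γ'), ?_⟩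
    rw [toMat_mul, Matrix.mul_apply_eq_vecMul, hB, toMat_slLower, ← Matrix.smul_vecMul, smul_add,
      ← Pi.single_smul, ← Pi.single_smul, smul_eq_mul, smul_eq_mul, ← h0, ← h1]
    ext j
    rw [Matrix.add_vecMul, Pi.add_apply, Matrix.single_vecMul, Matrix.single_vecMul]
    refine Fin.cases ?_ (fun j => ?_) j
    · have := lowerMat_succ_zero (0 : Fin (n + 2) → ℤ) (toMat γ') 0
      rw [Fin.succ_zero_eq_one] at this
      simp [Matrix.row, this]
    · have e := congrFun h' j
      have := lowerMat_succ_succ (0 : Fin (n + 2) → ℤ) (toMat γ') 0 j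
      rw [Fin.succ_zero_eq_one] at this
      simp only [Pi.smul_apply, smul_eq_mul] at e
      simp [Matrix.row, this, e]

/-- If `w` is the first row of `γ`, pairing with the first column of `γ⁻¹` sends `w` to 1 and the
equation to `t = t' * m` for an integer `m`. -/
theorem nat_dvd_of_smul_row_eq {n : ℕ} {t t' : ℕ} {w w' : Fin (n + 2) → ℤ}
    (hw : w ∈ primitiveVectors n) (h : (t : ℤ) • w = (t' : ℤ) • w') : t' ∣ t := by
  obtain ⟨γ, rfl⟩ := hw
  have h1 : toMat γ 0 ⬝ᵥ (fun j => toMat γ⁻¹ j 0) = 1 := by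
    have := congrFun (congrFun (congrArg toMat (mul_inv_cancel γ)) 0) 0
    rw [toMat_mul, Matrix.mul_apply] at this
    exact this
  have h2 := congrArg (fun x => x ⬝ᵥ (fun j => toMat γ⁻¹ j 0)) h
  simp only [smul_dotProduct, h1, smul_eq_mul, mul_one] at h2
  exact Int.natCast_dvd_natCast.1 ⟨_, h2⟩

theorem ne_zero_of_mem_primitiveVectors {n : ℕ} {w : Fin (n + 2) → ℤ}
    (hw : w ∈ primitiveVectors n) : w ≠ 0 := by
  rintro rfl
  have := nat_dvd_of_smul_row_eq (t := 1) (t' := 0) (w' := 0) hw (by simp)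
  simp at this

/-- A nonzero integral vector is uniquely a positive multiple of a primitive vector. -/
def smulPrimitiveEquiv (n : ℕ) : ℕ × primitiveVectors n ≃ {v : Fin (n + 2) → ℤ // v ≠ 0} :=
  -- The index is shifted: `t : ℕ` stands for the positive multiplier `t + 1`.
  Equiv.ofBijective (fun x => ⟨((x.1 + 1 : ℕ) : ℤ) • x.2.1, smul_ne_zero
    (Int.natCast_ne_zero.2 (Nat.succ_ne_zero _)) (ne_zero_of_mem_primitiveVectors x.2.2)⟩) (by
    constructor
    · rintro ⟨t, w⟩ ⟨t', w'⟩ h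
      have h' := congrArg Subtype.val h
      simp only at h'
      have ht : t = t' := Nat.succ_injective (Nat.dvd_antisymm
        (nat_dvd_of_smul_row_eq w'.2 h'.symm) (nat_dvd_of_smul_row_eq w.2 h'))
      subst ht
      refine Prod.ext rfl (Subtype.ext ?_)
      exact smul_right_injective _ (Int.natCast_ne_zero.2 (Nat.succ_ne_zero t)) h'
    · rintro ⟨v, hv⟩
      obtain ⟨t, γ, h⟩ := exists_smul_row n v
      cases t with
      | zero => exact absurd (by simpa using h) hv
      | succ t => exact ⟨(t, ⟨_, γ, rfl⟩), Subtype.ext h.symm⟩)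

theorem smulPrimitiveEquiv_apply {n : ℕ} (x : ℕ × primitiveVectors n) :
    (smulPrimitiveEquiv n x).1 = ((x.1 + 1 : ℕ) : ℤ) • x.2.1 := rfl

end Primitive

/-! ### Unfolding over `SL(ℤ)` -/

section Unfolding

instance instHaarSLReal (n : ℕ) : (slMeasure ℝ (n + 1)).IsHaarMeasure := slMeasure_isHaarMeasure n

/-- The embedding of `SL(ℤ)` in `SL(ℝ)`. -/
abbrev slIntHom (n : ℕ) :
    SpecialLinearGroup (Fin (n + 1)) ℤ →* SpecialLinearGroup (Fin (n + 1)) ℝ :=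
  SpecialLinearGroup.map (Int.castRingHom ℝ)

instance countableSLInt (n : ℕ) : Countable (SpecialLinearGroup (Fin n) ℤ) :=
  have : Countable (Matrix (Fin n) (Fin n) ℤ) := inferInstanceAs (Countable (Fin n → Fin n → ℤ))
  toMat_injective.countable

/-- SL(ℤ) is discrete: an integral matrix whose entries differ from those of the identity by less
than 1 is the identity. Quotients of elements of `U` are that close to 1. -/
theorem exists_isStrictDomain_slIntHom (n : ℕ) : ∃ F, IsStrictDomain (slIntHom n) F := by
  have hV : {g : SpecialLinearGroup (Fin (n + 1)) ℝ | ∀ i j,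
      |toMat g i j - (1 : Matrix (Fin (n + 1)) (Fin (n + 1)) ℝ) i j| < 1} ∈
      nhds (1 : SpecialLinearGroup (Fin (n + 1)) ℝ) := by
    refine IsOpen.mem_nhds ?_ (by simp)
    simp only [Set.ofPred_forall]
    refine isOpen_iInter_of_finite fun i => isOpen_iInter_of_finite fun j => ?_
    exact isOpen_lt ((continuous_toMat.matrix_elem i j).sub continuous_const).abs continuous_const
  obtain ⟨U, hU, hdiv⟩ := exists_nhds_split_inv hV
  refine exists_isStrictDomain _ isOpen_interior (mem_interior_iff_mem_nhds.2 hU)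
    fun γ u hu hγu => toMat_injective (Matrix.ext fun i j => ?_)
  have h := hdiv _ (interior_subset hγu) _ (interior_subset hu) i j
  rw [mul_div_cancel_right] at h
  have h' : |((toMat γ i j - (1 : Matrix (Fin (n + 1)) (Fin (n + 1)) ℤ) i j : ℤ) : ℝ)| < 1 := by
    rw [toMat_map] at h
    rw [Matrix.map_apply, Matrix.one_apply] at h
    rw [Matrix.one_apply]
    push_cast
    exact h
  rw [← Int.cast_abs] at h'
  have := Int.abs_lt_one_iff.1 (by exact_mod_cast h')
  rw [toMat_one]
  exact sub_eq_zero.1 this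

theorem slLower_mul_slPhi {K : Type} [NormedField K] {n : ℕ}
    (a : (Fin (n + 1) → K) × SpecialLinearGroup (Fin (n + 1)) K)
    (x : ((Fin (n + 1) → K) × SpecialLinearGroup (Fin (n + 1)) K) ×
      {y : Fin (n + 2) → K // y 0 ≠ 0}) :
    slLower a * slPhi x = slPhi ((a.1 + toMat a.2 *ᵥ x.1.1, a.2 * x.1.2), x.2) := by
  rw [slPhi_eq, slPhi_eq, ← mul_assoc, slLower_mul]

theorem ae_toMat_apply_ne_zero {K : Type} [NormedField K] [MeasureSpace K] [BorelSpace K]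
    [SecondCountableTopology K] (n : ℕ) : ∀ᵐ g ∂(slMeasure K (n + 2)), toMat g 0 0 ≠ 0 := by
  rw [ae_iff, slMeasure, Measure.map_apply continuous_slPhi.measurable]
  · have : slPhi ⁻¹' {g : SpecialLinearGroup (Fin (n + 2)) K | ¬toMat g 0 0 ≠ 0} = ∅ :=
      Set.eq_empty_of_forall_notMem fun x hx => hx (slPhi_mem_bigCell x)
    rw [this, measure_empty]
  · simp only [not_not]
    exact measurableSet_eq_fun (continuous_toMat.matrix_elem 0 0).measurable measurable_const

theorem ae_forall_slIntHom (n : ℕ) :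
    ∀ᵐ g ∂(slMeasure ℝ (n + 2)), ∀ γ, toMat (slIntHom (n + 1) γ * g) 0 0 ≠ 0 := by
  rw [ae_all_iff]
  intro γ
  exact (measurePreserving_mul_left _ (slIntHom (n + 1) γ)).quasiMeasurePreserving.ae
    (ae_toMat_apply_ne_zero n)

/-- The half-open cube. -/
def unitCube (n : ℕ) : Set (Fin n → ℝ) := Set.univ.pi fun _ => Set.Ico 0 1

/-- A fundamental domain for the stabilizer of the first basis row vector in `SL(ℤ)`. -/
def unfoldSet {n : ℕ} (D : Set (SpecialLinearGroup (Fin (n + 1)) ℝ)) :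
    Set (SpecialLinearGroup (Fin (n + 2)) ℝ) :=
  slPhi '' ((unitCube (n + 1) ×ˢ D) ×ˢ Set.univ)

theorem slPhi_mem_unfoldSet {n : ℕ} {D : Set (SpecialLinearGroup (Fin (n + 1)) ℝ)}
    (x : ((Fin (n + 1) → ℝ) × SpecialLinearGroup (Fin (n + 1)) ℝ) ×
      {y : Fin (n + 2) → ℝ // y 0 ≠ 0}) :
    slPhi x ∈ unfoldSet D ↔ x.1.1 ∈ unitCube (n + 1) ∧ x.1.2 ∈ D := by
  rw [unfoldSet, slPhi_injective.mem_set_image]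
  simp

theorem measurableSet_unitCube (n : ℕ) : MeasurableSet (unitCube n) :=
  MeasurableSet.univ_pi fun _ => measurableSet_Ico

theorem volume_unitCube (n : ℕ) : volume (unitCube n) = 1 := by
  rw [unitCube, Real.volume_pi_Ico]
  simp

theorem measurableSet_unfoldSet {n : ℕ} {D : Set (SpecialLinearGroup (Fin (n + 1)) ℝ)}
    (hD : MeasurableSet D) : MeasurableSet (unfoldSet D) :=
  isOpenEmbedding_slPhi.measurableEmbedding.measurableSet_image.2
    (((measurableSet_unitCube _).prod hD).prod MeasurableSet.univ)

/-- In the coordinates `Φ` the indicator depends only on the lower factor and `f` only on the row,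
so the integral splits; the unit cube has volume 1. -/
theorem lintegral_unfoldSet {n : ℕ} {D : Set (SpecialLinearGroup (Fin (n + 1)) ℝ)}
    (hD : MeasurableSet D) {f : (Fin (n + 2) → ℝ) → ENNReal} (hf : Measurable f) :
    ∫⁻ g, (unfoldSet D).indicator 1 g * f (toMat g 0) ∂(slMeasure ℝ (n + 2)) =
      slMeasure ℝ (n + 1) D * ∫⁻ y, f y := by
  have := sigmaFinite_comap_subtype (volume : Measure (Fin (n + 2) → ℝ))
    (measurableSet_apply_ne_zero 0)
  rw [slMeasure, isOpenEmbedding_slPhi.measurableEmbedding.lintegral_map]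
  have e : ∀ x : ((Fin (n + 1) → ℝ) × SpecialLinearGroup (Fin (n + 1)) ℝ) ×
      {y : Fin (n + 2) → ℝ // y 0 ≠ 0},
      (unfoldSet D).indicator 1 (slPhi x) * f (toMat (slPhi x) 0) =
        ((unitCube (n + 1) ×ˢ D).indicator 1 x.1) * f x.2 := by
    intro x
    rw [row_slPhi]
    congr 1
    by_cases h : x.1 ∈ unitCube (n + 1) ×ˢ D
    · rw [Set.indicator_of_mem h, Set.indicator_of_mem ((slPhi_mem_unfoldSet x).2 h)]
      rfl
    · rw [Set.indicator_of_notMem h,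
        Set.indicator_of_notMem fun h' => h ((slPhi_mem_unfoldSet x).1 h')]
  simp only [e]
  have hS := (measurableSet_unitCube (n + 1)).prod hD
  rw [lintegral_prod_mul (g := fun y : {y : Fin (n + 2) → ℝ // y 0 ≠ 0} => f y.1)
    (measurable_one.indicator hS).aemeasurable
    (hf.comp measurable_subtype_coe).aemeasurable, lintegral_indicator_one hS, Measure.prod_prod,
    volume_unitCube, one_mul, lintegral_comap_subtype _ (measurableSet_apply_ne_zero 0),
    Measure.restrict_eq_self_of_ae_mem]
  exact ae_apply_ne_zero 0

/-- The matrices with a given first row form a coset of the stabilizer, parametrized by an integral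
vector and an element of the smaller SL(ℤ). The domain `D` determines the latter, and then integer
parts determine the vector. -/
theorem existsUnique_mem_unfoldSet {n : ℕ} {D : Set (SpecialLinearGroup (Fin (n + 1)) ℝ)}
    (hD : IsStrictDomain (slIntHom n) D) {g : SpecialLinearGroup (Fin (n + 2)) ℝ}
    (hg : ∀ γ, toMat (slIntHom (n + 1) γ * g) 0 0 ≠ 0) (γ₀ : SpecialLinearGroup (Fin (n + 2)) ℤ) :
    ∃! γ, toMat γ 0 = toMat γ₀ 0 ∧ slIntHom (n + 1) γ * g ∈ unfoldSet D := by
  obtain ⟨x, hx⟩ := mem_range_slPhi (hg γ₀)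
  have key : ∀ a : (Fin (n + 1) → ℤ) × SpecialLinearGroup (Fin (n + 1)) ℤ,
      slIntHom (n + 1) (slLower a * γ₀) * g ∈ unfoldSet D ↔
        (fun i => ((a.1 i : ℤ) : ℝ)) + toMat (slIntHom n a.2) *ᵥ x.1.1 ∈ unitCube (n + 1) ∧
        slIntHom n a.2 * x.1.2 ∈ D := by
    intro a
    rw [map_mul, mul_assoc, ← hx, slLower_map, slLower_mul_slPhi, slPhi_mem_unfoldSet]
    rfl
  obtain ⟨h, hh, huniq⟩ := hD.2 x.1.2
  have hfloor : ∀ (a : Fin (n + 1) → ℤ) (v : Fin (n + 1) → ℝ),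
      (fun i => ((a i : ℤ) : ℝ)) + v ∈ unitCube (n + 1) ↔ a = fun i => -⌊v i⌋ := by
    intro a v
    simp only [unitCube, Set.mem_pi, Set.mem_univ, true_implies, Pi.add_apply, Set.mem_Ico,
      funext_iff]
    refine forall_congr' fun i => ?_
    rw [eq_neg_iff_add_eq_zero, add_comm (a i), ← Int.floor_add_intCast, Int.floor_eq_zero_iff,
      add_comm, Set.mem_Ico]
  refine ⟨slLower ((fun i => -⌊(toMat (slIntHom n h) *ᵥ x.1.1) i⌋), h) * γ₀, ⟨?_, ?_⟩, ?_⟩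
  · rw [row_slLower_mul]
  · exact (key _).2 ⟨(hfloor _ _).2 rfl, hh⟩
  · rintro γ ⟨hrow, hmem⟩
    obtain ⟨a, ha⟩ : ∃ a, γ = slLower a * γ₀ :=
      ⟨lowerPart ⟨_, row_mul_inv_of_row_eq hrow⟩, by
        rw [slLower_lowerPart, inv_mul_cancel_right]⟩
    rw [ha, key] at hmem
    have h2 : a.2 = h := huniq _ hmem.2
    have h1 := (hfloor _ _).1 hmem.1
    rw [ha, ← h2, ← h1]

theorem row_slIntHom_mul {n : ℕ} (γ : SpecialLinearGroup (Fin (n + 1)) ℤ)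
    (g : SpecialLinearGroup (Fin (n + 1)) ℝ) :
    toMat (slIntHom n γ * g) 0 = (fun j => ((toMat γ 0 j : ℤ) : ℝ)) ᵥ* toMat g := by
  rw [toMat_mul, Matrix.mul_apply_eq_vecMul]
  rfl

theorem measurable_vecMul_toMat {n : ℕ} (w : Fin n → ℝ) :
    Measurable fun g : SpecialLinearGroup (Fin n) ℝ => w ᵥ* toMat g :=
  (Continuous.matrix_vecMul continuous_const continuous_toMat).measurable

/-- Unfold the integral of `lintegral_unfoldSet` into a sum over SL(ℤ) and group its terms by the
first row `w`. For almost every `g` exactly one term in each group survives, and its value is `f` at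
`w ᵥ* g`. -/
theorem lintegral_tsum_primitive {n : ℕ} {D : Set (SpecialLinearGroup (Fin (n + 1)) ℝ)}
    (hD : IsStrictDomain (slIntHom n) D) {F : Set (SpecialLinearGroup (Fin (n + 2)) ℝ)}
    (hF : IsStrictDomain (slIntHom (n + 1)) F) {f : (Fin (n + 2) → ℝ) → ENNReal}
    (hf : Measurable f) :
    ∫⁻ g in F, ∑' w : primitiveVectors n, f ((fun j => ((w.1 j : ℤ) : ℝ)) ᵥ* toMat g)
      ∂(slMeasure ℝ (n + 2)) = slMeasure ℝ (n + 1) D * ∫⁻ y, f y := by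
  have hrow : Measurable fun g : SpecialLinearGroup (Fin (n + 2)) ℝ => toMat g 0 :=
    measurable_pi_iff.2 fun j => (continuous_toMat.matrix_elem 0 j).measurable
  rw [← lintegral_unfoldSet hD.1 hf, hF.lintegral_eq_tsum
    (f := fun g => (unfoldSet D).indicator 1 g * f (toMat g 0)) _
    ((measurable_one.indicator (measurableSet_unfoldSet hD.1)).mul (hf.comp hrow))]
  refine lintegral_congr_ae (ae_restrict_of_ae ?_)
  filter_upwards [ae_forall_slIntHom n] with g hg
  let r : SpecialLinearGroup (Fin (n + 2)) ℤ → primitiveVectors n := fun γ => ⟨toMat γ 0, γ, rfl⟩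
  rw [← (Equiv.sigmaFiberEquiv r).tsum_eq, ENNReal.tsum_sigma']
  refine tsum_congr fun w => ?_
  obtain ⟨γ₀, hγ₀⟩ := w.2
  obtain ⟨γ, ⟨hγ, hmem⟩, huniq⟩ := existsUnique_mem_unfoldSet hD hg γ₀
  have hr : r γ = w := Subtype.ext (hγ.trans hγ₀)
  rw [tsum_eq_single ⟨γ, hr⟩]
  · simp only [Equiv.sigmaFiberEquiv, Equiv.coe_fn_mk]
    rw [Set.indicator_of_mem hmem, Pi.one_apply, one_mul, row_slIntHom_mul, ← hr]
  · rintro ⟨δ, hδ⟩ hne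
    simp only [Equiv.sigmaFiberEquiv, Equiv.coe_fn_mk]
    rw [Set.indicator_of_notMem, zero_mul]
    intro hmem'
    refine hne (Subtype.ext (huniq δ ⟨?_, hmem'⟩))
    exact (congrArg Subtype.val hδ).trans hγ₀.symm

end Unfolding

/-! ### The covolume of `SL(ℤ)` in `SL(ℝ)` -/

section RealCovolume

/-- The value `ζ(k)`, as a sum in `[0, ∞]`. -/
def zetaENN (k : ℕ) : ENNReal := ∑' t : ℕ, ENNReal.ofReal (1 / ((t + 1 : ℕ) : ℝ) ^ k)

theorem summable_one_div_succ_pow {k : ℕ} (hk : 2 ≤ k) :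
    Summable fun t : ℕ => 1 / ((t + 1 : ℕ) : ℝ) ^ k :=
  (summable_nat_add_iff (f := fun t : ℕ => 1 / (t : ℝ) ^ k) 1).2
    (Real.summable_one_div_nat_pow.2 (by omega))

theorem zetaENN_ne_top {k : ℕ} (hk : 2 ≤ k) : zetaENN k ≠ ⊤ := by
  rw [zetaENN, ← ENNReal.ofReal_tsum_of_nonneg (fun t => by positivity)
    (summable_one_div_succ_pow hk)]
  exact ENNReal.ofReal_ne_top

theorem lintegral_comp_smul_pi {n : ℕ} {f : (Fin n → ℝ) → ENNReal} (hf : Measurable f) {r : ℝ}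
    (hr : 0 < r) : ∫⁻ y, f (r • y) = ENNReal.ofReal (1 / r ^ n) * ∫⁻ y, f y := by
  rw [← lintegral_map hf (measurable_const_smul r), Measure.map_addHaar_smul _ hr.ne',
    lintegral_smul_measure, smul_eq_mul, Module.finrank_fin_fun, abs_of_pos (by positivity),
    one_div]

theorem intCast_vecMul_zero {n : ℕ} (A : Matrix (Fin n) (Fin n) ℝ) :
    (fun j => (((0 : Fin n → ℤ) j : ℤ) : ℝ)) ᵥ* A = 0 := by
  have : (fun j => (((0 : Fin n → ℤ) j : ℤ) : ℝ)) = 0 := by ext; simp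
  rw [this, Matrix.zero_vecMul]

/-- Write a nonzero vector as `t + 1` times a primitive one. Rescaling `f` by `t + 1` divides its
integral by `(t + 1) ^ (n + 2)`, and the sum over `t` is the zeta value. -/
theorem lintegral_tsum_ne_zero {n : ℕ} {D : Set (SpecialLinearGroup (Fin (n + 1)) ℝ)}
    (hD : IsStrictDomain (slIntHom n) D) {F : Set (SpecialLinearGroup (Fin (n + 2)) ℝ)}
    (hF : IsStrictDomain (slIntHom (n + 1)) F) {f : (Fin (n + 2) → ℝ) → ENNReal}
    (hf : Measurable f) :
    ∫⁻ g in F, ∑' v : {v : Fin (n + 2) → ℤ // v ≠ 0},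
      f ((fun j => ((v.1 j : ℤ) : ℝ)) ᵥ* toMat g) ∂(slMeasure ℝ (n + 2)) =
      slMeasure ℝ (n + 1) D * zetaENN (n + 2) * ∫⁻ y, f y := by
  have hm : ∀ (t : ℕ) (w : primitiveVectors n), Measurable
      fun g : SpecialLinearGroup (Fin (n + 2)) ℝ =>
        f (((t + 1 : ℕ) : ℝ) • ((fun j => ((w.1 j : ℤ) : ℝ)) ᵥ* toMat g)) := fun t w =>
    hf.comp ((measurable_const_smul ((t + 1 : ℕ) : ℝ)).comp (measurable_vecMul_toMat _))
  have e : ∀ g : SpecialLinearGroup (Fin (n + 2)) ℝ,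
      ∑' v : {v : Fin (n + 2) → ℤ // v ≠ 0}, f ((fun j => ((v.1 j : ℤ) : ℝ)) ᵥ* toMat g) =
      ∑' (t : ℕ) (w : primitiveVectors n),
        f (((t + 1 : ℕ) : ℝ) • ((fun j => ((w.1 j : ℤ) : ℝ)) ᵥ* toMat g)) := by
    intro g
    rw [← (smulPrimitiveEquiv n).tsum_eq, ENNReal.tsum_prod']
    refine tsum_congr fun t => tsum_congr fun w => ?_
    rw [smulPrimitiveEquiv_apply, ← Matrix.smul_vecMul]
    congr 2
    ext j
    simp
  simp only [e]
  rw [lintegral_tsum fun t => (Measurable.tsum (hm t)).aemeasurable]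
  have h2 : ∀ t : ℕ, ∫⁻ g in F, ∑' w : primitiveVectors n,
      f (((t + 1 : ℕ) : ℝ) • ((fun j => ((w.1 j : ℤ) : ℝ)) ᵥ* toMat g)) ∂(slMeasure ℝ (n + 2)) =
      ENNReal.ofReal (1 / ((t + 1 : ℕ) : ℝ) ^ (n + 2)) *
        (slMeasure ℝ (n + 1) D * ∫⁻ y, f y) := by
    intro t
    rw [lintegral_tsum_primitive hD hF (f := fun y => f (((t + 1 : ℕ) : ℝ) • y))
      (hf.comp (measurable_const_smul _)), lintegral_comp_smul_pi hf (by positivity)]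
    ring
  simp only [h2]
  rw [ENNReal.tsum_mul_right, zetaENN]
  ring

/-! ### Counting lattice points in cubes -/

/-- The half-open cube with side `N`. -/
def scaledCube (n N : ℕ) : Set (Fin n → ℝ) := Set.univ.pi fun _ => Set.Ico 0 (N : ℝ)

/-- The open cube `(-1, 1)^n`. -/
def symmCube (n : ℕ) : Set (Fin n → ℝ) := Set.univ.pi fun _ => Set.Ioo (-1) 1

theorem measurableSet_scaledCube (n N : ℕ) : MeasurableSet (scaledCube n N) :=
  MeasurableSet.univ_pi fun _ => measurableSet_Ico

theorem measurableSet_symmCube (n : ℕ) : MeasurableSet (symmCube n) :=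
  MeasurableSet.univ_pi fun _ => measurableSet_Ioo

theorem volume_scaledCube (n N : ℕ) : volume (scaledCube n N) = (N : ENNReal) ^ n := by
  rw [scaledCube, Real.volume_pi_Ico]
  simp

theorem volume_symmCube_ne_top (n : ℕ) : volume (symmCube n) ≠ ⊤ := by
  rw [symmCube, Real.volume_pi_Ioo]
  simp only [Finset.prod_const]
  exact ENNReal.pow_ne_top ENNReal.ofReal_ne_top

/-- The number of points of `ℤ^n A` in a set. -/
def latticeCount {n : ℕ} (B : Set (Fin n → ℝ)) (A : Matrix (Fin n) (Fin n) ℝ) : ENNReal :=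
  ∑' v : Fin n → ℤ, B.indicator 1 ((fun j => ((v j : ℤ) : ℝ)) ᵥ* A)

/-- If the translated cube contains a lattice point, subtracting it moves all the others into (-1,
1)^n. The bound does not depend on `k`. -/
theorem latticeCount_unitCube_translate_le {n : ℕ} (A : Matrix (Fin n) (Fin n) ℝ)
    (k : Fin n → ℝ) :
    ∑' v : Fin n → ℤ, (unitCube n).indicator (1 : (Fin n → ℝ) → ENNReal)
      ((fun j => ((v j : ℤ) : ℝ)) ᵥ* A - k) ≤ latticeCount (symmCube n) A := by
  by_cases h : ∃ v₀ : Fin n → ℤ, (fun j => ((v₀ j : ℤ) : ℝ)) ᵥ* A - k ∈ unitCube n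
  · obtain ⟨v₀, h₀⟩ := h
    rw [latticeCount, ← (Equiv.subRight v₀).tsum_eq fun v : Fin n → ℤ =>
      (symmCube n).indicator (1 : (Fin n → ℝ) → ENNReal) ((fun j => ((v j : ℤ) : ℝ)) ᵥ* A)]
    refine ENNReal.tsum_le_tsum fun v => ?_
    by_cases hv : (fun j => ((v j : ℤ) : ℝ)) ᵥ* A - k ∈ unitCube n
    · have e : (fun j => (((Equiv.subRight v₀ v) j : ℤ) : ℝ)) =
          (fun j => ((v j : ℤ) : ℝ)) - (fun j => ((v₀ j : ℤ) : ℝ)) := by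
        ext j
        simp
      have hmem : (fun j => (((Equiv.subRight v₀ v) j : ℤ) : ℝ)) ᵥ* A ∈ symmCube n := by
        rw [e, Matrix.sub_vecMul]
        simp only [unitCube, symmCube, Set.mem_pi, Set.mem_univ, true_implies, Set.mem_Ico,
          Set.mem_Ioo, Pi.sub_apply] at h₀ hv ⊢
        intro i
        have := h₀ i
        have := hv i
        constructor <;> linarith
      rw [Set.indicator_of_mem hv, Set.indicator_of_mem hmem]
      exact le_rfl
    · rw [Set.indicator_of_notMem hv]
      exact zero_le
  · have : ∀ v : Fin n → ℤ, (unitCube n).indicator (1 : (Fin n → ℝ) → ENNReal)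
        ((fun j => ((v j : ℤ) : ℝ)) ᵥ* A - k) = 0 := fun v =>
      Set.indicator_of_notMem (fun hv => h ⟨v, hv⟩) _
    simp only [this, tsum_zero]
    exact zero_le

/-- Cut the large cube into unit cubes. After division by `N ^ n` the bound no longer depends on
`N`, so it can dominate in the limit below. -/
theorem latticeCount_scaledCube_le {n : ℕ} (A : Matrix (Fin n) (Fin n) ℝ) (N : ℕ) :
    latticeCount (scaledCube n N) A ≤ (N : ENNReal) ^ n * latticeCount (symmCube n) A := by
  have h1 : ∀ x : Fin n → ℝ, (scaledCube n N).indicator (1 : (Fin n → ℝ) → ENNReal) x ≤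
      ∑ k : Fin n → Fin N, (unitCube n).indicator 1 (x - fun j => ((k j : ℕ) : ℝ)) := by
    intro x
    by_cases hx : x ∈ scaledCube n N
    · rw [Set.indicator_of_mem hx]
      simp only [scaledCube, Set.mem_pi, Set.mem_univ, true_implies, Set.mem_Ico] at hx
      let k : Fin n → Fin N := fun j => ⟨⌊x j⌋₊, (Nat.floor_lt (hx j).1).2 (hx j).2⟩
      have hk : (x - fun j => ((k j : ℕ) : ℝ)) ∈ unitCube n := by
        simp only [unitCube, Set.mem_pi, Set.mem_univ, true_implies, Set.mem_Ico, Pi.sub_apply, k]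
        intro i
        have := Nat.floor_le (hx i).1
        have := Nat.lt_floor_add_one (x i)
        constructor <;> linarith
      exact (le_of_eq (Set.indicator_of_mem hk _).symm).trans (Finset.single_le_sum
        (f := fun k : Fin n → Fin N => (unitCube n).indicator (1 : (Fin n → ℝ) → ENNReal)
          (x - fun j => ((k j : ℕ) : ℝ))) (fun _ _ => zero_le) (Finset.mem_univ k))
    · rw [Set.indicator_of_notMem hx]
      exact zero_le
  calc latticeCount (scaledCube n N) A
      ≤ ∑' v : Fin n → ℤ, ∑ k : Fin n → Fin N, (unitCube n).indicator 1
        ((fun j => ((v j : ℤ) : ℝ)) ᵥ* A - fun j => ((k j : ℕ) : ℝ)) :=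
        ENNReal.tsum_le_tsum fun v => h1 _
    _ = ∑ k : Fin n → Fin N, ∑' v : Fin n → ℤ, (unitCube n).indicator 1
        ((fun j => ((v j : ℤ) : ℝ)) ᵥ* A - fun j => ((k j : ℕ) : ℝ)) :=
        Summable.tsum_finsetSum fun _ _ => ENNReal.summable
    _ ≤ ∑ k : Fin n → Fin N, latticeCount (symmCube n) A :=
        Finset.sum_le_sum fun k _ => latticeCount_unitCube_translate_le A _
    _ = (N : ENNReal) ^ n * latticeCount (symmCube n) A := by
        rw [Finset.sum_const, nsmul_eq_mul]
        simp

theorem latticeCount_eq_add {n : ℕ} (B : Set (Fin n → ℝ)) (A : Matrix (Fin n) (Fin n) ℝ) :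
    latticeCount B A = B.indicator 1 0 +
      ∑' v : {v : Fin n → ℤ // v ≠ 0}, B.indicator 1 ((fun j => ((v.1 j : ℤ) : ℝ)) ᵥ* A) := by
  have h := Summable.tsum_add_tsum_compl (s := {(0 : Fin n → ℤ)})
    (f := fun v => B.indicator (1 : (Fin n → ℝ) → ENNReal) ((fun j => ((v j : ℤ) : ℝ)) ᵥ* A))
    ENNReal.summable ENNReal.summable
  rw [latticeCount, ← h, tsum_singleton (0 : Fin n → ℤ) fun v : Fin n → ℤ =>
    B.indicator (1 : (Fin n → ℝ) → ENNReal) ((fun j => ((v j : ℤ) : ℝ)) ᵥ* A), intCast_vecMul_zero]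
  rfl

theorem latticeCount_eq_encard {n : ℕ} (B : Set (Fin n → ℝ)) (A : Matrix (Fin n) (Fin n) ℝ) :
    latticeCount B A = {v : Fin n → ℤ | (fun j => ((v j : ℤ) : ℝ)) ᵥ* A ∈ B}.encard := by
  rw [← ENNReal.tsum_set_one, tsum_subtype _ fun _ => (1 : ENNReal)]
  rfl

-- Rescaling turns the count into one of points of N⁻¹ℤⁿ in a fixed set, as needed for the
-- asymptotic count. Boundedness matters because `Nat.card` of an infinite set is 0.
open Filter Topology Pointwise in
theorem latticeCount_scaledCube_eq_card {n : ℕ} (A : Matrix (Fin n) (Fin n) ℝ)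
    (hb : Bornology.IsBounded {x : Fin n → ℝ | x ᵥ* A ∈ unitCube n}) {N : ℕ} (hN : N ≠ 0) :
    latticeCount (scaledCube n N) A =
      Nat.card ↑({x : Fin n → ℝ | x ᵥ* A ∈ unitCube n} ∩
        (N : ℝ)⁻¹ • (Submodule.span ℤ (Set.range (Pi.basisFun ℝ (Fin n))) : Set (Fin n → ℝ))) := by
  have hN' : (N : ℝ) ≠ 0 := Nat.cast_ne_zero.2 hN
  have hNpos : (0 : ℝ) < N := Nat.cast_pos.2 (Nat.pos_of_ne_zero hN)
  have hinj : Function.Injective fun v : Fin n → ℤ => (N : ℝ)⁻¹ • fun j => ((v j : ℤ) : ℝ) := by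
    intro v w h
    have := smul_right_injective _ (inv_ne_zero hN') h
    ext j
    exact_mod_cast congrFun this j
  have hmem : ∀ x : Fin n → ℝ,
      x ∈ (Submodule.span ℤ (Set.range (Pi.basisFun ℝ (Fin n))) : Set (Fin n → ℝ)) ↔
        ∃ v : Fin n → ℤ, (fun j => ((v j : ℤ) : ℝ)) = x := by
    intro x
    rw [SetLike.mem_coe, Module.Basis.mem_span_iff_repr_mem]
    simp only [Pi.basisFun_repr, Set.mem_range, algebraMap_int_eq, Int.coe_castRingHom]
    rw [Classical.skolem]
    simp only [funext_iff]
  have himage : {x : Fin n → ℝ | x ᵥ* A ∈ unitCube n} ∩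
      (N : ℝ)⁻¹ • (Submodule.span ℤ (Set.range (Pi.basisFun ℝ (Fin n))) : Set (Fin n → ℝ)) =
      (fun v : Fin n → ℤ => (N : ℝ)⁻¹ • fun j => ((v j : ℤ) : ℝ)) ''
        {v : Fin n → ℤ | (fun j => ((v j : ℤ) : ℝ)) ᵥ* A ∈ scaledCube n N} := by
    have hcube : ∀ v : Fin n → ℤ, ((N : ℝ)⁻¹ • fun j => ((v j : ℤ) : ℝ)) ᵥ* A ∈ unitCube n ↔
        (fun j => ((v j : ℤ) : ℝ)) ᵥ* A ∈ scaledCube n N := by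
      intro v
      rw [Matrix.smul_vecMul]
      simp only [unitCube, scaledCube, Set.mem_pi, Set.mem_univ, true_implies, Set.mem_Ico,
        Pi.smul_apply, smul_eq_mul]
      refine forall_congr' fun i => ?_
      rw [inv_mul_lt_iff₀ hNpos, mul_one, mul_nonneg_iff_of_pos_left (inv_pos.2 hNpos)]
    ext x
    simp only [Set.mem_inter_iff, Set.mem_ofPred_eq, Set.mem_smul_set, Set.mem_image, hmem]
    constructor
    · rintro ⟨hx, _, ⟨v, rfl⟩, rfl⟩
      exact ⟨v, (hcube v).1 hx, rfl⟩
    · rintro ⟨v, hv, rfl⟩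
      exact ⟨(hcube v).2 hv, _, ⟨v, rfl⟩, rfl⟩
  have hfin : ({x : Fin n → ℝ | x ᵥ* A ∈ unitCube n} ∩
      (N : ℝ)⁻¹ • (Submodule.span ℤ (Set.range (Pi.basisFun ℝ (Fin n))) :
        Set (Fin n → ℝ))).Finite := by
    refine ((ZSpan.setFinite_inter (Pi.basisFun ℝ (Fin n)) (hb.smul₀ (N : ℝ))).image
      fun x => (N : ℝ)⁻¹ • x).subset ?_
    rintro x ⟨hx, y, hy, rfl⟩
    refine ⟨y, ⟨⟨(N : ℝ)⁻¹ • y, hx, ?_⟩, hy⟩, rfl⟩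
    simp only [smul_smul, mul_inv_cancel₀ hN', one_smul]
  rw [himage] at hfin ⊢
  rw [latticeCount_eq_encard, Nat.card_image_of_injective hinj, Nat.card_coe_set_eq,
    ← (hfin.of_finite_image hinj.injOn).cast_ncard_eq]
  simp

-- The preimage of the unit cube under `g` is bounded, has volume 1 because `g` preserves volume,
-- and has null frontier because it is convex; so the normalized count tends to 1.
open Filter Topology Pointwise in
theorem tendsto_latticeCount_scaledCube {n : ℕ} (g : SpecialLinearGroup (Fin (n + 1)) ℝ) :
    Tendsto (fun N : ℕ => latticeCount (scaledCube (n + 1) (N + 1)) (toMat g) /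
      ((N + 1 : ℕ) : ENNReal) ^ (n + 1)) atTop (𝓝 1) := by
  have hconv : Convex ℝ {x : Fin (n + 1) → ℝ | x ᵥ* toMat g ∈ unitCube (n + 1)} :=
    (convex_pi fun _ _ => convex_Ico 0 1 : Convex ℝ (unitCube (n + 1))).linear_preimage
      (Matrix.vecMulLinear (toMat g))
  have hvol : volume {x : Fin (n + 1) → ℝ | x ᵥ* toMat g ∈ unitCube (n + 1)} = 1 :=
    ((measurePreserving_vecMul g).measure_preimage_emb (measurableEmbedding_vecMul g) _).trans
      (volume_unitCube _)
  have hmeas : MeasurableSet {x : Fin (n + 1) → ℝ | x ᵥ* toMat g ∈ unitCube (n + 1)} :=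
    (measurePreserving_vecMul g).measurable (measurableSet_unitCube _)
  have hb : Bornology.IsBounded {x : Fin (n + 1) → ℝ | x ᵥ* toMat g ∈ unitCube (n + 1)} := by
    have hcomp : IsCompact ((fun y : Fin (n + 1) → ℝ => y ᵥ* toMat g⁻¹) ''
        Set.univ.pi fun _ => Set.Icc 0 1) :=
      (isCompact_univ_pi fun _ => isCompact_Icc).image
        (Continuous.matrix_vecMul continuous_id continuous_const)
    refine hcomp.isBounded.subset fun x hx => ⟨x ᵥ* toMat g, ?_, ?_⟩
    · exact Set.pi_mono (fun _ _ => Set.Ico_subset_Icc_self) hx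
    · simp only [Matrix.vecMul_vecMul, ← toMat_mul, mul_inv_cancel, toMat_one, vecMul_one]
  have h := tendsto_card_div_pow_atTop_volume _ hb hmeas (hconv.addHaar_frontier volume)
  rw [measureReal_def, hvol, ENNReal.toReal_one, Fintype.card_fin] at h
  have h' := (ENNReal.continuous_ofReal.tendsto 1).comp (h.comp (tendsto_add_atTop_nat 1))
  rw [ENNReal.ofReal_one] at h'
  refine h'.congr fun N => ?_
  simp only [Function.comp_apply]
  rw [latticeCount_scaledCube_eq_card _ hb (Nat.succ_ne_zero N),
    ENNReal.ofReal_div_of_pos (by positivity), ENNReal.ofReal_natCast,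
    ENNReal.ofReal_pow (by positivity), ENNReal.ofReal_natCast]

-- Let `b N` count the nonzero lattice points in the cube of side `N + 1`, divided by the volume of
-- the cube. Its integral over `F` is `c` for every `N`, and it tends to 1 pointwise. Fatou's lemma
-- bounds the measure of `F` by `c`; once this is known to be finite, dominated convergence gives
-- equality.
open Filter Topology in
theorem slMeasure_strictDomain_succ {n : ℕ} {D : Set (SpecialLinearGroup (Fin (n + 1)) ℝ)}
    (hD : IsStrictDomain (slIntHom n) D) (hfin : slMeasure ℝ (n + 1) D ≠ ⊤)
    {F : Set (SpecialLinearGroup (Fin (n + 2)) ℝ)} (hF : IsStrictDomain (slIntHom (n + 1)) F) :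
    slMeasure ℝ (n + 2) F = slMeasure ℝ (n + 1) D * zetaENN (n + 2) := by
  set μ := (slMeasure ℝ (n + 2)).restrict F with hμ
  set c := slMeasure ℝ (n + 1) D * zetaENN (n + 2) with hc
  have hc_top : c ≠ ⊤ := ENNReal.mul_ne_top hfin (zetaENN_ne_top (by omega))
  have hmeas : ∀ B : Set (Fin (n + 2) → ℝ), MeasurableSet B → Measurable
      fun g : SpecialLinearGroup (Fin (n + 2)) ℝ => ∑' v : {v : Fin (n + 2) → ℤ // v ≠ 0},
        B.indicator (1 : (Fin (n + 2) → ℝ) → ENNReal) ((fun j => ((v.1 j : ℤ) : ℝ)) ᵥ* toMat g) := fun B hB =>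
    Measurable.tsum fun v =>
      (measurable_one.indicator hB).comp (measurable_vecMul_toMat _)
  have hint : ∀ B : Set (Fin (n + 2) → ℝ), MeasurableSet B →
      ∫⁻ g, ∑' v : {v : Fin (n + 2) → ℤ // v ≠ 0},
        B.indicator (1 : (Fin (n + 2) → ℝ) → ENNReal) ((fun j => ((v.1 j : ℤ) : ℝ)) ᵥ* toMat g) ∂μ =
      c * volume B := fun B hB => by
    rw [hμ, lintegral_tsum_ne_zero hD hF (measurable_one.indicator hB),
      lintegral_indicator_one hB]
  let b : ℕ → SpecialLinearGroup (Fin (n + 2)) ℝ → ENNReal := fun N g =>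
    (∑' v : {v : Fin (n + 2) → ℤ // v ≠ 0}, (scaledCube (n + 2) (N + 1)).indicator
      (1 : (Fin (n + 2) → ℝ) → ENNReal) ((fun j => ((v.1 j : ℤ) : ℝ)) ᵥ* toMat g)) /
      ((N + 1 : ℕ) : ENNReal) ^ (n + 2)
  have hNpos : ∀ N : ℕ, ((N + 1 : ℕ) : ENNReal) ^ (n + 2) ≠ 0 := fun N =>
    pow_ne_zero _ (Nat.cast_ne_zero.2 (Nat.succ_ne_zero N))
  have hNtop : ∀ N : ℕ, ((N + 1 : ℕ) : ENNReal) ^ (n + 2) ≠ ⊤ := fun N =>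
    ENNReal.pow_ne_top (ENNReal.natCast_ne_top _)
  have hbm : ∀ N, Measurable (b N) := fun N =>
    (hmeas _ (measurableSet_scaledCube _ _)).div_const _
  have hbint : ∀ N, ∫⁻ g, b N g ∂μ = c := by
    intro N
    simp only [b, div_eq_mul_inv]
    rw [lintegral_mul_const _ (hmeas _ (measurableSet_scaledCube _ _)),
      hint _ (measurableSet_scaledCube _ _), volume_scaledCube, mul_assoc,
      ENNReal.mul_inv_cancel (hNpos N) (hNtop N), mul_one]
  have hblim : ∀ g, Tendsto (fun N => b N g) atTop (𝓝 1) := by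
    intro g
    -- The origin lies in every cube but is not counted by `b N`; its share vanishes in the limit.
    have h0 : Tendsto (fun N : ℕ => 1 / ((N + 1 : ℕ) : ENNReal) ^ (n + 2)) atTop (𝓝 0) := by
      have h := (ENNReal.tendsto_inv_nat_nhds_zero.comp (tendsto_add_atTop_nat 1))
      have h' := ENNReal.Tendsto.pow (n := n + 2) h
      simp only [Function.comp_def, ne_eq, Nat.succ_ne_zero, not_false_eq_true, zero_pow,
        ← ENNReal.inv_pow] at h'
      simpa only [one_div] using h'
    have h1 := ENNReal.Tendsto.sub (tendsto_latticeCount_scaledCube g) h0 (Or.inl ENNReal.one_ne_top)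
    rw [tsub_zero] at h1
    refine h1.congr fun N => ?_
    rw [latticeCount_eq_add, Set.indicator_of_mem, Pi.one_apply, ENNReal.add_div]
    · change 1 / ((N + 1 : ℕ) : ENNReal) ^ (n + 2) + b N g - 1 / ((N + 1 : ℕ) : ENNReal) ^ (n + 2) = b N g
      exact ENNReal.add_sub_cancel_left (ENNReal.div_ne_top ENNReal.one_ne_top (hNpos N))
    · simp only [scaledCube, Set.mem_pi, Set.mem_univ, true_implies, Set.mem_Ico, Pi.zero_apply,
        le_refl, true_and]
      intro _
      positivity
  have hone : ∫⁻ _, 1 ∂μ = slMeasure ℝ (n + 2) F := by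
    rw [lintegral_one, hμ, Measure.restrict_apply_univ]
  have hle : slMeasure ℝ (n + 2) F ≤ c := by
    rw [← hone]
    calc ∫⁻ _, 1 ∂μ = ∫⁻ g, liminf (fun N => b N g) atTop ∂μ := by
          refine lintegral_congr fun g => ?_
          rw [(hblim g).liminf_eq]
      _ ≤ liminf (fun N => ∫⁻ g, b N g ∂μ) atTop := lintegral_liminf_le hbm
      _ = c := by simp only [hbint, liminf_const]
  have hdom : Tendsto (fun N => ∫⁻ g, b N g ∂μ) atTop (𝓝 (∫⁻ _, 1 ∂μ)) := by
    refine tendsto_lintegral_of_dominated_convergence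
      (fun g => latticeCount (symmCube (n + 2)) (toMat g)) hbm ?_ ?_ (ae_of_all _ hblim)
    · intro N
      refine ae_of_all _ fun g => ?_
      refine ENNReal.div_le_of_le_mul' (le_trans ?_ (latticeCount_scaledCube_le (toMat g) (N + 1)))
      rw [latticeCount_eq_add]
      exact le_add_self
    -- The origin contributes a constant to the dominating function, integrable because `hle` makes
    -- the measure of `F` finite; the remaining sum has integral `c` times the volume of the cube.
    · simp only [latticeCount_eq_add]
      rw [lintegral_add_right _ (hmeas _ (measurableSet_symmCube _)),
        hint _ (measurableSet_symmCube _), lintegral_const]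
      refine ENNReal.add_ne_top.2 ⟨ENNReal.mul_ne_top ?_ ?_,
        ENNReal.mul_ne_top hc_top (volume_symmCube_ne_top _)⟩
      · refine ne_top_of_le_ne_top ENNReal.one_ne_top (Set.indicator_le_self' ?_ _)
        simp
      · rw [hμ, Measure.restrict_apply_univ]
        exact ne_top_of_le_ne_top hc_top hle
  simp only [hbint] at hdom
  rw [← hone]
  exact tendsto_nhds_unique hdom tendsto_const_nhds

theorem slMeasure_strictDomain (n : ℕ) {F : Set (SpecialLinearGroup (Fin (n + 1)) ℝ)}
    (hF : IsStrictDomain (slIntHom n) F) :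
    slMeasure ℝ (n + 1) F = ∏ k ∈ Finset.Icc 2 (n + 1), zetaENN k := by
  induction n with
  | zero =>
    obtain ⟨γ, hγ, -⟩ := hF.2 1
    rw [Subsingleton.elim (α := SpecialLinearGroup (Fin 1) ℝ) (slIntHom 0 γ * 1) 1] at hγ
    simp [slMeasure, hγ]
  | succ n ih =>
    obtain ⟨D, hD⟩ := exists_isStrictDomain_slIntHom n
    have hfin : slMeasure ℝ (n + 1) D ≠ ⊤ := by
      rw [ih hD]
      exact ENNReal.prod_ne_top fun k hk => zetaENN_ne_top (Finset.mem_Icc.1 hk).1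
    rw [slMeasure_strictDomain_succ hD hfin hF, ih hD,
      Finset.prod_Icc_succ_top (a := 2) (b := n + 1) (by omega)]

end RealCovolume

/-! ### The volume of `SL(ℤ_p)` -/

theorem indicator_one_congr {α β : Type*} {s : Set α} {t : Set β} {x : α} {y : β}
    (h : x ∈ s ↔ y ∈ t) : s.indicator (1 : α → ENNReal) x = t.indicator 1 y := by
  by_cases hx : x ∈ s
  · rw [Set.indicator_of_mem hx, Set.indicator_of_mem (h.1 hx)]
    rfl
  · rw [Set.indicator_of_notMem hx, Set.indicator_of_notMem fun hy => hx (h.2 hy)]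

section PadicVolume

variable (p : ℕ) [hp : Fact p.Prime]

instance instAddHaarPadic : (volume : Measure ℚ_[p]).IsAddHaarMeasure :=
  inferInstanceAs (Measure.addHaarMeasure (padicUnitBall p)).IsAddHaarMeasure

instance instNullSingletonPadic : NullSingletonClass (volume : Measure ℚ_[p]) := inferInstance

instance instHaarSLPadic (n : ℕ) : (slMeasure ℚ_[p] (n + 1)).IsHaarMeasure :=
  slMeasure_isHaarMeasure n

instance instRightSLPadic (n : ℕ) : (slMeasure ℚ_[p] (n + 1)).IsMulRightInvariant :=
  isMulRightInvariant_of_hom_trivial sl_hom_units_eq_one _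

theorem volume_padic_closedBall : volume (Metric.closedBall (0 : ℚ_[p]) 1) = 1 :=
  Measure.addHaarMeasure_self (K₀ := padicUnitBall p)

theorem padic_closedBall_eq_iUnion :
    Metric.closedBall (0 : ℚ_[p]) 1 =
      ⋃ i : Fin p, (fun x => ((i : ℕ) : ℚ_[p]) + x) '' Metric.ball 0 1 := by
  ext x
  simp only [Metric.mem_closedBall, dist_zero_right, Set.mem_iUnion, Set.mem_image,
    Metric.mem_ball]
  constructor
  · intro hx
    obtain ⟨n, hn, h⟩ := PadicInt.exists_mem_range (⟨x, hx⟩ : ℤ_[p])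
    refine ⟨⟨n, hn⟩, x - n, ?_, by ring⟩
    exact PadicInt.mem_nonunits.1 (by simpa using h)
  · rintro ⟨i, y, hy, rfl⟩
    refine (Padic.nonarchimedean _ _).trans (max_le ?_ hy.le)
    exact_mod_cast Padic.norm_int_le_one (p := p) (i : ℕ)

/-- The `p` residue classes are disjoint translates of the open unit ball pℤ_p, and their union ℤ_p
has mass 1. -/
theorem volume_padic_ball : volume (Metric.ball (0 : ℚ_[p]) 1) = (p : ENNReal)⁻¹ := by
  have h := volume_padic_closedBall p
  rw [padic_closedBall_eq_iUnion, measure_iUnion] at h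
  · simp only [Set.image_add_left, measure_preimage_add, tsum_fintype, Finset.sum_const,
      Finset.card_univ, Fintype.card_fin, nsmul_eq_mul] at h
    exact ENNReal.eq_inv_of_mul_eq_one_left (by rwa [mul_comm])
  · intro i j hij
    refine Set.disjoint_left.2 ?_
    rintro _ ⟨x, hx, rfl⟩ ⟨y, hy, hxy⟩
    rw [Metric.mem_ball, dist_zero_right] at hx hy
    have h1 : ‖(((i : ℕ) - (j : ℕ) : ℤ) : ℚ_[p])‖ < 1 := by
      have e : (((i : ℕ) - (j : ℕ) : ℤ) : ℚ_[p]) = y + -x := by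
        push_cast
        linear_combination -hxy
      rw [e]
      refine (Padic.nonarchimedean _ _).trans_lt (max_lt hy ?_)
      rwa [norm_neg]
    rw [Padic.norm_intCast_lt_one_iff] at h1
    have h2 := Int.eq_zero_of_abs_lt_dvd h1 (by
      rw [abs_lt]
      have := i.2
      have := j.2
      constructor <;> omega)
    exact hij (Fin.ext (by omega))
  · intro i
    rw [Set.image_add_left]
    exact measurable_const_add _ measurableSet_ball

theorem volume_padic_norm_eq_one (n : ℕ) :
    volume {y : Fin (n + 1) → ℚ_[p] | ‖y‖ = 1} =
      ENNReal.ofReal (1 - 1 / (p : ℝ) ^ (n + 1)) := by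
  have h : {y : Fin (n + 1) → ℚ_[p] | ‖y‖ = 1} =
      (Set.univ.pi fun _ => Metric.closedBall 0 1) \ (Set.univ.pi fun _ => Metric.ball 0 1) := by
    ext y
    simp only [Set.mem_sdiff, Set.mem_pi, Set.mem_univ, true_implies, Metric.mem_closedBall,
      Metric.mem_ball, dist_zero_right, Set.mem_ofPred_eq]
    rw [← pi_norm_le_iff_of_nonneg zero_le_one, ← pi_norm_lt_iff one_pos, not_lt]
    exact ⟨fun h => ⟨h.le, h.ge⟩, fun h => le_antisymm h.1 h.2⟩
  have hball : volume (Set.univ.pi fun _ : Fin (n + 1) => Metric.ball (0 : ℚ_[p]) 1) =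
      ENNReal.ofReal (1 / (p : ℝ) ^ (n + 1)) := by
    rw [volume_pi_pi]
    simp only [volume_padic_ball, Finset.prod_const, Finset.card_univ, Fintype.card_fin]
    have hpos : (0 : ℝ) < p := Nat.cast_pos.2 hp.out.pos
    rw [one_div, ENNReal.ofReal_inv_of_pos (by positivity), ENNReal.ofReal_pow hpos.le,
      ENNReal.ofReal_natCast, ENNReal.inv_pow]
  rw [h, measure_sdiff, hball, volume_pi_pi]
  · simp only [volume_padic_closedBall, Finset.prod_const_one]
    rw [ENNReal.ofReal_sub _ (by positivity), ENNReal.ofReal_one]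
  · exact Set.pi_mono fun _ _ => Metric.ball_subset_closedBall
  · exact (MeasurableSet.univ_pi fun _ => measurableSet_ball).nullMeasurableSet
  · rw [hball]
    exact ENNReal.ofReal_ne_top

/-- The subgroup `SL(ℤ_p)` of `SL(ℚ_p)`. -/
def slIntegral (n : ℕ) : Subgroup (SpecialLinearGroup (Fin n) ℚ_[p]) :=
  (SpecialLinearGroup.map (PadicInt.Coe.ringHom (p := p))).range

variable {p}

theorem mem_slIntegral {n : ℕ} {g : SpecialLinearGroup (Fin n) ℚ_[p]} :
    g ∈ slIntegral p n ↔ ∀ i j, ‖toMat g i j‖ ≤ 1 := by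
  constructor
  · rintro ⟨h, rfl⟩ i j
    exact (toMat h i j).2
  · intro h
    let A : Matrix (Fin n) (Fin n) ℤ_[p] := fun i j => ⟨toMat g i j, h i j⟩
    have hA : A.map (PadicInt.Coe.ringHom (p := p)) = toMat g := rfl
    refine ⟨⟨A, ?_⟩, toMat_injective hA⟩
    apply Subtype.val_injective
    have := RingHom.map_det (PadicInt.Coe.ringHom (p := p)) A
    rw [RingHom.mapMatrix_apply, hA, det_toMat] at this
    exact this

theorem isOpen_slIntegral (n : ℕ) :
    IsOpen (slIntegral p n : Set (SpecialLinearGroup (Fin n) ℚ_[p])) := by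
  have : (slIntegral p n : Set (SpecialLinearGroup (Fin n) ℚ_[p])) =
      ⋂ i, ⋂ j, {g | toMat g i j ∈ Metric.closedBall (0 : ℚ_[p]) 1} := by
    ext g
    simp [mem_slIntegral]
  rw [this]
  refine isOpen_iInter_of_finite fun i => isOpen_iInter_of_finite fun j => ?_
  exact (IsUltrametricDist.isOpen_closedBall _ one_ne_zero).preimage
    (continuous_toMat.matrix_elem i j)

/-- The row pairs to 1 with an integral column of the inverse, which the ultrametric inequality
forbids if all its entries have norm less than 1. -/
theorem norm_row_of_mem_slIntegral {n : ℕ} {g : SpecialLinearGroup (Fin (n + 1)) ℚ_[p]}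
    (hg : g ∈ slIntegral p (n + 1)) : ‖(toMat g 0 : Fin (n + 1) → ℚ_[p])‖ = 1 := by
  refine le_antisymm ((pi_norm_le_iff_of_nonneg zero_le_one).2 (mem_slIntegral.1 hg 0)) ?_
  by_contra hlt
  rw [not_le, pi_norm_lt_iff one_pos] at hlt
  have h1 : ∑ j, toMat g 0 j * toMat g⁻¹ j 0 = 1 := by
    have := congrFun (congrFun (congrArg toMat (mul_inv_cancel g)) 0) 0
    rw [toMat_mul, Matrix.mul_apply] at this
    exact this
  have h2 : ‖∑ j, toMat g 0 j * toMat g⁻¹ j 0‖ < 1 := by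
    obtain ⟨j, -, hj⟩ := IsUltrametricDist.exists_norm_finsetSum_le_of_nonempty
      (Finset.univ_nonempty (α := Fin (n + 1))) fun j => toMat g 0 j * toMat g⁻¹ j 0
    refine hj.trans_lt ?_
    rw [norm_mul]
    exact (mul_le_of_le_one_right (norm_nonneg _)
      (mem_slIntegral.1 ((slIntegral p (n + 1)).inv_mem hg) j 0)).trans_lt (hlt j)
  rw [h1, norm_one] at h2
  exact lt_irrefl _ h2

theorem slLower_mem_slIntegral {n : ℕ}
    {x : (Fin (n + 1) → ℚ_[p]) × SpecialLinearGroup (Fin (n + 1)) ℚ_[p]} :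
    slLower x ∈ slIntegral p (n + 2) ↔ ‖x.1‖ ≤ 1 ∧ x.2 ∈ slIntegral p (n + 1) := by
  rw [mem_slIntegral, mem_slIntegral, Fin.forall_fin_succ, pi_norm_le_iff_of_nonneg zero_le_one]
  simp only [Fin.forall_fin_succ (n := n + 1), toMat_slLower, lowerMat_zero, lowerMat_succ_zero,
    lowerMat_succ_succ, forall_and]
  simp

theorem slUpper_mem_slIntegral {n : ℕ} (y : {y : Fin (n + 2) → ℚ_[p] // y 0 ≠ 0})
    (h0 : ‖y.1 0‖ = 1) (hy : ∀ i, ‖y.1 i‖ ≤ 1) : slUpper y ∈ slIntegral p (n + 2) := by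
  rw [mem_slIntegral]
  intro i j
  change ‖upperRow y.1 i j‖ ≤ 1
  simp only [upperRow, of_apply]
  split_ifs <;> simp [h0, hy]

/-- If `y 0` is a unit, `slUpper` is already integral. Otherwise some `y i` is a unit; an integral
transvection adds it to `y 0`, which becomes a unit, and is undone afterwards. -/
theorem exists_slIntegral_row {n : ℕ} {y : Fin (n + 2) → ℚ_[p]} (hy : ‖y‖ = 1) :
    ∃ k ∈ slIntegral p (n + 2), toMat k 0 = y := by
  have hle := (pi_norm_le_iff_of_nonneg zero_le_one).1 hy.le
  by_cases h0 : ‖y 0‖ = 1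
  · have h0' : y 0 ≠ 0 := fun h => by simp [h] at h0
    exact ⟨slUpper ⟨y, h0'⟩, slUpper_mem_slIntegral _ h0 hle, row_slUpper _⟩
  · have hlt := lt_of_le_of_ne (hle 0) h0
    obtain ⟨i, hi⟩ : ∃ i, 1 ≤ ‖y i‖ := by
      by_contra h
      push Not at h
      exact ((pi_norm_lt_iff one_pos).2 h).ne hy
    have hi0 : i ≠ 0 := by rintro rfl; exact absurd hi (not_le.2 hlt)
    have hi1 : ‖y i‖ = 1 := le_antisymm (hle i) hi
    let t := SpecialLinearGroup.transvection hi0 (1 : ℚ_[p])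
    have ht : t ∈ slIntegral p (n + 2) := by
      rw [mem_slIntegral]
      intro a b
      rw [toMat_transvection, Matrix.add_apply, Matrix.one_apply, Matrix.single_apply]
      refine (Padic.nonarchimedean _ _).trans (max_le ?_ ?_) <;> split_ifs <;> simp
    have hyt : y ᵥ* toMat t = y + Pi.single 0 (y i) := by
      rw [toMat_transvection, Matrix.vecMul_add, Matrix.vecMul_one]
      congr 1
      ext j
      simp [Matrix.vecMul, dotProduct, Matrix.single_apply, Pi.single_apply, ite_and]
      grind
    have h1 : ‖(y ᵥ* toMat t) 0‖ = 1 := by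
      rw [hyt, Pi.add_apply, Pi.single_eq_same, Padic.add_eq_max_of_ne (by rw [hi1]; exact hlt.ne),
        hi1, max_eq_right hlt.le]
    have h1' : (y ᵥ* toMat t) 0 ≠ 0 := fun h => by simp [h] at h1
    have hle' : ∀ j, ‖(y ᵥ* toMat t) j‖ ≤ 1 := by
      intro j
      rw [hyt, Pi.add_apply]
      refine (Padic.nonarchimedean _ _).trans (max_le (hle j) ?_)
      rw [Pi.single_apply]
      split_ifs <;> simp [hle]
    refine ⟨slUpper ⟨_, h1'⟩ * t⁻¹, (slIntegral p (n + 2)).mul_mem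
      (slUpper_mem_slIntegral _ h1 hle') ((slIntegral p (n + 2)).inv_mem ht), ?_⟩
    rw [toMat_mul, Matrix.mul_apply_eq_vecMul, row_slUpper, Matrix.vecMul_vecMul, ← toMat_mul,
      mul_inv_cancel, toMat_one, vecMul_one]

/-- Integrate over the first row `y`. If `y` has norm one, `slUpper y` is a stabilizer element times
an integral matrix, and right invariance shows that the fibre has the mass of the integral
stabilizer elements. All other fibres are empty. -/
theorem slMeasure_slIntegral_succ (n : ℕ) :
    slMeasure ℚ_[p] (n + 2) (slIntegral p (n + 2)) =
      slMeasure ℚ_[p] (n + 1) (slIntegral p (n + 1)) *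
        ENNReal.ofReal (1 - 1 / (p : ℝ) ^ (n + 2)) := by
  have hS : ∀ n, MeasurableSet (slIntegral p n : Set (SpecialLinearGroup (Fin n) ℚ_[p])) :=
    fun n => (isOpen_slIntegral n).measurableSet
  set I : SpecialLinearGroup (Fin (n + 2)) ℚ_[p] → ENNReal :=
    (slIntegral p (n + 2) : Set (SpecialLinearGroup (Fin (n + 2)) ℚ_[p])).indicator 1 with hI
  have hIm : Measurable I := measurable_one.indicator (hS _)
  have hIk : ∀ g, ∀ k ∈ slIntegral p (n + 2), I (g * k) = I g := by
    intro g k hk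
    exact indicator_one_congr (Subgroup.mul_mem_cancel_right _ hk)
  have hlow : ∫⁻ x, I (slLower x) ∂(lowerMeasure ℚ_[p] n) =
      slMeasure ℚ_[p] (n + 1) (slIntegral p (n + 1)) := by
    have e : ∀ x, I (slLower x) = ((Set.univ.pi fun _ : Fin (n + 1) =>
        Metric.closedBall (0 : ℚ_[p]) 1) ×ˢ
        (slIntegral p (n + 1) : Set (SpecialLinearGroup (Fin (n + 1)) ℚ_[p]))).indicator 1 x := by
      intro x
      refine indicator_one_congr ?_
      simp only [SetLike.mem_coe, slLower_mem_slIntegral, Set.mem_prod,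
        Set.mem_pi, Set.mem_univ, true_implies, Metric.mem_closedBall, dist_zero_right,
        pi_norm_le_iff_of_nonneg zero_le_one]
    simp only [e]
    rw [lintegral_indicator_one ((MeasurableSet.univ_pi fun _ => measurableSet_closedBall).prod
      (hS _)), Measure.prod_prod, volume_pi_pi]
    simp [volume_padic_closedBall]
  rw [← lintegral_indicator_one (hS _), lintegral_slMeasure hIm, ← volume_padic_norm_eq_one p,
    ← lintegral_indicator_const (measurableSet_eq_fun (continuous_norm.measurable)
      measurable_const)]
  refine lintegral_congr_ae ?_
  filter_upwards [ae_apply_ne_zero 0] with y hy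
  simp only [slUpperExt, dif_pos hy]
  by_cases h : ‖y‖ = 1
  · rw [Set.indicator_of_mem (by exact h), ← hlow]
    obtain ⟨k, hk, hrow⟩ := exists_slIntegral_row h
    have hrow' : toMat (slUpper ⟨y, hy⟩) 0 = toMat k 0 := by rw [row_slUpper, hrow]
    have hfac : slUpper ⟨y, hy⟩ = slLower (lowerPart ⟨_, row_mul_inv_of_row_eq hrow'⟩) * k := by
      rw [slLower_lowerPart, inv_mul_cancel_right]
    rw [hfac]
    simp only [← mul_assoc, hIk _ k hk]
    exact lintegral_lowerMeasure_mul_right hIm _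
  · rw [Set.indicator_of_notMem (by exact h)]
    refine (lintegral_congr fun x => ?_).trans lintegral_zero
    refine Set.indicator_of_notMem (fun hmem => h ?_) _
    rw [← norm_row_of_mem_slIntegral hmem, row_slLower_mul, row_slUpper]

theorem slMeasure_slIntegral (n : ℕ) :
    slMeasure ℚ_[p] (n + 1) (slIntegral p (n + 1)) =
      ∏ k ∈ Finset.Icc 2 (n + 1), ENNReal.ofReal (1 - 1 / (p : ℝ) ^ k) := by
  induction n with
  | zero => simp [slMeasure, (slIntegral p 1).one_mem]
  | succ n ih =>
    rw [slMeasure_slIntegral_succ, ih, Finset.prod_Icc_succ_top (a := 2) (b := n + 1) (by omega)]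

end PadicVolume

/-! ### The group `UL(ℚ_p)` as a product of `SL(ℚ_p)` and `ℤ_pˣ` -/

section ULCoordinates

variable {p : ℕ} [hp : Fact p.Prime]

variable (p) in
/-- The elements of norm one of `ℚ_p`. -/
abbrev PadicUnit := {u : ℚ_[p] // ‖u‖ = 1}

theorem PadicUnit.ne_zero (u : PadicUnit p) : u.1 ≠ 0 := fun h => by
  have := u.2
  rw [h, norm_zero] at this
  exact zero_ne_one this

/-- The product of elements of norm one. -/
def PadicUnit.mul (u v : PadicUnit p) : PadicUnit p :=
  ⟨u.1 * v.1, by rw [norm_mul, u.2, v.2, one_mul]⟩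

/-- The inverse of an element of norm one. -/
def PadicUnit.inv (u : PadicUnit p) : PadicUnit p := ⟨u.1⁻¹, by rw [norm_inv, u.2, inv_one]⟩

theorem measurableSet_norm_eq_one : MeasurableSet {u : ℚ_[p] | ‖u‖ = 1} :=
  measurableSet_eq_fun continuous_norm.measurable measurable_const

variable (p) in
/-- The Haar measure of `ℚ_p` on the elements of norm one. -/
def unitMeasure : Measure (PadicUnit p) := Measure.comap Subtype.val volume

instance sigmaFinite_unitMeasure : SigmaFinite (unitMeasure p) :=
  sigmaFinite_comap_subtype _ measurableSet_norm_eq_one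

theorem unitMeasure_univ : unitMeasure p Set.univ = ENNReal.ofReal (1 - 1 / (p : ℝ)) := by
  rw [unitMeasure, comap_subtype_apply _ measurableSet_norm_eq_one, Set.image_univ,
    Subtype.range_coe_subtype]
  have h := volume_padic_norm_eq_one p 0
  rw [zero_add, pow_one] at h
  rw [← h, ← (volume_preserving_funUnique (Fin 1) ℚ_[p]).measure_preimage
    measurableSet_norm_eq_one.nullMeasurableSet]
  congr 1
  ext y
  simp only [Set.mem_preimage, Set.mem_ofPred_eq]
  rw [← pi_norm_const (ι := Fin 1)]
  have : (fun _ : Fin 1 => (MeasurableEquiv.funUnique (Fin 1) ℚ_[p]) y) = y := by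
    ext i
    rw [Subsingleton.elim i default]
    rfl
  rw [this]

/-- Multiplication by a unit is an additive automorphism preserving ℤ_p, so the normalization
determines the image measure. -/
theorem measurePreserving_padic_mul {c : ℚ_[p]} (hc : ‖c‖ = 1) :
    MeasurePreserving (fun x : ℚ_[p] => c * x) volume volume := by
  have hc0 : c ≠ 0 := PadicUnit.ne_zero ⟨c, hc⟩
  have hcont : Continuous fun x : ℚ_[p] => c * x := continuous_const_mul c
  refine ⟨hcont.measurable, ?_⟩
  let e : ℚ_[p] ≃+ ℚ_[p] :=
    { toFun := fun x => c * x
      invFun := fun x => c⁻¹ * x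
      left_inv := fun x => inv_mul_cancel_left₀ hc0 x
      right_inv := fun x => mul_inv_cancel_left₀ hc0 x
      map_add' := fun x y => mul_add c x y }
  have h1 : (Measure.map e (volume : Measure ℚ_[p])).IsAddHaarMeasure :=
    e.isAddHaarMeasure_map volume hcont (continuous_const_mul c⁻¹)
  have h2 := Measure.addHaarMeasure_unique (Measure.map e (volume : Measure ℚ_[p]))
    (padicUnitBall p)
  have h3 : Measure.map e (volume : Measure ℚ_[p]) (padicUnitBall p) = 1 := by
    rw [Measure.map_apply (f := e) hcont.measurable]
    · have : e ⁻¹' (padicUnitBall p : Set ℚ_[p]) = Metric.closedBall 0 1 := by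
        ext x
        change c * x ∈ Metric.closedBall 0 1 ↔ _
        simp [hc]
      rw [this, volume_padic_closedBall]
    · exact measurableSet_closedBall
  rw [h3, one_smul] at h2
  exact h2

theorem measurePreserving_padic_pi_mul {n : ℕ} {c : Fin n → ℚ_[p]} (hc : ∀ i, ‖c i‖ = 1) :
    MeasurePreserving (fun (x : Fin n → ℚ_[p]) i => c i * x i) volume volume :=
  volume_preserving_pi fun i => measurePreserving_padic_mul (hc i)

theorem measurePreserving_unit_mul (u : PadicUnit p) :
    MeasurePreserving u.mul (unitMeasure p) (unitMeasure p) := by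
  have hm : Measurable u.mul := by
    refine Measurable.subtype_mk ?_
    exact measurable_subtype_coe.const_mul _
  refine ⟨hm, Measure.ext fun s hs => ?_⟩
  rw [Measure.map_apply hm hs, unitMeasure, comap_subtype_apply _ measurableSet_norm_eq_one,
    comap_subtype_apply _ measurableSet_norm_eq_one]
  refine Eq.trans ?_ ((measurePreserving_padic_mul u.2).measure_preimage
    ((MeasurableEmbedding.subtype_coe measurableSet_norm_eq_one).measurableSet_image.2
      hs).nullMeasurableSet)
  congr 1
  ext x
  constructor
  · rintro ⟨y, hy, rfl⟩
    exact ⟨u.mul y, hy, rfl⟩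
  · rintro ⟨z, hz, hzx⟩
    have hx : ‖x‖ = 1 := by
      have := congrArg norm hzx
      simp only [norm_mul, u.2, one_mul] at this
      rw [← this, z.2]
    refine ⟨⟨x, hx⟩, ?_, rfl⟩
    have : u.mul ⟨x, hx⟩ = z := Subtype.ext hzx.symm
    rwa [Set.mem_preimage, this]

/-- The diagonal of the matrix `diag(1, …, 1, u)`. -/
def lastVec (n : ℕ) (u : ℚ_[p]) : Fin (n + 1) → ℚ_[p] := fun i => if i = Fin.last n then u else 1

/-- The matrix `diag(1, …, 1, u)`. -/
def lastDiag (n : ℕ) (u : ℚ_[p]) : Matrix (Fin (n + 1)) (Fin (n + 1)) ℚ_[p] :=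
  diagonal (lastVec n u)

theorem lastDiag_mul (n : ℕ) (u v : ℚ_[p]) :
    lastDiag n u * lastDiag n v = lastDiag n (u * v) := by
  rw [lastDiag, lastDiag, diagonal_mul_diagonal, lastDiag]
  congr 1
  ext i
  simp only [lastVec]
  split_ifs <;> simp

theorem lastDiag_one (n : ℕ) : lastDiag n (1 : ℚ_[p]) = 1 := by
  rw [lastDiag, ← diagonal_one]
  congr 1
  ext i
  simp [lastVec]

theorem det_lastDiag (n : ℕ) (u : ℚ_[p]) : (lastDiag n u).det = u := by
  rw [lastDiag, det_diagonal]
  simp [lastVec]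

theorem lastDiag_mul_inv (n : ℕ) (u : PadicUnit p) : lastDiag n u.1 * lastDiag n u.1⁻¹ = 1 := by
  rw [lastDiag_mul, mul_inv_cancel₀ u.ne_zero, lastDiag_one]

theorem lastDiag_inv_mul (n : ℕ) (u : PadicUnit p) : lastDiag n u.1⁻¹ * lastDiag n u.1 = 1 := by
  rw [lastDiag_mul, inv_mul_cancel₀ u.ne_zero, lastDiag_one]

theorem continuous_lastDiag (n : ℕ) : Continuous (lastDiag (p := p) n) := by
  refine Continuous.matrix_diagonal (continuous_pi fun i => ?_)
  simp only [lastVec]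
  split_ifs <;> fun_prop

/-- The underlying matrix of an element of `UL`. -/
def ulMat {d : ℕ} (g : UL d ℚ_[p]) : Matrix (Fin d) (Fin d) ℚ_[p] := g.1.1

theorem ulMat_injective {d : ℕ} : Function.Injective (ulMat (p := p) (d := d)) :=
  fun _ _ h => Subtype.ext (Units.ext h)

theorem ulMat_mul {d : ℕ} (g h : UL d ℚ_[p]) : ulMat (g * h) = ulMat g * ulMat h := rfl

theorem norm_det_ulMat {d : ℕ} (g : UL d ℚ_[p]) : ‖(ulMat g).det‖ = 1 := g.2

theorem continuous_ulMat {d : ℕ} : Continuous (ulMat (p := p) (d := d)) :=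
  Units.continuous_val.comp continuous_subtype_val

/-- `diag(1, …, 1, u)` as an element of `GL`. -/
def lastGL (n : ℕ) (u : PadicUnit p) : GL (Fin (n + 1)) ℚ_[p] :=
  ⟨lastDiag n u.1, lastDiag n u.1⁻¹, lastDiag_mul_inv n u, lastDiag_inv_mul n u⟩

theorem continuous_lastGL (n : ℕ) : Continuous (lastGL (p := p) n) := by
  refine Units.continuous_iff.2 ⟨(continuous_lastDiag n).comp continuous_subtype_val, ?_⟩
  exact (continuous_lastDiag n).comp (continuous_subtype_val.inv₀ fun u => PadicUnit.ne_zero u)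

/-- The product of an element of `SL` with `diag(1, …, 1, u)`. -/
def ulTheta (n : ℕ) (x : SpecialLinearGroup (Fin (n + 1)) ℚ_[p] × PadicUnit p) :
    UL (n + 1) ℚ_[p] :=
  ⟨SpecialLinearGroup.toGL x.1 * lastGL n x.2, by
    change ‖(toMat x.1 * lastDiag n x.2.1).det‖ = 1
    rw [det_mul, det_toMat, det_lastDiag, one_mul, x.2.2]⟩

theorem ulMat_ulTheta {n : ℕ} (x : SpecialLinearGroup (Fin (n + 1)) ℚ_[p] × PadicUnit p) :
    ulMat (ulTheta n x) = toMat x.1 * lastDiag n x.2.1 := rfl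

theorem continuous_ulTheta (n : ℕ) : Continuous (ulTheta (p := p) n) :=
  Continuous.subtype_mk ((SpecialLinearGroup.continuous_toGL.comp continuous_fst).mul
    ((continuous_lastGL n).comp continuous_snd)) _

/-- The determinant of an element of `UL`. -/
def ulDet {d : ℕ} (g : UL d ℚ_[p]) : PadicUnit p := ⟨(ulMat g).det, norm_det_ulMat g⟩

/-- The first component of the inverse of `ulTheta`. -/
def ulToSL {n : ℕ} (g : UL (n + 1) ℚ_[p]) : SpecialLinearGroup (Fin (n + 1)) ℚ_[p] :=
  ⟨ulMat g * lastDiag n (ulDet g).1⁻¹, by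
    rw [det_mul, det_lastDiag]
    exact mul_inv_cancel₀ (ulDet g).ne_zero⟩

theorem toMat_ulToSL {n : ℕ} (g : UL (n + 1) ℚ_[p]) :
    toMat (ulToSL g) = ulMat g * lastDiag n (ulDet g).1⁻¹ := rfl

theorem continuous_ulDet {d : ℕ} : Continuous (ulDet (p := p) (d := d)) :=
  Continuous.subtype_mk continuous_ulMat.matrix_det _

theorem continuous_ulToSL {n : ℕ} : Continuous (ulToSL (p := p) (n := n)) := by
  refine Continuous.subtype_mk (continuous_ulMat.mul ((continuous_lastDiag n).comp ?_)) _
  exact (continuous_subtype_val.comp continuous_ulDet).inv₀ fun g => (ulDet g).ne_zero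

/-- `ulTheta` as a homeomorphism. -/
def ulThetaHomeo (n : ℕ) :
    SpecialLinearGroup (Fin (n + 1)) ℚ_[p] × PadicUnit p ≃ₜ UL (n + 1) ℚ_[p] where
  toFun := ulTheta n
  invFun g := (ulToSL g, ulDet g)
  left_inv x := by
    have h : ulDet (ulTheta n x) = x.2 := by
      refine Subtype.ext ?_
      change (ulMat (ulTheta n x)).det = _
      rw [ulMat_ulTheta, det_mul, det_toMat, det_lastDiag, one_mul]
    refine Prod.ext (toMat_injective ?_) h
    rw [toMat_ulToSL, h, ulMat_ulTheta, Matrix.mul_assoc, lastDiag_mul_inv, Matrix.mul_one]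
  right_inv g := by
    refine ulMat_injective ?_
    rw [ulMat_ulTheta, toMat_ulToSL, Matrix.mul_assoc, lastDiag_inv_mul, Matrix.mul_one]
  continuous_toFun := continuous_ulTheta n
  continuous_invFun := continuous_ulToSL.prodMk continuous_ulDet

theorem ulToSL_ulTheta {n : ℕ} (x : SpecialLinearGroup (Fin (n + 1)) ℚ_[p] × PadicUnit p) :
    ulToSL (ulTheta n x) = x.1 := congrArg Prod.fst ((ulThetaHomeo n).left_inv x)

theorem ulTheta_surjective (n : ℕ) : Function.Surjective (ulTheta (p := p) n) :=
  (ulThetaHomeo n).surjective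

/-! ### The measure on `UL(ℚ_p)` -/

theorem lastDiag_succ (n : ℕ) (u : ℚ_[p]) : lastDiag (n + 1) u = lowerMat 0 (lastDiag n u) := by
  ext i j
  refine Fin.cases ?_ (fun i => ?_) i
  · rw [lowerMat_zero, lastDiag, diagonal_apply]
    simp only [lastVec, Pi.single_apply]
    have : (0 : Fin (n + 2)) ≠ Fin.last (n + 1) := (Fin.last_pos).ne
    simp [this, eq_comm]
  · refine Fin.cases ?_ (fun j => ?_) j
    · simp [lastDiag]
    · rw [lowerMat_succ_succ]
      simp only [lastDiag, diagonal_apply, lastVec, Fin.succ_inj, ← Fin.succ_last]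

/-- Moving diag(1, …, 1, u) past the upper factor only rescales the last coordinate of `y` by a
unit. The entry `y 0` is not affected, since 0 is not the last index. -/
theorem lastDiag_mul_upperRow {n : ℕ} (u : PadicUnit p) (y : Fin (n + 2) → ℚ_[p]) :
    lastDiag (n + 1) u.1 * upperRow y =
      upperRow (fun i => lastVec (n + 1) u.1⁻¹ i * y i) * lastDiag (n + 1) u.1 := by
  have h0 : (0 : Fin (n + 2)) ≠ Fin.last (n + 1) := (Fin.last_pos).ne
  have hu := u.ne_zero
  ext i j
  rw [lastDiag, diagonal_mul, mul_diagonal]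
  by_cases hi : i = 0
  · subst hi
    simp only [upperRow, of_apply, if_true, lastVec, if_neg h0, one_mul]
    split_ifs <;> field_simp
  · simp only [upperRow, of_apply, if_neg hi, lastVec, if_neg h0, one_mul]
    by_cases hij : i = j
    · subst hij
      ring
    · simp [hij]

theorem ulPhi_ulTheta {n : ℕ} (v : Fin (n + 1) → ℚ_[p])
    (x : SpecialLinearGroup (Fin (n + 1)) ℚ_[p] × PadicUnit p)
    (y : {y : Fin (n + 2) → ℚ_[p] // y 0 ≠ 0}) :
    ulPhi ((v, ulTheta n x), y) = ulTheta (n + 1) (slLower (v, x.1) *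
      slUpperExt (fun i => lastVec (n + 1) x.2.1⁻¹ i * y.1 i), x.2) := by
  have h0 : (0 : Fin (n + 2)) ≠ Fin.last (n + 1) := (Fin.last_pos).ne
  have hy : (fun i => lastVec (n + 1) x.2.1⁻¹ i * y.1 i) 0 ≠ 0 := by
    simp only [lastVec, if_neg h0, one_mul]
    exact y.2
  refine ulMat_injective ?_
  rw [ulMat_ulTheta, slUpperExt, dif_pos hy, toMat_mul, toMat_slLower, Matrix.mul_assoc]
  change lowerMat v (toMat x.1 * lastDiag n x.2.1) * upperRow y.1 =
    lowerMat v (toMat x.1) * (upperRow _ * lastDiag (n + 1) x.2.1)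
  rw [← lastDiag_mul_upperRow, ← Matrix.mul_assoc, lastDiag_succ, lowerMat_mul,
    Matrix.mulVec_zero, add_zero]

theorem lintegral_comap_ne_zero {K : Type} [NormedField K] [MeasureSpace K] [BorelSpace K]
    [SigmaFinite (volume : Measure K)] [NullSingletonClass (volume : Measure K)] {n : ℕ}
    (f : (Fin (n + 1) → K) → ENNReal) :
    ∫⁻ y : {y : Fin (n + 1) → K // y 0 ≠ 0}, f y.1 ∂(Measure.comap Subtype.val volume) =
      ∫⁻ y, f y := by
  rw [lintegral_comap_subtype _ (measurableSet_apply_ne_zero 0),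
    Measure.restrict_eq_self_of_ae_mem]
  have := Measure.pi_hyperplane (fun _ : Fin (n + 1) => (volume : Measure K)) 0 0
  rw [ae_iff, volume_pi]
  simpa only [Set.mem_ofPred_eq, not_not] using this

theorem measurableEmbedding_pi_mul {n : ℕ} {c : Fin n → ℚ_[p]} (hc : ∀ i, ‖c i‖ = 1) :
    MeasurableEmbedding (fun (x : Fin n → ℚ_[p]) i => c i * x i) :=
  (Homeomorph.piCongrRight fun i =>
    Homeomorph.mulLeft₀ (c i) (PadicUnit.ne_zero ⟨c i, hc i⟩)).measurableEmbedding

theorem norm_lastVec (n : ℕ) (u : PadicUnit p) (i : Fin (n + 1)) : ‖lastVec n u.1⁻¹ i‖ = 1 := by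
  simp only [lastVec]
  split_ifs
  · rw [norm_inv, u.2, inv_one]
  · exact norm_one

instance secondCountableGLPadic (d : ℕ) : SecondCountableTopology (UL (d + 1) ℚ_[p]) :=
  (ulThetaHomeo d).symm.secondCountableTopology

theorem continuous_of_continuous_ulMat {X : Type*} [TopologicalSpace X] {n : ℕ}
    {f : X → UL (n + 1) ℚ_[p]} (hf : Continuous fun x => ulMat (f x)) : Continuous f := by
  refine (ulThetaHomeo n).symm.comp_continuous_iff.1 ?_
  have hdet : Continuous fun x => ulDet (f x) := Continuous.subtype_mk hf.matrix_det _
  refine Continuous.prodMk (Continuous.subtype_mk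
    (hf.mul ((continuous_lastDiag n).comp ?_)) _) hdet
  exact (continuous_subtype_val.comp hdet).inv₀ fun x => (ulDet (f x)).ne_zero

theorem continuous_ulPhi {n : ℕ} : Continuous (ulPhi (K := ℚ_[p]) (n := n)) := by
  refine continuous_of_continuous_ulMat ?_
  change Continuous fun x : ((Fin (n + 1) → ℚ_[p]) × UL (n + 1) ℚ_[p]) ×
    {y : Fin (n + 2) → ℚ_[p] // y 0 ≠ 0} => lowerBlock x.1.1 (ulMat x.1.2) * upperRow x.2.1
  refine Continuous.mul ?_ ?_
  · refine continuous_matrix fun i j => ?_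
    refine Fin.cases ?_ (fun i => ?_) i
    · exact continuous_const
    · refine Fin.cases ?_ (fun j => ?_) j
      · exact (continuous_apply i).comp (continuous_fst.comp continuous_fst)
      · exact (continuous_ulMat.comp (continuous_snd.comp continuous_fst)).matrix_elem i j
  · have hy : ∀ j, Continuous fun x : ((Fin (n + 1) → ℚ_[p]) × UL (n + 1) ℚ_[p]) ×
        {y : Fin (n + 2) → ℚ_[p] // y 0 ≠ 0} => x.2.1 j := fun j =>
      (continuous_apply j).comp (continuous_subtype_val.comp continuous_snd)
    refine continuous_matrix fun i j => ?_
    simp only [upperRow, of_apply]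
    split_ifs
    · exact hy j
    · exact continuous_const.div (hy 0) fun x => x.2.2
    · exact continuous_const
    · exact continuous_const

/-- Tonelli's theorem, arranged so that the variable `z` is outermost. In the application `z` is the
unit, and the inner integrals are those of `SL` for a fixed unit. -/
theorem lintegral_prod_map_prod {A B C D E : Type*} [MeasurableSpace A] [MeasurableSpace B]
    [MeasurableSpace C] [MeasurableSpace D] [MeasurableSpace E] {a : Measure A} {b : Measure B}
    {c : Measure C} {d : Measure D} [SFinite a] [SFinite b] [SFinite c] [SFinite d]
    {θ : B × C → E} (hθ : Measurable θ) {f : (A × E) × D → ENNReal} (hf : Measurable f) :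
    ∫⁻ z, f z ∂((a.prod (Measure.map θ (b.prod c))).prod d) =
      ∫⁻ z, ∫⁻ y, ∫⁻ x, f ((x.1, θ (x.2, z)), y) ∂(a.prod b) ∂d ∂c := by
  have hG : Measurable fun w : A × E => ∫⁻ y, f (w, y) ∂d := hf.lintegral_prod_right'
  rw [lintegral_prod _ hf.aemeasurable, lintegral_prod _ hG.aemeasurable]
  have h1 : ∀ x : A, ∫⁻ e, ∫⁻ y, f ((x, e), y) ∂d ∂(Measure.map θ (b.prod c)) =
      ∫⁻ z, ∫⁻ w, ∫⁻ y, f ((x, θ (w, z)), y) ∂d ∂b ∂c := fun x => by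
    have hGx : Measurable fun e : E => ∫⁻ y, f ((x, e), y) ∂d := hG.comp measurable_prodMk_left
    rw [lintegral_map (f := fun e : E => ∫⁻ y, f ((x, e), y) ∂d) hGx hθ]
    exact lintegral_prod_symm _ (hGx.comp hθ).aemeasurable
  have hm1 : Measurable fun q : (A × C) × B => ∫⁻ y, f ((q.1.1, θ (q.2, q.1.2)), y) ∂d :=
    hG.comp (by fun_prop)
  rw [lintegral_congr h1, lintegral_lintegral_swap hm1.lintegral_prod_right'.aemeasurable]
  refine lintegral_congr fun z => ?_
  have hm2 : Measurable fun q : A × B => ∫⁻ y, f ((q.1, θ (q.2, z)), y) ∂d :=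
    hG.comp (by fun_prop)
  rw [← lintegral_prod _ hm2.aemeasurable]
  refine lintegral_lintegral_swap ?_
  exact (hf.comp (g := f) (f := fun q : (A × B) × D => ((q.1.1, θ (q.1.2, z)), q.2))
    (by fun_prop)).aemeasurable

/-- For a fixed unit, `ulPhi` read in the coordinates `ulTheta` is the `Φ` of `SL` applied to a row
whose coordinates are rescaled by factors of norm one, and this rescaling preserves volume. -/
theorem ulMeasure_eq_map (n : ℕ) : ulMeasure ℚ_[p] (n + 1) =
    Measure.map (ulTheta n) ((slMeasure ℚ_[p] (n + 1)).prod (unitMeasure p)) := by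
  induction n with
  | zero =>
    have h1 : ulMeasure ℚ_[p] (0 + 1) = Measure.map ulOne (unitMeasure p) := rfl
    have h2 : slMeasure ℚ_[p] (0 + 1) = Measure.dirac 1 := rfl
    rw [h1, h2, Measure.dirac_prod, Measure.map_map (continuous_ulTheta 0).measurable
      measurable_prodMk_left]
    congr 1
    ext u : 1
    refine ulMat_injective ?_
    rw [Function.comp_apply, ulMat_ulTheta, toMat_one, Matrix.one_mul]
    ext i j
    rw [Subsingleton.elim i 0, Subsingleton.elim j 0]
    change u.1 = _
    simp [lastDiag, lastVec]
  | succ n ih =>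
    have := sigmaFinite_comap_subtype (volume : Measure (Fin (n + 2) → ℚ_[p]))
      (measurableSet_apply_ne_zero 0)
    refine Measure.ext_of_lintegral _ fun f hf => ?_
    have h1 : ulMeasure ℚ_[p] (n + 1 + 1) = Measure.map ulPhi
      (((volume : Measure (Fin (n + 1) → ℚ_[p])).prod (ulMeasure ℚ_[p] (n + 1))).prod
        (Measure.comap Subtype.val (volume : Measure (Fin (n + 2) → ℚ_[p])))) := rfl
    rw [h1, ih, lintegral_map hf continuous_ulPhi.measurable,
      lintegral_map hf (continuous_ulTheta _).measurable,
      lintegral_prod_symm (fun x => f (ulTheta (n + 1) x))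
        (hf.comp (continuous_ulTheta _).measurable).aemeasurable]
    refine (lintegral_prod_map_prod (continuous_ulTheta n).measurable
      (hf.comp continuous_ulPhi.measurable)).trans ?_
    refine lintegral_congr fun u => ?_
    rw [lintegral_slMeasure (f := fun g => f (ulTheta (n + 1) (g, u)))
      (hf.comp ((continuous_ulTheta _).measurable.comp measurable_prodMk_right))]
    simp only [Function.comp_apply, ulPhi_ulTheta]
    rw [lintegral_comap_ne_zero (f := fun y : Fin (n + 2) → ℚ_[p] => ∫⁻ x, f (ulTheta (n + 1)
        (slLower (x.1, x.2) * slUpperExt (fun i => lastVec (n + 1) u.1⁻¹ i * y i), u))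
        ∂lowerMeasure ℚ_[p] n),
      (measurePreserving_padic_pi_mul (norm_lastVec (n + 1) u)).lintegral_comp_emb
        (measurableEmbedding_pi_mul (norm_lastVec (n + 1) u))
        (fun y : Fin (n + 2) → ℚ_[p] => ∫⁻ x, f (ulTheta (n + 1)
          (slLower (x.1, x.2) * slUpperExt y, u)) ∂lowerMeasure ℚ_[p] n)]

/-! ### The Haar property on `UL(ℚ_p)` -/

theorem lastDiag_conj_apply (n : ℕ) (u : PadicUnit p)
    (M : Matrix (Fin (n + 1)) (Fin (n + 1)) ℚ_[p])
    (i j : Fin (n + 1)) :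
    (lastDiag n u.1 * M * lastDiag n u.1⁻¹) i j = lastVec n u.1 i * M i j * lastVec n u.1⁻¹ j := by
  rw [lastDiag, lastDiag, mul_diagonal, diagonal_mul]

/-- Conjugation by `diag(1, …, 1, u)` as an endomorphism of `SL`. -/
def slConjHom (n : ℕ) (u : PadicUnit p) :
    SpecialLinearGroup (Fin (n + 1)) ℚ_[p] →* SpecialLinearGroup (Fin (n + 1)) ℚ_[p] where
  toFun s := ⟨lastDiag n u.1 * toMat s * lastDiag n u.1⁻¹, by
    rw [det_mul, det_mul, det_toMat, det_lastDiag, det_lastDiag, mul_one,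
      mul_inv_cancel₀ u.ne_zero]⟩
  map_one' := toMat_injective (by
    rw [toMat_mk, toMat_one, Matrix.mul_one, lastDiag_mul_inv])
  map_mul' s t := toMat_injective (by
    refine Eq.trans ?_ (toMat_mul _ _).symm
    change lastDiag n u.1 * toMat (s * t) * lastDiag n u.1⁻¹ =
      lastDiag n u.1 * toMat s * lastDiag n u.1⁻¹ * (lastDiag n u.1 * toMat t * lastDiag n u.1⁻¹)
    rw [toMat_mul]
    simp only [Matrix.mul_assoc]
    rw [← Matrix.mul_assoc (lastDiag n u.1⁻¹) (lastDiag n u.1), lastDiag_inv_mul, Matrix.one_mul])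

theorem toMat_slConjHom (n : ℕ) (u : PadicUnit p) (s : SpecialLinearGroup (Fin (n + 1)) ℚ_[p]) :
    toMat (slConjHom n u s) = lastDiag n u.1 * toMat s * lastDiag n u.1⁻¹ := rfl

theorem slConjHom_inv_slConjHom (n : ℕ) (u : PadicUnit p)
    (s : SpecialLinearGroup (Fin (n + 1)) ℚ_[p]) : slConjHom n u.inv (slConjHom n u s) = s := by
  refine toMat_injective ?_
  rw [toMat_slConjHom, toMat_slConjHom]
  change lastDiag n u.1⁻¹ * (lastDiag n u.1 * toMat s * lastDiag n u.1⁻¹) * lastDiag n u.1⁻¹⁻¹ = _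
  rw [inv_inv, Matrix.mul_assoc, Matrix.mul_assoc, lastDiag_inv_mul, Matrix.mul_one,
    ← Matrix.mul_assoc, lastDiag_inv_mul, Matrix.one_mul]

theorem PadicUnit.inv_inv (u : PadicUnit p) : u.inv.inv = u := Subtype.ext (_root_.inv_inv u.1)

/-- Conjugation by `diag(1, …, 1, u)` as an automorphism of `SL`. -/
def slConj (n : ℕ) (u : PadicUnit p) :
    SpecialLinearGroup (Fin (n + 1)) ℚ_[p] ≃* SpecialLinearGroup (Fin (n + 1)) ℚ_[p] where
  toFun := slConjHom n u
  invFun := slConjHom n u.inv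
  left_inv := slConjHom_inv_slConjHom n u
  right_inv s := by
    have := slConjHom_inv_slConjHom n u.inv s
    rwa [u.inv_inv] at this
  map_mul' := map_mul _

theorem continuous_slConjHom (n : ℕ) (u : PadicUnit p) : Continuous (slConjHom n u) :=
  Continuous.subtype_mk ((continuous_const.mul continuous_toMat).mul continuous_const) _

theorem slMeasure_slIntegral_ne_zero (n : ℕ) :
    slMeasure ℚ_[p] (n + 1) (slIntegral p (n + 1)) ≠ 0 :=
  (isOpen_slIntegral _).measure_ne_zero _ ⟨1, one_mem _⟩

theorem slMeasure_slIntegral_ne_top (n : ℕ) :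
    slMeasure ℚ_[p] (n + 1) (slIntegral p (n + 1)) ≠ ⊤ := by
  rw [slMeasure_slIntegral]
  exact ENNReal.prod_ne_top fun _ _ => ENNReal.ofReal_ne_top

theorem slConjHom_mem_slIntegral {n : ℕ} {u : PadicUnit p}
    {s : SpecialLinearGroup (Fin (n + 1)) ℚ_[p]} :
    slConjHom n u s ∈ slIntegral p (n + 1) ↔ s ∈ slIntegral p (n + 1) := by
  rw [mem_slIntegral, mem_slIntegral]
  refine forall_congr' fun i => forall_congr' fun j => ?_
  have hi := norm_lastVec n u.inv i
  rw [show u.inv.1⁻¹ = u.1 from _root_.inv_inv u.1] at hi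
  rw [toMat_slConjHom, lastDiag_conj_apply, norm_mul, norm_mul, norm_lastVec, hi, mul_one, one_mul]

/-- An automorphism scales Haar measure by a constant. This one preserves SL(ℤ_p), whose measure is
finite and positive, so the constant is 1. -/
theorem measurePreserving_slConjHom (n : ℕ) (u : PadicUnit p) :
    MeasurePreserving (slConjHom n u) (slMeasure ℚ_[p] (n + 1)) (slMeasure ℚ_[p] (n + 1)) := by
  refine ⟨(continuous_slConjHom n u).measurable, ?_⟩
  have h1 : (Measure.map (slConj n u) (slMeasure ℚ_[p] (n + 1))).IsHaarMeasure :=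
    (slConj n u).isHaarMeasure_map _ (continuous_slConjHom n u) (continuous_slConjHom n u.inv)
  have h2 := Measure.isMulLeftInvariant_eq_smul (Measure.map (slConj n u) (slMeasure ℚ_[p] (n + 1)))
    (slMeasure ℚ_[p] (n + 1))
  have h3 := congrArg (fun m => m (slIntegral p (n + 1) : Set _)) h2
  have hpre : slConjHom n u ⁻¹' (slIntegral p (n + 1)) = slIntegral p (n + 1) :=
    Set.ext fun _ => slConjHom_mem_slIntegral
  have h4 : Measure.map (slConj n u) (slMeasure ℚ_[p] (n + 1)) (slIntegral p (n + 1)) =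
      slMeasure ℚ_[p] (n + 1) (slIntegral p (n + 1)) := by
    change Measure.map (slConjHom n u) _ _ = _
    rw [Measure.map_apply (continuous_slConjHom n u).measurable
      (isOpen_slIntegral _).measurableSet, hpre]
  simp only [h4, Measure.smul_apply] at h3
  have h5 : Measure.haarScalarFactor (Measure.map (slConj n u) (slMeasure ℚ_[p] (n + 1)))
      (slMeasure ℚ_[p] (n + 1)) = 1 := by
    rw [ENNReal.smul_def, smul_eq_mul] at h3
    have h6 := (ENNReal.eq_div_iff (slMeasure_slIntegral_ne_zero n)
      (slMeasure_slIntegral_ne_top n)).2 ((mul_comm _ _).trans h3.symm)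
    rw [ENNReal.div_self (slMeasure_slIntegral_ne_zero n) (slMeasure_slIntegral_ne_top n)] at h6
    exact_mod_cast h6
  rw [h5, one_smul] at h2
  exact h2

theorem ulTheta_mul (n : ℕ) (x y : SpecialLinearGroup (Fin (n + 1)) ℚ_[p] × PadicUnit p) :
    ulTheta n x * ulTheta n y = ulTheta n (x.1 * slConjHom n x.2 y.1, x.2.mul y.2) := by
  refine ulMat_injective ?_
  rw [ulMat_mul, ulMat_ulTheta, ulMat_ulTheta, ulMat_ulTheta, toMat_mul, toMat_slConjHom]
  change _ = _ * lastDiag n (x.2.1 * y.2.1)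
  rw [← lastDiag_mul]
  simp only [Matrix.mul_assoc]
  rw [← Matrix.mul_assoc (lastDiag n x.2.1⁻¹) (lastDiag n x.2.1), lastDiag_inv_mul, Matrix.one_mul]

instance compactSpace_padicUnit : CompactSpace (PadicUnit p) := by
  refine isCompact_iff_compactSpace.1 ?_
  refine Metric.isCompact_of_isClosed_isBounded (isClosed_eq continuous_norm continuous_const) ?_
  exact Metric.isBounded_closedBall.subset (fun u (hu : ‖u‖ = 1) => mem_closedBall_zero_iff.2 hu.le)

/-- `UL` is a semidirect product: in the coordinates `ulTheta` a left translation is a conjugation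
followed by a left translation on `SL`, together with a multiplication on the units. Each of these
preserves its measure. -/
theorem isMulLeftInvariant_ulMeasure (n : ℕ) :
    (ulMeasure ℚ_[p] (n + 1)).IsMulLeftInvariant := by
  refine ⟨fun g => ?_⟩
  obtain ⟨x, rfl⟩ := ulTheta_surjective n g
  have hmul : Measurable fun g => ulTheta n x * g := (continuous_const_mul _).measurable
  have hmp := ((measurePreserving_mul_left (slMeasure ℚ_[p] (n + 1)) x.1).comp
    (measurePreserving_slConjHom n x.2)).prod (measurePreserving_unit_mul x.2)
  rw [ulMeasure_eq_map, Measure.map_map hmul (continuous_ulTheta n).measurable]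
  conv_rhs => rw [← hmp.map_eq, Measure.map_map (continuous_ulTheta n).measurable hmp.measurable]
  congr 1
  ext y : 1
  exact ulTheta_mul n x y

theorem ulMeasure_image_prod (n : ℕ) (s : Set (SpecialLinearGroup (Fin (n + 1)) ℚ_[p])) :
    ulMeasure ℚ_[p] (n + 1) (ulToSL ⁻¹' s) =
      slMeasure ℚ_[p] (n + 1) s * ENNReal.ofReal (1 - 1 / (p : ℝ)) := by
  rw [ulMeasure_eq_map, ← unitMeasure_univ, ← Measure.prod_prod]
  change Measure.map (ulThetaHomeo n) _ _ = _
  rw [(ulThetaHomeo n).measurableEmbedding.map_apply]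
  congr 1
  ext x
  change ulToSL (ulTheta n x) ∈ s ↔ _
  simp [ulToSL_ulTheta]

theorem ofReal_one_sub_inv_prime_ne_zero : ENNReal.ofReal (1 - 1 / (p : ℝ)) ≠ 0 := by
  have : (1 : ℝ) < p := by exact_mod_cast hp.out.one_lt
  rw [ne_eq, ENNReal.ofReal_eq_zero, not_le, sub_pos]
  exact (div_lt_one (by positivity)).2 this

/-- The units are compact, so the preimage under `ulToSL` of a compact neighbourhood is again
compact, of finite positive measure. -/
instance instHaarULPadic (n : ℕ) : (ulMeasure ℚ_[p] (n + 1)).IsHaarMeasure := by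
  have := isMulLeftInvariant_ulMeasure (p := p) n
  obtain ⟨C, hC, hC1⟩ := exists_compact_mem_nhds (1 : SpecialLinearGroup (Fin (n + 1)) ℚ_[p])
  have himage : ulToSL (p := p) ⁻¹' C = ulThetaHomeo n '' (C ×ˢ Set.univ) := by
    rw [← Homeomorph.preimage_symm]
    ext g
    change _ ↔ (ulToSL g, ulDet g) ∈ C ×ˢ Set.univ
    simp
  have hint : ulToSL ⁻¹' (interior C) ⊆ interior (ulToSL (p := p) (n := n) ⁻¹' C) :=
    interior_maximal (Set.preimage_mono interior_subset)
      (isOpen_interior.preimage continuous_ulToSL)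
  refine Measure.isHaarMeasure_of_isCompact_nonempty_interior _ (ulToSL (p := p) ⁻¹' C) ?_ ?_ ?_ ?_
  · rw [himage]
    exact (hC.prod isCompact_univ).image (ulThetaHomeo n).continuous
  · refine Set.Nonempty.mono hint ?_
    obtain ⟨x, hx⟩ := (ulThetaHomeo (p := p) n).symm.surjective (1, ⟨1, norm_one⟩)
    refine ⟨x, ?_⟩
    rw [Set.mem_preimage, show ulToSL x = 1 from congrArg Prod.fst hx]
    exact mem_interior_iff_mem_nhds.2 hC1
  · rw [ulMeasure_image_prod]
    exact mul_ne_zero (Measure.measure_pos_of_mem_nhds _ hC1).ne' ofReal_one_sub_inv_prime_ne_zero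
  · rw [ulMeasure_image_prod]
    exact ENNReal.mul_ne_top hC.measure_ne_top ENNReal.ofReal_ne_top

instance locallyCompactULPadic (n : ℕ) : LocallyCompactSpace (UL (n + 1) ℚ_[p]) :=
  (ulThetaHomeo n).symm.isClosedEmbedding.locallyCompactSpace

end ULCoordinates

/-! ### Approximation by `S`-integers -/

section Approximation

variable {S : Finset Nat.Primes}

theorem inv_prime_mem_SInt (p : S) : ((p : Nat.Primes) : ℚ)⁻¹ ∈ SInt S := by
  intro q hq
  have hne : (q : ℕ) ≠ (p : Nat.Primes) := fun h => hq (Nat.Primes.coe_nat_injective h ▸ p.2)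
  have h : padicNorm q (((p : Nat.Primes) : ℕ) : ℚ) = 1 :=
    (padicNorm.nat_eq_one_iff _).2 fun h => hne ((Nat.prime_dvd_prime_iff_eq q.2 p.1.2).1 h)
  rw [← one_div, padicNorm.div, padicNorm.one, h, div_one]

/-- The inverse of an element of `S` as an `S`-integer. -/
def invPrime (p : S) : SInt S := ⟨((p : Nat.Primes) : ℚ)⁻¹, inv_prime_mem_SInt p⟩

theorem sIntHom_invPrime (K : Type) [Field K] [CharZero K] (p : S) :
    sIntHom S K (invPrime p) = ((p : Nat.Primes) : K)⁻¹ := by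
  change ((((p : Nat.Primes) : ℚ)⁻¹ : ℚ) : K) = _
  push_cast
  rfl

theorem sIntHom_injective (K : Type) [Field K] [CharZero K] :
    Function.Injective (sIntHom S K) :=
  (Rat.castHom K).injective.comp Subtype.val_injective

theorem norm_sIntHom (p : S) (z : SInt S) :
    ‖sIntHom S ℚ_[(p : Nat.Primes)] z‖ = padicNorm (p : Nat.Primes) z.1 :=
  Padic.eq_padicNorm _

theorem exists_natCast_norm_sub_lt {p : ℕ} [Fact p.Prime] {x : ℚ_[p]} (hx : ‖x‖ ≤ 1) {ε : ℝ}
    (hε : 0 < ε) : ∃ a : ℕ, ‖x - a‖ < ε := by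
  obtain ⟨a, ha⟩ := (PadicInt.denseRange_natCast (p := p)).exists_dist_lt ⟨x, hx⟩ hε
  exact ⟨a, ha⟩

/-- The approximant is m p⁻ᵏ a. Here `m`, a high power of the product of the other primes of `S`, is
a unit at `p` and small elsewhere; pᵏ clears the denominator of `c`; and `a` approximates c pᵏ / m
in ℤ_p. -/
theorem single_mem_closure_range_sIntHom (p : S) (c : ℚ_[(p : Nat.Primes)]) :
    (Pi.single p c : ∀ q : S, ℚ_[(q : Nat.Primes)]) ∈
      closure (Set.range fun (z : SInt S) (q : S) => sIntHom S ℚ_[(q : Nat.Primes)] z) := by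
  rw [Metric.mem_closure_range_iff]
  intro ε hε
  -- Since every prime is at least 2, 2⁻ᴺ < ε bounds q⁻ᴺ at all other places at once.
  obtain ⟨N, hN⟩ := exists_pow_lt_of_lt_one hε (one_half_lt_one (α := ℝ))
  let m : ℕ := (∏ q ∈ S.erase p, (q : ℕ)) ^ N
  have hmp : ‖(m : ℚ_[(p : Nat.Primes)])‖ = 1 := by
    have h : ¬ ((p : Nat.Primes) : ℕ) ∣ m := fun h => by
      obtain ⟨q, hq, hpq⟩ := (p.1.2.prime.dvd_finsetProd_iff _).1 (p.1.2.dvd_of_dvd_pow h)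
      have := (Nat.prime_dvd_prime_iff_eq p.1.2 q.2).1 hpq
      exact Finset.ne_of_mem_erase hq (Nat.Primes.coe_nat_injective this.symm)
    exact Padic.norm_natCast_eq_one_iff.2 (p.1.2.coprime_iff_not_dvd.2 h)
  have hmq : ∀ q : S, q ≠ p → ‖(m : ℚ_[(q : Nat.Primes)])‖ < ε := by
    intro q hq
    have hdvd : ((q : Nat.Primes) : ℕ) ^ N ∣ m := pow_dvd_pow_of_dvd
      (Finset.dvd_prod_of_mem (fun q : Nat.Primes => (q : ℕ))
        (Finset.mem_erase.2 ⟨fun h => hq (Subtype.ext h), q.2⟩)) N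
    have h2 : ‖((m : ℤ) : ℚ_[(q : Nat.Primes)])‖ ≤ ((q : Nat.Primes) : ℝ) ^ (-N : ℤ) :=
      (Padic.norm_int_le_pow_iff_dvd _ _).2 (by exact_mod_cast hdvd)
    rw [Int.cast_natCast] at h2
    refine h2.trans_lt (lt_of_le_of_lt ?_ hN)
    rw [_root_.zpow_neg, zpow_natCast, ← inv_pow]
    refine pow_le_pow_left₀ (by positivity) ?_ N
    rw [one_div]
    exact inv_anti₀ two_pos (by exact_mod_cast q.1.2.two_le)
  have hm0 : (m : ℚ_[(p : Nat.Primes)]) ≠ 0 := by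
    intro h
    rw [h, norm_zero] at hmp
    exact zero_ne_one hmp
  have hp0 : (((p : Nat.Primes) : ℕ) : ℚ_[(p : Nat.Primes)]) ≠ 0 := by
    exact_mod_cast p.1.2.ne_zero
  obtain ⟨k, hk⟩ : ∃ k : ℕ, ‖c * ((p : Nat.Primes) : ℚ_[(p : Nat.Primes)]) ^ k‖ ≤ 1 := by
    have h1 : Filter.Tendsto (fun k : ℕ => c * ((p : Nat.Primes) : ℚ_[(p : Nat.Primes)]) ^ k)
        Filter.atTop (nhds (c * 0)) :=
      (tendsto_pow_atTop_nhds_zero_of_norm_lt_one Padic.norm_p_lt_one).const_mul c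
    rw [mul_zero] at h1
    obtain ⟨k, hk⟩ := (h1.eventually (Metric.ball_mem_nhds 0 one_pos)).exists
    exact ⟨k, (mem_ball_zero_iff.1 hk).le⟩
  have hx : ‖c * ((p : Nat.Primes) : ℚ_[(p : Nat.Primes)]) ^ k / m‖ ≤ 1 := by
    rw [norm_div, hmp, div_one]
    exact hk
  -- The precision ε‖pᵏ‖ makes up for the later division by pᵏ.
  obtain ⟨a, ha⟩ := exists_natCast_norm_sub_lt hx
    (mul_pos hε (norm_pos_iff.2 (pow_ne_zero k hp0)))
  refine ⟨m * invPrime p ^ k * a, (dist_pi_lt_iff hε).2 fun q => ?_⟩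
  rw [dist_eq_norm, map_mul, map_mul, map_pow, map_natCast, map_natCast, sIntHom_invPrime]
  by_cases hq : q = p
  · subst hq
    rw [Pi.single_eq_same]
    have e : c - m * ((q : Nat.Primes) : ℚ_[(q : Nat.Primes)])⁻¹ ^ k * a =
        m * (((q : Nat.Primes) : ℚ_[(q : Nat.Primes)]) ^ k)⁻¹ *
          (c * ((q : Nat.Primes) : ℚ_[(q : Nat.Primes)]) ^ k / m - a) := by
      rw [inv_pow]
      field_simp
    rw [e, norm_mul, norm_mul, hmp, one_mul, norm_inv, inv_mul_lt_iff₀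
      (norm_pos_iff.2 (pow_ne_zero k hp0)), mul_comm _ ε]
    exact ha
  · rw [Pi.single_eq_of_ne hq, zero_sub, norm_neg, norm_mul, norm_mul]
    have h1 : ‖(a : ℚ_[(q : Nat.Primes)])‖ ≤ 1 := Padic.norm_int_le_one (a : ℤ)
    have h2 : ‖((((p : Nat.Primes) : ℕ) : ℚ_[(q : Nat.Primes)])⁻¹ ^ k)‖ = 1 := by
      have hne : ¬ ((q : Nat.Primes) : ℕ) ∣ (p : Nat.Primes) := fun h =>
        hq (Subtype.ext (Nat.Primes.coe_nat_injective
          ((Nat.prime_dvd_prime_iff_eq q.1.2 p.1.2).1 h)))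
      have h4 : ‖(((p : Nat.Primes) : ℕ) : ℚ_[(q : Nat.Primes)])‖ = 1 :=
        Padic.norm_natCast_eq_one_iff.2 (q.1.2.coprime_iff_not_dvd.2 hne)
      rw [norm_pow, norm_inv, h4, inv_one, one_pow]
    rw [h2, mul_one]
    exact (mul_le_of_le_one_right (norm_nonneg _) h1).trans_lt (hmq q hq)

variable (S) in
/-- The diagonal embedding of `SL(ℤ_S)` in the product of the groups `SL(ℚ_p)`, for `p ∈ S`. -/
def slFinHom (n : ℕ) : SpecialLinearGroup (Fin n) (SInt S) →*
    ∀ p : S, SpecialLinearGroup (Fin n) ℚ_[(p : Nat.Primes)] :=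
  MonoidHom.pi fun p : S => SpecialLinearGroup.map (sIntHom S ℚ_[(p : Nat.Primes)])

theorem sl_transvection_zero {ι R : Type*} [Fintype ι] [DecidableEq ι] [CommRing R] {i j : ι}
    (hij : i ≠ j) : SpecialLinearGroup.transvection hij (0 : R) = 1 := by
  refine toMat_injective ?_
  change 1 + Matrix.single i j (0 : R) = 1
  rw [Matrix.single_zero, add_zero]

theorem continuous_sl_transvection {ι R : Type*} [Fintype ι] [DecidableEq ι] [CommRing R]
    [TopologicalSpace R] [IsTopologicalRing R] {i j : ι} (hij : i ≠ j) :
    Continuous fun c : R => SpecialLinearGroup.transvection hij c := by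
  refine Continuous.subtype_mk ?_ _
  change Continuous fun c : R => (1 : Matrix ι ι R) + Matrix.single i j c
  refine continuous_const.add (continuous_matrix fun a b => ?_)
  simp only [Matrix.single_apply]
  split_ifs
  · exact continuous_id
  · exact continuous_const

/-- The elements at `p` whose one-place embedding lies in the closure form a subgroup. By
approximation of the parameter it contains all transvections, which generate. -/
theorem mulSingle_mem_closure_slFinHom (n : ℕ) (p : S)
    (g : SpecialLinearGroup (Fin (n + 1)) ℚ_[(p : Nat.Primes)]) :
    Pi.mulSingle p g ∈ (slFinHom S (n + 1)).range.topologicalClosure := by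
  cases n with
  | zero =>
    have : Subsingleton (Fin (0 + 1)) := inferInstanceAs (Subsingleton (Fin 1))
    have : g = 1 := Subsingleton.elim _ _
    rw [this, Pi.mulSingle_one]
    exact one_mem _
  | succ n =>
    have h := closure_transvections_eq_top
      ((slFinHom S (n + 2)).range.topologicalClosure.comap (MonoidHom.mulSingle
        (fun q : S => SpecialLinearGroup (Fin (n + 2)) ℚ_[(q : Nat.Primes)]) p))
      (fun i j hij c => ?_)
    · have hg : g ∈ (⊤ : Subgroup (SpecialLinearGroup (Fin (n + 2)) ℚ_[(p : Nat.Primes)])) :=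
        Subgroup.mem_top g
      rw [← h] at hg
      exact hg
    · have hcont : Continuous fun (c : ∀ q : S, ℚ_[(q : Nat.Primes)]) (q : S) =>
          SpecialLinearGroup.transvection hij (c q) :=
        continuous_pi fun q => (continuous_sl_transvection hij).comp (continuous_apply q)
      have hmem := map_mem_closure (t := (slFinHom S (n + 2)).range) hcont
        (single_mem_closure_range_sIntHom p c) ?_
      · have e : (fun q : S => SpecialLinearGroup.transvection hij
            ((Pi.single p c : ∀ q : S, ℚ_[(q : Nat.Primes)]) q)) =
            Pi.mulSingle p (SpecialLinearGroup.transvection hij c) := by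
          ext q : 1
          by_cases hq : q = p
          · subst hq
            rw [Pi.single_eq_same, Pi.mulSingle_eq_same]
          · rw [Pi.single_eq_of_ne hq, Pi.mulSingle_eq_of_ne hq, sl_transvection_zero]
        rw [e] at hmem
        exact hmem
      · rintro _ ⟨z, rfl⟩
        refine ⟨SpecialLinearGroup.transvection hij z, ?_⟩
        ext q : 1
        refine toMat_injective ?_
        change ((1 : Matrix (Fin (n + 2)) (Fin (n + 2)) (SInt S)) + Matrix.single i j z).map
          (sIntHom S ℚ_[(q : Nat.Primes)]) = 1 + Matrix.single i j (sIntHom S _ z)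
        rw [Matrix.map_add _ (map_add _), Matrix.map_one _ (map_zero _) (map_one _),
          Matrix.map_single]

/-- Strong approximation, for the open subgroup `∏ SL(ℤ_p)`. -/
theorem exists_slFinHom_mul_mem (n : ℕ)
    (g : ∀ p : S, SpecialLinearGroup (Fin (n + 1)) ℚ_[(p : Nat.Primes)]) :
    ∃ γ, ∀ p : S, slFinHom S (n + 1) γ p * g p ∈ slIntegral (p : Nat.Primes) (n + 1) := by
  -- The closure contains the elements supported at one place, hence the whole finite product. So
  -- the open set of `x` with `x * g` integral, which contains `g⁻¹`, meets SL(ℤ_S).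
  have hg : g⁻¹ ∈ (slFinHom S (n + 1)).range.topologicalClosure :=
    Subgroup.pi_mem_of_mulSingle_mem _ fun p => mulSingle_mem_closure_slFinHom n p _
  have hopen : IsOpen (⋂ p : S, {x : ∀ p : S, SpecialLinearGroup (Fin (n + 1)) ℚ_[(p : Nat.Primes)] |
      x p * g p ∈ slIntegral (p : Nat.Primes) (n + 1)}) :=
    isOpen_iInter_of_finite fun p => (isOpen_slIntegral (p := (p : Nat.Primes)) (n + 1)).preimage
      ((continuous_apply p).mul continuous_const)
  obtain ⟨_, hx, γ, rfl⟩ := mem_closure_iff.1 hg _ hopen (Set.mem_iInter.2 fun p => by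
    change (g p)⁻¹ * g p ∈ slIntegral (p : Nat.Primes) (n + 1)
    rw [inv_mul_cancel]
    exact one_mem _)
  exact ⟨γ, fun p => Set.mem_iInter.1 hx p⟩

/-! ### Fundamental domains of the `S`-arithmetic groups -/

variable (S) in
/-- The diagonal embedding of `SL(ℤ_S)` in `SL(ℚ_S)`. -/
def slDiagHom (n : ℕ) : SpecialLinearGroup (Fin n) (SInt S) →* SLQS S n :=
  (SpecialLinearGroup.map (sIntHom S ℝ)).prod (slFinHom S n)

theorem exists_int_of_padicNorm_le_one {z : ℚ} (hz : ∀ p : Nat.Primes, padicNorm p z ≤ 1) :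
    ∃ k : ℤ, (k : ℚ) = z := by
  refine ⟨z.num, Rat.coe_int_num_of_den_eq_one ?_⟩
  by_contra hden
  obtain ⟨p, hp, hpd⟩ := Nat.exists_prime_and_dvd hden
  have := Fact.mk hp
  have hnum : ¬ (p : ℤ) ∣ z.num := fun h => by
    have h1 := Nat.dvd_gcd (Int.natCast_dvd.1 h) hpd
    rw [z.reduced] at h1
    exact hp.one_lt.ne' (Nat.dvd_one.1 h1)
  have h2 := hz ⟨p, hp⟩
  have h3 : padicNorm p z = padicNorm p z.num / padicNorm p z.den := by
    rw [← padicNorm.div, Rat.num_div_den]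
  change padicNorm p z ≤ 1 at h2
  rw [h3, (padicNorm.int_eq_one_iff _).2 hnum] at h2
  have h4 : padicNorm p (z.den : ℚ) < 1 := (padicNorm.nat_lt_one_iff _).2 hpd
  have h5 : 0 < padicNorm p (z.den : ℚ) :=
    lt_of_le_of_ne (padicNorm.nonneg _) (Ne.symm (padicNorm.nonzero (by simp)))
  rw [div_le_one h5] at h2
  exact h4.not_ge h2

theorem map_int_mem_slIntegral {n : ℕ} (η : SpecialLinearGroup (Fin n) ℤ) (p : S) :
    slFinHom S n (SpecialLinearGroup.map (Int.castRingHom (SInt S)) η) p ∈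
      slIntegral (p : Nat.Primes) n := by
  refine mem_slIntegral.2 fun i j => ?_
  change ‖sIntHom S ℚ_[(p : Nat.Primes)] ((toMat η i j : ℤ) : SInt S)‖ ≤ 1
  rw [map_intCast]
  exact Padic.norm_int_le_one _

/-- The entries are integral at the primes outside `S` by definition and at those in `S` by
hypothesis, so they are integers. -/
theorem exists_int_of_slFinHom_mem {n : ℕ} {γ : SpecialLinearGroup (Fin n) (SInt S)}
    (h : ∀ p : S, slFinHom S n γ p ∈ slIntegral (p : Nat.Primes) n) :
    ∃ η : SpecialLinearGroup (Fin n) ℤ,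
      SpecialLinearGroup.map (Int.castRingHom (SInt S)) η = γ := by
  have hint : ∀ i j, ∃ k : ℤ, (k : ℚ) = (toMat γ i j).1 := fun i j => by
    refine exists_int_of_padicNorm_le_one fun p => ?_
    by_cases hp : p ∈ S
    · have h1 := mem_slIntegral.1 (h ⟨p, hp⟩) i j
      have h2 := norm_sIntHom ⟨p, hp⟩ (toMat γ i j)
      have h3 : ((padicNorm p (toMat γ i j).1 : ℚ) : ℝ) ≤ 1 := h2 ▸ h1
      exact_mod_cast h3
    · exact (toMat γ i j).2 p hp
  choose A hA using hint
  have hmap : (Matrix.of A).map (Int.castRingHom (SInt S)) = toMat γ := by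
    refine Matrix.ext fun i j => Subtype.ext ?_
    rw [← hA]
    simp
  refine ⟨⟨Matrix.of A, ?_⟩, toMat_injective hmap⟩
  have hdet := RingHom.map_det (Int.castRingHom (SInt S)) (Matrix.of A)
  rw [RingHom.mapMatrix_apply, hmap, det_toMat] at hdet
  have h1 := congrArg Subtype.val hdet
  simp only [eq_intCast, Subring.coe_one, SubringClass.coe_intCast] at h1
  exact_mod_cast h1

theorem map_sIntHom_map_int {n : ℕ} (η : SpecialLinearGroup (Fin (n + 1)) ℤ) :
    SpecialLinearGroup.map (sIntHom S ℝ)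
      (SpecialLinearGroup.map (Int.castRingHom (SInt S)) η) = slIntHom n η := by
  refine toMat_injective (Matrix.ext fun i j => ?_)
  change sIntHom S ℝ ((toMat η i j : ℤ) : SInt S) = ((toMat η i j : ℤ) : ℝ)
  exact map_intCast _ _

variable (S) in
/-- The product of a subset of `SL(ℝ)` and the groups `SL(ℤ_p)`, for `p ∈ S`. -/
def slDomain (n : ℕ) (F : Set (SpecialLinearGroup (Fin n) ℝ)) : Set (SLQS S n) :=
  F ×ˢ Set.univ.pi fun p : S => (slIntegral (p : Nat.Primes) n : Set _)

/-- Strong approximation makes the finite components integral; the remaining freedom is exactly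
SL(ℤ), and `F` singles out one element of it by the real component. -/
theorem isStrictDomain_slDomain {n : ℕ} {F : Set (SpecialLinearGroup (Fin (n + 1)) ℝ)}
    (hF : IsStrictDomain (slIntHom n) F) :
    IsStrictDomain (slDiagHom S (n + 1)) (slDomain S (n + 1) F) := by
  refine ⟨hF.1.prod (MeasurableSet.univ_pi fun p =>
    (isOpen_slIntegral (p := (p : Nat.Primes)) _).measurableSet), fun x => ?_⟩
  obtain ⟨δ, hδ⟩ := exists_slFinHom_mul_mem n x.2
  obtain ⟨η, hη, hη'⟩ := hF.2 (SpecialLinearGroup.map (sIntHom S ℝ) δ * x.1)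
  refine ⟨SpecialLinearGroup.map (Int.castRingHom (SInt S)) η * δ, ⟨?_, fun p _ => ?_⟩, ?_⟩
  · change SpecialLinearGroup.map (sIntHom S ℝ) (_ * δ) * x.1 ∈ F
    rw [map_mul, map_sIntHom_map_int, mul_assoc]
    exact hη
  · change slFinHom S (n + 1) (_ * δ) p * x.2 p ∈ slIntegral (p : Nat.Primes) (n + 1)
    rw [map_mul, Pi.mul_apply, mul_assoc]
    exact mul_mem (map_int_mem_slIntegral η p) (hδ p)
  · rintro γ ⟨hγ1, hγ2⟩
    have hmem : ∀ p : S, slFinHom S (n + 1) (γ * δ⁻¹) p ∈ slIntegral (p : Nat.Primes) (n + 1) := by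
      intro p
      have h1 : slFinHom S (n + 1) γ p * x.2 p ∈ slIntegral (p : Nat.Primes) (n + 1) :=
        hγ2 p (Set.mem_univ p)
      have h2 := mul_mem h1 (inv_mem (hδ p))
      rw [_root_.mul_inv_rev, mul_assoc, mul_inv_cancel_left] at h2
      rw [map_mul, map_inv]
      exact h2
    obtain ⟨θ, hθ⟩ := exists_int_of_slFinHom_mem hmem
    have hγ : γ = SpecialLinearGroup.map (Int.castRingHom (SInt S)) θ * δ := by
      rw [hθ, inv_mul_cancel_right]
    have hθη : θ = η := by
      refine hη' θ ?_
      change slIntHom n θ * (SpecialLinearGroup.map (sIntHom S ℝ) δ * x.1) ∈ F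
      rw [← map_sIntHom_map_int (S := S), ← mul_assoc, ← map_mul, ← hγ]
      exact hγ1
    rw [hγ, hθη]

/-- A strict domain is a fundamental domain for the image, and for a countable group and an
invariant measure all fundamental domains have the same measure. -/
theorem hasCovolume_range_of_isStrictDomain {G Δ : Type} [Group G] [MeasurableSpace G]
    [MeasurableMul G] [Group Δ] [Countable Δ] {i : Δ →* G} {F : Set G} (hF : IsStrictDomain i F)
    (μ : Measure G) [μ.IsMulLeftInvariant] : HasCovolume i.range μ (μ F) := by
  have hfund : IsFundamentalDomain i.range F μ := by
    refine IsFundamentalDomain.mk' hF.1.nullMeasurableSet fun x => ?_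
    obtain ⟨γ, hγ, huniq⟩ := hF.2 x
    refine ⟨⟨i γ, γ, rfl⟩, hγ, ?_⟩
    rintro ⟨_, δ, rfl⟩ hδ
    exact Subtype.ext (congrArg i (huniq δ hδ))
  have : Countable i.range := i.rangeRestrict_surjective.countable
  exact ⟨⟨F, hfund⟩, fun F' hF' => hF'.measure_eq hfund⟩

instance countableSInt : Countable (SInt S) := Subtype.val_injective.countable

instance countableSLSInt (n : ℕ) : Countable (SpecialLinearGroup (Fin n) (SInt S)) :=
  have : Countable (Matrix (Fin n) (Fin n) (SInt S)) :=
    inferInstanceAs (Countable (Fin n → Fin n → SInt S))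
  toMat_injective.countable

/-- The inclusion of `SL` in `UL`. -/
def slToUL (n : ℕ) (K : Type) [NormedField K] : SpecialLinearGroup (Fin n) K →* UL n K :=
  SpecialLinearGroup.toGL.codRestrict (UL n K) fun g => by
    change ‖(toMat g).det‖ = 1
    rw [det_toMat, norm_one]

variable (S) in
/-- The diagonal embedding of `SL(ℤ_S)` in `UL(ℚ_S)`. -/
def ulDiagHom (n : ℕ) : SpecialLinearGroup (Fin n) (SInt S) →* ULQS S n :=
  (SpecialLinearGroup.map (sIntHom S ℝ)).prod (MonoidHom.pi fun p : S =>
    (slToUL n ℚ_[(p : Nat.Primes)]).comp (SpecialLinearGroup.map (sIntHom S _)))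

/-- The real component has determinant 1 and ℤ_S embeds in ℝ, so a matrix giving an element of
UL(ℤ_S) already lies in SL(ℤ_S). -/
theorem ulDiagHom_range (n : ℕ) : (ulDiagHom S n).range = ULZS S n := by
  ext g
  constructor
  · rintro ⟨γ, rfl⟩
    refine ⟨SpecialLinearGroup.toGL γ, Units.ext ?_, fun p => Units.ext ?_⟩ <;> rfl
  · rintro ⟨γ, h, h'⟩
    have hdet : (γ : Matrix (Fin n) (Fin n) (SInt S)).det = 1 := by
      refine sIntHom_injective ℝ ?_
      have h1 : toMat g.1 = (γ : Matrix (Fin n) (Fin n) (SInt S)).map (sIntHom S ℝ) :=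
        congrArg Units.val h
      have h2 := RingHom.map_det (sIntHom S ℝ) (γ : Matrix (Fin n) (Fin n) (SInt S))
      rw [RingHom.mapMatrix_apply, ← h1, det_toMat] at h2
      rw [h2, map_one]
    refine ⟨⟨γ, hdet⟩, Prod.ext (toMat_injective (congrArg Units.val h).symm) ?_⟩
    ext p : 1
    exact Subtype.ext (Units.ext (congrArg Units.val (h' p)).symm)

/-- The projection of `UL(ℚ_S)` to `SL(ℚ_S)`. -/
def ulProj {n : ℕ} (x : ULQS S (n + 1)) : SLQS S (n + 1) := (x.1, fun p => ulToSL (x.2 p))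

/-- `ulToSL` corrects the determinant by a factor on the right, so it commutes with left
multiplication by `SL`. Hence strict domains pull back along `ulProj`. -/
theorem ulToSL_slToUL_mul {p : ℕ} [Fact p.Prime] {n : ℕ}
    (s : SpecialLinearGroup (Fin (n + 1)) ℚ_[p]) (g : UL (n + 1) ℚ_[p]) :
    ulToSL (slToUL _ _ s * g) = s * ulToSL g := by
  have hdet : ulDet (slToUL _ _ s * g) = ulDet g := by
    refine Subtype.ext ?_
    change (toMat s * ulMat g).det = (ulMat g).det
    rw [det_mul, det_toMat, one_mul]
  refine toMat_injective ?_
  rw [toMat_mul, toMat_ulToSL, toMat_ulToSL, hdet, ← Matrix.mul_assoc]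
  rfl

theorem ulProj_ulDiagHom_mul {n : ℕ} (γ : SpecialLinearGroup (Fin (n + 1)) (SInt S))
    (x : ULQS S (n + 1)) : ulProj (ulDiagHom S (n + 1) γ * x) = slDiagHom S (n + 1) γ * ulProj x :=
  Prod.ext rfl (funext fun _ => ulToSL_slToUL_mul _ _)

theorem ulProj_preimage_slDomain {n : ℕ} (F : Set (SpecialLinearGroup (Fin (n + 1)) ℝ)) :
    ulProj ⁻¹' (slDomain S (n + 1) F) = F ×ˢ Set.univ.pi fun p : S =>
      ulToSL ⁻¹' (slIntegral (p : Nat.Primes) (n + 1) : Set _) := rfl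

theorem isStrictDomain_ulProj_preimage {n : ℕ} {F : Set (SpecialLinearGroup (Fin (n + 1)) ℝ)}
    (hF : IsStrictDomain (slIntHom n) F) :
    IsStrictDomain (ulDiagHom S (n + 1)) (ulProj ⁻¹' (slDomain S (n + 1) F)) := by
  constructor
  · rw [ulProj_preimage_slDomain]
    exact hF.1.prod (MeasurableSet.univ_pi fun p => continuous_ulToSL.measurable
      (isOpen_slIntegral (p := (p : Nat.Primes)) _).measurableSet)
  · intro x
    simp only [Set.mem_preimage, ulProj_ulDiagHom_mul]
    exact (isStrictDomain_slDomain hF).2 _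

end Approximation

/-! ### The values of the zeta function -/

section Zeta

/-- The positive integers that are coprime to all elements of `S`. -/
def coprimeSet (S : Finset Nat.Primes) : Set ℕ := {t | 0 < t ∧ t.Coprime (∏ p ∈ S, (p : ℕ))}

theorem zetaS_eq_tsum_coprimeSet (S : Finset Nat.Primes) (k : ℕ) :
    zetaS S k = ∑' t : coprimeSet S, 1 / ((t : ℕ) : ℝ) ^ k := rfl

theorem coprimeSet_eq_union {S : Finset Nat.Primes} {p : Nat.Primes} (hp : p ∉ S) :
    coprimeSet S = coprimeSet (insert p S) ∪ (fun t => (p : ℕ) * t) '' coprimeSet S := by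
  have hpS : (p : ℕ).Coprime (∏ q ∈ S, (q : ℕ)) := Nat.Coprime.prod_right fun q hq =>
    (Nat.coprime_primes p.2 q.2).2 fun h => hp (Nat.Primes.coe_nat_injective h ▸ hq)
  ext t
  constructor
  · rintro ⟨h0, h⟩
    by_cases hpt : (p : ℕ) ∣ t
    · obtain ⟨s, rfl⟩ := hpt
      exact Or.inr ⟨s, ⟨Nat.pos_of_mul_pos_left h0, Nat.Coprime.coprime_mul_left h⟩, rfl⟩
    · refine Or.inl ⟨h0, ?_⟩
      rw [Finset.prod_insert hp]
      exact Nat.Coprime.mul_right ((p.2.coprime_iff_not_dvd.2 hpt).symm) h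
  · rintro (⟨h0, h⟩ | ⟨s, ⟨h0, h⟩, rfl⟩)
    · rw [Finset.prod_insert hp] at h
      exact ⟨h0, Nat.Coprime.coprime_mul_left_right h⟩
    · exact ⟨Nat.mul_pos p.2.pos h0, Nat.Coprime.mul_left hpS h⟩

theorem disjoint_coprimeSet {S : Finset Nat.Primes} {p : Nat.Primes} (hp : p ∉ S) :
    Disjoint (coprimeSet (insert p S)) ((fun t => (p : ℕ) * t) '' coprimeSet S) := by
  rw [Set.disjoint_left]
  rintro _ ⟨_, h⟩ ⟨s, _, rfl⟩
  rw [Finset.prod_insert hp] at h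
  exact p.2.one_lt.ne' (Nat.Coprime.eq_one_of_dvd (Nat.Coprime.coprime_mul_right_right h).symm
    (Dvd.intro s rfl))

/-- The terms divisible by `p` contribute `1 / p ^ k` times the whole sum, so excluding them removes
the Euler factor at `p`. -/
theorem zetaS_insert {S : Finset Nat.Primes} {p : Nat.Primes} (hp : p ∉ S) {k : ℕ} (hk : 2 ≤ k) :
    zetaS (insert p S) k = (1 - 1 / (p : ℝ) ^ k) * zetaS S k := by
  have hsum : Summable fun t : ℕ => 1 / (t : ℝ) ^ k := Real.summable_one_div_nat_pow.2 hk
  have hinj : Function.Injective fun t => (p : ℕ) * t := fun a b h =>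
    Nat.eq_of_mul_eq_mul_left p.2.pos h
  have h1 : zetaS S k = zetaS (insert p S) k + 1 / (p : ℝ) ^ k * zetaS S k := by
    conv_lhs => rw [zetaS_eq_tsum_coprimeSet, coprimeSet_eq_union hp]
    rw [Summable.tsum_union_disjoint (f := fun t : ℕ => 1 / (t : ℝ) ^ k) (disjoint_coprimeSet hp)
      (hsum.subtype _) (hsum.subtype _), tsum_image (fun t : ℕ => 1 / (t : ℝ) ^ k) hinj.injOn]
    rw [zetaS_eq_tsum_coprimeSet, zetaS_eq_tsum_coprimeSet, ← tsum_mul_left]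
    congr 2
    ext t
    push_cast
    rw [mul_pow, one_div_mul_one_div]
  linarith

theorem zetaS_empty (k : ℕ) : zetaS ∅ k = ∑' t : ℕ, 1 / ((t + 1 : ℕ) : ℝ) ^ k := by
  rw [zetaS_eq_tsum_coprimeSet]
  have e : coprimeSet ∅ = Set.range Nat.succ := by
    ext t
    simp [coprimeSet, Nat.pos_iff_ne_zero]
  rw [e, tsum_range (fun t : ℕ => 1 / (t : ℝ) ^ k) Nat.succ_injective]

theorem one_sub_one_div_pow_nonneg (p : Nat.Primes) (k : ℕ) : (0 : ℝ) ≤ 1 - 1 / (p : ℝ) ^ k := by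
  have : (1 : ℝ) ≤ (p : ℝ) ^ k := one_le_pow₀ (by exact_mod_cast p.2.one_lt.le)
  rw [sub_nonneg]
  exact (div_le_one (by positivity)).2 this

theorem zetaS_nonneg (S : Finset Nat.Primes) (k : ℕ) : 0 ≤ zetaS S k :=
  tsum_nonneg fun _ => by positivity

theorem ofReal_zetaS (S : Finset Nat.Primes) {k : ℕ} (hk : 2 ≤ k) :
    ENNReal.ofReal (zetaS S k) =
      zetaENN k * ∏ p : S, ENNReal.ofReal (1 - 1 / ((p : Nat.Primes) : ℝ) ^ k) := by
  rw [Finset.prod_coe_sort S fun p : Nat.Primes => ENNReal.ofReal (1 - 1 / (p : ℝ) ^ k)]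
  induction S using Finset.induction_on with
  | empty =>
    rw [zetaS_empty k, Finset.prod_empty, mul_one, zetaENN,
      ENNReal.ofReal_tsum_of_nonneg (fun _ => by positivity) (summable_one_div_succ_pow hk)]
  | insert p S hp ih =>
    rw [zetaS_insert hp hk, ENNReal.ofReal_mul (one_sub_one_div_pow_nonneg p k), ih,
      Finset.prod_insert hp, mul_left_comm]

theorem ofReal_prod_zetaS (S : Finset Nat.Primes) (d : ℕ) :
    ENNReal.ofReal (∏ k ∈ Finset.Icc 2 d, zetaS S k) = (∏ k ∈ Finset.Icc 2 d, zetaENN k) *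
      ∏ p : S, ∏ k ∈ Finset.Icc 2 d, ENNReal.ofReal (1 - 1 / ((p : Nat.Primes) : ℝ) ^ k) := by
  rw [Finset.prod_comm, ← Finset.prod_mul_distrib,
    ENNReal.ofReal_prod_of_nonneg fun k _ => zetaS_nonneg S k]
  exact Finset.prod_congr rfl fun k hk => ofReal_zetaS S (Finset.mem_Icc.1 hk).1

end Zeta

/-! ### Haar measures and covolumes -/

/-- The real factor contributes the values ζ(k), and the volumes of the SL(ℤ_p) turn each of them
into ζ_S(k). -/
theorem nuS_slDomain (S : Finset Nat.Primes) {n : ℕ}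
    {F : Set (SpecialLinearGroup (Fin (n + 1)) ℝ)} (hF : IsStrictDomain (slIntHom n) F) :
    nuS S (n + 1) (slDomain S (n + 1) F) =
      ENNReal.ofReal (∏ k ∈ Finset.Icc 2 (n + 1), zetaS S k) := by
  rw [nuS, slDomain, Measure.prod_prod, Measure.pi_pi, slMeasure_strictDomain n hF,
    ofReal_prod_zetaS]
  congr 1
  exact Finset.prod_congr rfl fun p _ => slMeasure_slIntegral n

theorem muS_ulProj_preimage (S : Finset Nat.Primes) {n : ℕ}
    {F : Set (SpecialLinearGroup (Fin (n + 1)) ℝ)} (hF : IsStrictDomain (slIntHom n) F) :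
    muS S (n + 1) (ulProj ⁻¹' (slDomain S (n + 1) F)) =
      ENNReal.ofReal ((∏ p ∈ S, (1 - 1 / ((p : ℕ) : ℝ))) *
        ∏ k ∈ Finset.Icc 2 (n + 1), zetaS S k) := by
  have hnonneg : ∀ p ∈ S, (0 : ℝ) ≤ 1 - 1 / ((p : ℕ) : ℝ) := fun p _ => by
    simpa using one_sub_one_div_pow_nonneg p 1
  rw [muS, ulProj_preimage_slDomain, Measure.prod_prod, Measure.pi_pi,
    slMeasure_strictDomain n hF, ENNReal.ofReal_mul (Finset.prod_nonneg hnonneg),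
    ENNReal.ofReal_prod_of_nonneg hnonneg, ofReal_prod_zetaS,
    ← Finset.prod_coe_sort S fun p : Nat.Primes => ENNReal.ofReal (1 - 1 / (p : ℝ)),
    mul_left_comm, ← Finset.prod_mul_distrib]
  congr 1
  refine Finset.prod_congr rfl fun p _ => ?_
  rw [ulMeasure_image_prod, slMeasure_slIntegral, mul_comm]

end

theorem theorem3p4 (S : Finset Nat.Primes) (d : ℕ) (hd : 1 ≤ d) :
    (muS S d).IsHaarMeasure ∧ (nuS S d).IsHaarMeasure ∧
    HasCovolume (ULZS S d) (muS S d)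
      (ENNReal.ofReal ((∏ p ∈ S, (1 - 1 / ((p : ℕ) : ℝ))) * ∏ k ∈ Finset.Icc 2 d, zetaS S k)) ∧
    HasCovolume (SLZS S d) (nuS S d)
      (ENNReal.ofReal (∏ k ∈ Finset.Icc 2 d, zetaS S k)) := by
  obtain ⟨n, rfl⟩ := Nat.exists_eq_add_of_le' hd
  have hmu : (muS S (n + 1)).IsHaarMeasure := by
    have : (Measure.pi fun p : S => ulMeasure ℚ_[(p : Nat.Primes)] (n + 1)).IsHaarMeasure :=
      Measure.pi.isHaarMeasure _
    exact Measure.prod.instIsHaarMeasure _ _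
  have hnu : (nuS S (n + 1)).IsHaarMeasure := by
    have : (Measure.pi fun p : S => slMeasure ℚ_[(p : Nat.Primes)] (n + 1)).IsHaarMeasure :=
      Measure.pi.isHaarMeasure _
    exact Measure.prod.instIsHaarMeasure _ _
  -- One domain for SL(ℤ) serves both groups; evaluating the measures on the domains built from it
  -- gives the two covolumes.
  obtain ⟨F, hF⟩ := exists_isStrictDomain_slIntHom n
  refine ⟨hmu, hnu, ?_, ?_⟩
  · rw [← ulDiagHom_range, ← muS_ulProj_preimage S hF]
    exact hasCovolume_range_of_isStrictDomain (isStrictDomain_ulProj_preimage hF) _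
  · rw [← nuS_slDomain S hF]
    exact hasCovolume_range_of_isStrictDomain (isStrictDomain_slDomain hF) _
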